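/- **Setting.** Let $d\ge 2$, $\mathbf t\in[-1/2,1/2]^d$ and let $\{Z(\mathbf s):\mathbf s\in \mathbf Z^d\}$, $\mathbf Z^d=\mathbf t+\mathbb Z^d$, be a strictly stationary random field with values in $\mathbb R^p$ and mean $\mu$ (finite under the moment condition below). Write $|B|$ for the cardinality of a set $B$ of lattice points or indices and for the Lebesgue measure of a region $B\subset\mathbb R^d$. Let $R_0\subset(-1/2,1/2]^d$ be a Borel set containing a neighbourhood of the origin such that, for every sequence of positive reals $a_n\to0$, the number of cubes of the scaled lattice $a_n\mathbb Z^d$ meeting both $\overline{R_0}$ and $\overline{R_0^c}$ is $O(a_n^{-(d-1)})$. Let $\Delta_n=\mathrm{diag}(\lambda^{(n)}_1,\dots,\lambda^{(n)}_d)$ with positive entries, let ${}_s\lambda_n>0$, and put $R_n=\Delta_nR_0$, ${}_sR_n={}_s\lambda_nR_0$. Assume $$\frac{d}{{}_s\lambda_n}+\sum_{i=1}^d\frac{{}_s\lambda_n}{\lambda_i^{(n)}}+\frac{{}_s\lambda_n^{\,d+1}}{\det\Delta_n}\to0,\qquad \max_i\lambda_i^{(n)}=O\big(\min_i\lambda_i^{(n)}\big).$$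 Let $H:\mathbb R^p\to\mathbb R$. For $A\subset\mathbb R^d$ bounded let $N(A)=|\mathbf Z^d\cap A|$ and $\theta(A)=H\big(N(A)^{-1}\sum_{\mathbf s\in\mathbf Z^d\cap A}Z(\mathbf s)\big)$. Put $\tau_n^2=N(R_n)\,\mathrm{Var}(\theta(R_n))$. For a finite index set $J\subset\mathbb Z^d$ and regions $A_{\mathbf i}$, $\mathbf i\in J$, the subsample variance estimator is $$\hat\tau^2=|J|^{-1}\sum_{\mathbf i\in J}N(A_{\mathbf i})\Big(\theta(A_{\mathbf i})-|J|^{-1}\sum_{\mathbf j\in J}\theta(A_{\mathbf j})\Big)^2 .$$ The overlapping (OL) estimator $\hat\tau^2_{n,\mathrm{OL}}$ uses $A_{\mathbf i}=\mathbf i+{}_sR_n$ and $J=\{\mathbf i:\mathbf i+{}_sR_n\subset R_n\}$; the nonoverlapping (NOL) estimator $\hat\tau^2_{n,\mathrm{NOL}}$ uses $A_{\mathbf i}={}_s\lambda_n(\mathbf i+R_0)$ and $J=\{\mathbf i:{}_s\lambda_n(\mathbf i+(-1/2,1/2]^d)\subset R_n\}$. For $T_1,T_2\subset\mathbf Z^d$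 let $\tilde\alpha(T_1,T_2)=\sup|P(A\cap B)-P(A)P(B)|$ over $A\in\sigma(Z(\mathbf s):\mathbf s\in T_1)$, $B\in\sigma(Z(\mathbf s):\mathbf s\in T_2)$. Let $\mathrm{dis}$ be the $\ell^\infty$-distance of sets, and let $\alpha(k,l)$ be the supremum of $\tilde\alpha(T_1,T_2)$ over $|T_1|,|T_2|\le l$, $\mathrm{dis}(T_1,T_2)\ge k$. With $\nabla=\nabla H(\mu)$ put $\sigma(\mathbf k)=\mathrm{Cov}(\nabla'Z(\mathbf t),\nabla'Z(\mathbf t+\mathbf k))$, $\mathbf k\in\mathbb Z^d$. Assume, for some $a\in\{0,1,2,\dots\}$ and with $r=3+a$: - $H$ is three times continuously differentiable and, for some constant $c>0$, all its third-order partial derivatives are bounded in absolute value by $c(1+\|x\|^a)$. - There are nonnegative functions $\alpha_1,g$ on $(0,\infty)$ with $\alpha_1(k)\to0$ as $k\to\infty$, $g(l)\to\infty$ as $l\to\infty$ and $\alpha(k,l)\le\alpha_1(k)g(l)$ for all $k,l>0$. Moreover, for some $0<\delta\le1$, $0<\kappa<(2r-1-1/d)(2r+\delta)/\delta$ and $c>0$: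 $E\|Z(\mathbf t)\|^{2r+\delta}<\infty$, $\sum_{m\ge1}m^{(2r-1)d-1}\alpha_1(m)^{\delta/(2r+\delta)}<\infty$, and $g(x)\le c\,x^\kappa$ for $x\ge1$. - $\sup\{\tilde\alpha(T_1,T_2):|T_1|=1,\ \mathrm{dis}(T_1,T_2)\ge k\}=o(k^{-d})$ as $k\to\infty$. - $\tau^2=\sum_{\mathbf k\in\mathbb Z^d}\sigma(\mathbf k)>0$. **Theorem 4.1.** Let $C_n(\mathbf k)=|\mathbf Z^d\cap{}_sR_n\cap(\mathbf k+{}_sR_n)|$ and ${}_sN_n=|\mathbf Z^d\cap{}_sR_n|$, and suppose that $$\lim_{n\to\infty}\frac{{}_sN_n-C_n(\mathbf k)}{({}_s\lambda_n)^{d-1}}=C(\mathbf k)\quad\text{exists for all }\mathbf k\in\mathbb Z^d.$$ Then $S=\sum_{\mathbf k\in\mathbb Z^d}C(\mathbf k)\sigma(\mathbf k)$ converges absolutely, the variance and the expectations below are finite, and $$E(\hat\tau_n^2)-\tau_n^2=\frac{-1}{{}_s\lambda_n|R_0|}\,S+o\big({}_s\lambda_n^{-1}\big),$$ so that, if $S\neq0$,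 $$E(\hat\tau_n^2)-\tau_n^2=\frac{-1}{{}_s\lambda_n|R_0|}\Big(\sum_{\mathbf k\in\mathbb Z^d}C(\mathbf k)\sigma(\mathbf k)\Big)(1+o(1)),$$ where $\hat\tau_n^2$ is $\hat\tau^2_{n,\mathrm{OL}}$ or, provided that ${}_s\lambda_n$ is an integer for every $n$, $\hat\tau^2_{n,\mathrm{NOL}}$. -/

import Mathlib

open MeasureTheory ProbabilityTheory Filter Topology Asymptotics

noncomputable section

namespace SpatialSubsampling

/-! ### Regions and lattice counts

Points of the sampling space are `Fin d → ℝ`, whose norm is the sup norm. The sites of the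
translated lattice `t + ℤ^d` are labelled by `k : Fin d → ℤ`, the label of the site `t + k`. -/

/-- The cube `(-1/2, 1/2]^d`. -/
def unitCube (d : ℕ) : Set (Fin d → ℝ) := {x | ∀ i, -(1 / 2) < x i ∧ x i ≤ 1 / 2}

/-- The image of `A` under the diagonal matrix with diagonal `c`. -/
def scaleSet {d : ℕ} (c : Fin d → ℝ) (A : Set (Fin d → ℝ)) : Set (Fin d → ℝ) :=
  (fun x i => c i * x i) '' A

/-- The integer translate `k + A`. -/
def translate {d : ℕ} (k : Fin d → ℤ) (A : Set (Fin d → ℝ)) : Set (Fin d → ℝ) :=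
  (fun x i => (k i : ℝ) + x i) '' A

/-- The labels of the sites of `t + ℤ^d` that lie in `A`. -/
def sites {d : ℕ} (t : Fin d → ℝ) (A : Set (Fin d → ℝ)) : Set (Fin d → ℤ) :=
  {k | (fun i => t i + (k i : ℝ)) ∈ A}

/-- The number of sites of `t + ℤ^d` in `A`. -/
def siteCount {d : ℕ} (t : Fin d → ℝ) (A : Set (Fin d → ℝ)) : ℕ := (sites t A).ncard

/-- The cube with index `j` of the scaled lattice `a ℤ^d`, that is `a (j + [0,1]^d)`. -/
def latticeCube {d : ℕ} (a : ℝ) (j : Fin d → ℤ) : Set (Fin d → ℝ) :=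
  {x | ∀ i, a * (j i : ℝ) ≤ x i ∧ x i ≤ a * ((j i : ℝ) + 1)}

/-- A template set: a Borel subset of `(-1/2, 1/2]^d` containing a neighbourhood of the origin,
such that, whenever `0 < a_n → 0`, the number of cubes of `a_n ℤ^d` that meet both the closure of
`R0` and the closure of its complement is `O((1 / a_n)^(d-1))`. -/
structure IsTemplate {d : ℕ} (R0 : Set (Fin d → ℝ)) : Prop where
  measurableSet : MeasurableSet R0
  subset_unitCube : R0 ⊆ unitCube d
  mem_nhds_zero : R0 ∈ 𝓝 (0 : Fin d → ℝ)
  boundary : ∀ a : ℕ → ℝ, (∀ n, 0 < a n) → Tendsto a atTop (𝓝 0) →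
    (fun n => (({j : Fin d → ℤ | (latticeCube (a n) j ∩ closure R0).Nonempty ∧
        (latticeCube (a n) j ∩ closure R0ᶜ).Nonempty}.ncard : ℕ) : ℝ))
      =O[atTop] fun n => ((a n)⁻¹) ^ (d - 1)

/-- Conditions on the scaling factors: `lam n i` is the factor of the sampling region in direction
`i`, and `slam n` is the common factor of the subsampling regions in all directions. In `small`,
the last summand is `det(sΔ_n)^((d+1)/d) / det(Δ_n)` for `sΔ_n = slam n • 1`. -/
structure ScalingCondition {d : ℕ} (lam : ℕ → Fin d → ℝ) (slam : ℕ → ℝ) : Prop where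
  lam_pos : ∀ n i, 0 < lam n i
  slam_pos : ∀ n, 0 < slam n
  small : Tendsto (fun n => (∑ _i : Fin d, 1 / slam n) + (∑ i, slam n / lam n i)
      + slam n ^ (d + 1) / ∏ i, lam n i) atTop (𝓝 0)
  comparable : ∃ K : ℝ, ∀ᶠ n in atTop, ∀ i j, lam n i ≤ K * lam n j

/-! ### The random field -/

variable {d p : ℕ} {Ω : Type*} [MeasurableSpace Ω]

/-- Strict stationarity: the law of the whole field is invariant under integer shifts. -/
def IsStationary (P : Measure Ω) (Z : (Fin d → ℤ) → Ω → EuclideanSpace ℝ (Fin p)) : Prop :=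
  ∀ h : Fin d → ℤ, P.map (fun ω k => Z (k + h) ω) = P.map (fun ω k => Z k ω)

/-- The σ-field generated by the variables `Z s`, `s ∈ T`. -/
def sigmaField (Z : (Fin d → ℤ) → Ω → EuclideanSpace ℝ (Fin p)) (T : Set (Fin d → ℤ)) :
    MeasurableSpace Ω :=
  ⨆ s ∈ T, MeasurableSpace.comap (Z s) inferInstance

/-- `dis(T₁, T₂) ≥ k` in the sup norm (true if one of the sets is empty). -/
def Separated (T₁ T₂ : Set (Fin d → ℤ)) (k : ℝ) : Prop :=
  ∀ x ∈ T₁, ∀ y ∈ T₂, k ≤ ‖x - y‖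

/-- The strong mixing coefficient of the σ-fields generated on `T₁` and `T₂`. -/
def alphaSets (P : Measure Ω) (Z : (Fin d → ℤ) → Ω → EuclideanSpace ℝ (Fin p))
    (T₁ T₂ : Set (Fin d → ℤ)) : ℝ :=
  sSup {x | ∃ A B : Set Ω, MeasurableSet[sigmaField Z T₁] A ∧ MeasurableSet[sigmaField Z T₂] B ∧
    x = |P.real (A ∩ B) - P.real A * P.real B|}

/-- The strong mixing coefficient `α(k, l)`, over sets of at most `l` sites at distance `≥ k`. -/
def alpha (P : Measure Ω) (Z : (Fin d → ℤ) → Ω → EuclideanSpace ℝ (Fin p)) (k l : ℝ) : ℝ :=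
  sSup {x | ∃ T₁ T₂ : Finset (Fin d → ℤ), (T₁.card : ℝ) ≤ l ∧ (T₂.card : ℝ) ≤ l ∧
    Separated (T₁ : Set (Fin d → ℤ)) T₂ k ∧ x = alphaSets P Z T₁ T₂}

/-- The strong mixing coefficient between one site and an arbitrary set at distance `≥ k`. -/
def alphaPoint (P : Measure Ω) (Z : (Fin d → ℤ) → Ω → EuclideanSpace ℝ (Fin p)) (k : ℝ) : ℝ :=
  sSup {x | ∃ (s : Fin d → ℤ) (T₂ : Set (Fin d → ℤ)),
    Separated {s} T₂ k ∧ x = alphaSets P Z {s} T₂}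

/-- The bound `α(k, l) ≤ α₁(k) g(l)` with `α₁, g ≥ 0`, `α₁ → 0` and `g → ∞`. -/
structure MixingBound (P : Measure Ω) (Z : (Fin d → ℤ) → Ω → EuclideanSpace ℝ (Fin p))
    (α₁ g : ℝ → ℝ) : Prop where
  alpha_nonneg : ∀ k, 0 < k → 0 ≤ α₁ k
  g_nonneg : ∀ l, 0 < l → 0 ≤ g l
  alpha_tendsto : Tendsto α₁ atTop (𝓝 0)
  g_tendsto : Tendsto g atTop atTop
  bound : ∀ k l, 0 < k → 0 < l → alpha P Z k l ≤ α₁ k * g l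

/-- The one-site mixing coefficient is `o(k^(-d))`. -/
def PointMixing (P : Measure Ω) (Z : (Fin d → ℤ) → Ω → EuclideanSpace ℝ (Fin p)) : Prop :=
  (fun k : ℕ => alphaPoint P Z (k : ℝ)) =o[atTop] fun k : ℕ => ((k : ℝ) ^ d)⁻¹

/-- The moment and mixing-rate condition of order `r`, for the pair `α₁, g`. -/
def MomentCondition (P : Measure Ω) (Z : (Fin d → ℤ) → Ω → EuclideanSpace ℝ (Fin p))
    (α₁ g : ℝ → ℝ) (r : ℕ) : Prop :=
  ∃ δ κ C : ℝ, 0 < δ ∧ δ ≤ 1 ∧ 0 < κ ∧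
    κ < (2 * (r : ℝ) - 1 - 1 / (d : ℝ)) * (2 * (r : ℝ) + δ) / δ ∧ 0 < C ∧
    Integrable (fun ω => ‖Z 0 ω‖ ^ (2 * (r : ℝ) + δ)) P ∧
    Summable (fun m : ℕ => ((m : ℝ) + 1) ^ ((2 * (r : ℝ) - 1) * (d : ℝ) - 1) *
      α₁ ((m : ℝ) + 1) ^ (δ / (2 * (r : ℝ) + δ))) ∧
    ∀ x, 1 ≤ x → g x ≤ C * x ^ κ

/-- `H` is `r` times continuously differentiable and all its partial derivatives of order `r` are
bounded by a multiple of `1 + ‖x‖^a`. -/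
def SmoothCondition (H : EuclideanSpace ℝ (Fin p) → ℝ) (r a : ℕ) : Prop :=
  ContDiff ℝ r H ∧ ∃ C : ℝ, 0 < C ∧ ∀ (x : EuclideanSpace ℝ (Fin p)) (ν : Fin r → Fin p),
    |iteratedFDeriv ℝ r H x (fun j => EuclideanSpace.single (ν j) (1 : ℝ))| ≤ C * (1 + ‖x‖ ^ a)

/-- The mean of the stationary field. -/
def fieldMean (P : Measure Ω) (Z : (Fin d → ℤ) → Ω → EuclideanSpace ℝ (Fin p)) :
    EuclideanSpace ℝ (Fin p) := ∫ ω, Z 0 ω ∂P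

/-- `σ(k) = Cov(∇' Z(t), ∇' Z(t + k))`, where `∇' z` is the derivative of `H` at the mean of the
field, applied to `z`. -/
def sigma (P : Measure Ω) (Z : (Fin d → ℤ) → Ω → EuclideanSpace ℝ (Fin p))
    (H : EuclideanSpace ℝ (Fin p) → ℝ) (k : Fin d → ℤ) : ℝ :=
  cov[fun ω => fderiv ℝ H (fieldMean P Z) (Z 0 ω),
    fun ω => fderiv ℝ H (fieldMean P Z) (Z k ω); P]

/-! ### The statistic and the subsample variance estimators -/

/-- The sample mean of the observations at the sites in `A`. -/
def siteMean (Z : (Fin d → ℤ) → Ω → EuclideanSpace ℝ (Fin p)) (t : Fin d → ℝ)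
    (A : Set (Fin d → ℝ)) (ω : Ω) : EuclideanSpace ℝ (Fin p) :=
  (siteCount t A : ℝ)⁻¹ • ∑ᶠ k ∈ sites t A, Z k ω

/-- The statistic `H` of the sample mean over `A`. -/
def statistic (H : EuclideanSpace ℝ (Fin p) → ℝ)
    (Z : (Fin d → ℤ) → Ω → EuclideanSpace ℝ (Fin p)) (t : Fin d → ℝ)
    (A : Set (Fin d → ℝ)) (ω : Ω) : ℝ :=
  H (siteMean Z t A ω)

/-- `τ_n² = N_n Var(H(sample mean over R))` for the sampling region `R`. -/
def targetVariance (P : Measure Ω) (H : EuclideanSpace ℝ (Fin p) → ℝ)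
    (Z : (Fin d → ℤ) → Ω → EuclideanSpace ℝ (Fin p)) (t : Fin d → ℝ)
    (R : Set (Fin d → ℝ)) : ℝ :=
  (siteCount t R : ℝ) * Var[statistic H Z t R; P]

/-- The average of `f` over the (finite) index set `J`. -/
def indexAverage (J : Set (Fin d → ℤ)) (f : (Fin d → ℤ) → ℝ) : ℝ :=
  (J.ncard : ℝ)⁻¹ * ∑ᶠ i ∈ J, f i

/-- The subsample variance estimator
`|J|⁻¹ ∑_{i ∈ J} N_i (θ_i - θ̃)²`, `θ̃ = |J|⁻¹ ∑_{i ∈ J} θ_i`, built from subregions `A i`, `i ∈ J`,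
where `N_i` is the number of sites in `A i` and `θ_i` the statistic evaluated on `A i`. -/
def subsampleEstimator (H : EuclideanSpace ℝ (Fin p) → ℝ)
    (Z : (Fin d → ℤ) → Ω → EuclideanSpace ℝ (Fin p)) (t : Fin d → ℝ)
    (J : Set (Fin d → ℤ)) (A : (Fin d → ℤ) → Set (Fin d → ℝ)) (ω : Ω) : ℝ :=
  indexAverage J fun i => (siteCount t (A i) : ℝ) *
    (statistic H Z t (A i) ω - indexAverage J fun j => statistic H Z t (A j) ω) ^ 2

/-- The overlapping estimator: all integer translates of the prototype `c R0` inside `R`. -/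
def estimatorOL (H : EuclideanSpace ℝ (Fin p) → ℝ)
    (Z : (Fin d → ℤ) → Ω → EuclideanSpace ℝ (Fin p)) (t : Fin d → ℝ)
    (R0 R : Set (Fin d → ℝ)) (c : Fin d → ℝ) : Ω → ℝ :=
  subsampleEstimator H Z t {i | translate i (scaleSet c R0) ⊆ R}
    fun i => translate i (scaleSet c R0)

/-- The nonoverlapping estimator: the regions `c (i + R0)`, over all `i` for which the cube
`c (i + (-1/2, 1/2]^d)` lies inside `R`. -/
def estimatorNOL (H : EuclideanSpace ℝ (Fin p) → ℝ)
    (Z : (Fin d → ℤ) → Ω → EuclideanSpace ℝ (Fin p)) (t : Fin d → ℝ)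
    (R0 R : Set (Fin d → ℝ)) (c : Fin d → ℝ) : Ω → ℝ :=
  subsampleEstimator H Z t {i | scaleSet c (translate i (unitCube d)) ⊆ R}
    fun i => scaleSet c (translate i R0)

/-- `b_n = -(s_n v)⁻¹ S (1 + o(1))`. In general this means
`b_n = -(s_n v)⁻¹ S + o(1 / s_n)`; for `S ≠ 0` it is the relative statement. -/
def BiasExpansion (b s : ℕ → ℝ) (v S : ℝ) : Prop :=
  ((fun n => b n - -1 / (s n * v) * S) =o[atTop] fun n => 1 / s n) ∧
  (S ≠ 0 → ∃ ε : ℕ → ℝ, Tendsto ε atTop (𝓝 0) ∧ ∀ n, b n = -1 / (s n * v) * S * (1 + ε n))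

end SpatialSubsampling

end

namespace SpatialSubsampling

/-! ### A covariance inequality under strong mixing -/

/-! On a set of `N` sites write the statistic as H(μ) + L + W, where L is the derivative of H at μ
applied to the deviation of the sample mean and W is the remainder. The second moment of L is exact:
N E L² = Σ σ(k) − N⁻¹ Σ e(k) σ(k), where e(k), called `excess`, counts the sites lost under
translation by k (`card_mul_integral_linPart_sq`). Both E W² and E LW are O(N⁻²)
(`exists_linError_bound`), so N times the variance of the statistic equals this expression up to
O(1/N).

By stationarity all subsample statistics have the same mean and variance. The estimator therefore
has mean N Var θ, for one prototype subsample, minus N times the variance of the average of the θ's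
(`integral_subsample_average`). If no site is used more than κ times among the subsamples, the
subtracted term is O(κ/|J| + 1/N) (`exists_bias_bounds`). One can take κ = N with |J| of order at
least det Δ for overlapping regions, and κ = 1 with |J| of order at least det Δ / s^d for disjoint
ones. After multiplication by s both give O(s^(d+1)/det Δ), which tends to zero.

In the bias the constant Σ σ(k) cancels (`tendsto_scaled_bias`). What survives is the boundary term
of the subsample: there N ~ s^d |R0| and e(k)/s^(d-1) → C(k), and dominated convergence applies
because e(k) grows at most linearly in ‖k‖ while (1 + ‖k‖)|σ(k)| is summable. For the full region,
counting boundary cubes shows that the same term is o(1/s). The errors O(1/N) are o(1/s) because d ≥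
2.

The moment bounds come from mixing. A mixed moment with one site at distance m from all the others
is O(m^(-r(d+1))), by truncation and a covariance inequality (`exists_momentDecay`). For arbitrary
sites let ρ be the largest nearest-neighbour distance. Then some site is isolated at scale ρ,
whereas the graph joining sites at distance at most ρ has no isolated vertex and so is dominated by
half of its vertices. Sharing the decay among the dominated sites makes the sum over all
configurations O(N^⌊n/2⌋) (`MomentDecay.exists_prod_sum_bound`). The odd case matters: third moments
of the mean deviation are O(N⁻²), which keeps the product of L with the quadratic Taylor term
negligible even for d = 2. -/

lemma abs_integral_mul_sub_le_of_setIntegral {Ω : Type*} {m mΩ : MeasurableSpace Ω} (hm : m ≤ mΩ)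
    {P : Measure Ω} [IsProbabilityMeasure P] {X W : Ω → ℝ} {c M : ℝ} (hW : Integrable W P)
    (hc : ∀ A, MeasurableSet[m] A → |∫ ω in A, W ω ∂P - P.real A * ∫ ω, W ω ∂P| ≤ c)
    (hX : StronglyMeasurable[m] X) (hXM : ∀ ω, |X ω| ≤ M) :
    |∫ ω, X ω * W ω ∂P - (∫ ω, X ω ∂P) * ∫ ω, W ω ∂P| ≤ 2 * c * M := by
  have hXm : AEStronglyMeasurable X P := (hX.mono hm).aestronglyMeasurable
  have hM : ∀ᵐ ω ∂P, ‖X ω‖ ≤ M := Eventually.of_forall hXM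
  have hXint : Integrable X P := Integrable.of_bound hXm M hM
  have hXW : Integrable (X * W) P := hW.bdd_mul hXm hM
  set h : Ω → ℝ := fun ω => (P[W|m]) ω - ∫ ω, W ω ∂P with hh
  have hhint : Integrable h P := integrable_condExp.sub (integrable_const _)
  have hhm : StronglyMeasurable[m] h := stronglyMeasurable_condExp.sub stronglyMeasurable_const
  have e1 : ∫ ω, X ω * W ω ∂P = ∫ ω, X ω * (P[W|m]) ω ∂P := by
    have := condExp_mul_of_stronglyMeasurable_left hX hXW hW
    calc ∫ ω, X ω * W ω ∂P = ∫ ω, (P[X * W|m]) ω ∂P := (integral_condExp hm).symm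
      _ = _ := integral_congr_ae this
  have hXc : Integrable (fun ω => X ω * (P[W|m]) ω) P := by
    simpa [mul_comm] using (integrable_condExp (μ := P) (f := W) (m := m)).bdd_mul hXm hM
  have e2 : ∫ ω, X ω * W ω ∂P - (∫ ω, X ω ∂P) * ∫ ω, W ω ∂P = ∫ ω, X ω * h ω ∂P := by
    rw [e1, ← integral_mul_const, ← integral_sub hXc (hXint.mul_const _)]
    simp only [hh, mul_sub]
  have hset : ∀ A, MeasurableSet[m] A → |∫ ω in A, h ω ∂P| ≤ c := by
    intro A hA
    have : ∫ ω in A, h ω ∂P = ∫ ω in A, W ω ∂P - P.real A * ∫ ω, W ω ∂P := by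
      rw [hh, integral_sub integrable_condExp.integrableOn (integrable_const _),
        setIntegral_condExp hm hW hA]
      simp
    rw [this]; exact hc A hA
  have hM0 : 0 ≤ M := by
    obtain ⟨ω⟩ : Nonempty Ω := P.nonempty_of_neZero
    exact (abs_nonneg _).trans (hXM ω)
  -- The sign set of `h` belongs to `m`, so the bound over sets applies to it and to its complement.
  -- Together they give E|h| ≤ 2c.
  set S : Set Ω := {ω | 0 ≤ h ω}
  have hS : MeasurableSet[m] S := measurableSet_le measurable_const hhm.measurable
  rw [e2]
  have habs : ∫ ω, |h ω| ∂P = ∫ ω in S, h ω ∂P - ∫ ω in Sᶜ, h ω ∂P := by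
    rw [← integral_add_compl (hm _ hS) hhint.abs, sub_eq_add_neg, ← integral_neg]
    congr 1
    · exact setIntegral_congr_fun (hm _ hS) fun ω hω => abs_of_nonneg hω
    · exact setIntegral_congr_fun (hm _ hS).compl fun ω hω =>
        abs_of_neg (not_le.mp hω)
  calc |∫ ω, X ω * h ω ∂P| ≤ ∫ ω, |X ω * h ω| ∂P := abs_integral_le_integral_abs
    _ ≤ ∫ ω, M * |h ω| ∂P := by
        refine integral_mono_of_nonneg (Eventually.of_forall fun ω => abs_nonneg _)
          (hhint.abs.const_mul M) (Eventually.of_forall fun ω => ?_)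
        simp only [abs_mul]
        exact mul_le_mul_of_nonneg_right (hXM ω) (abs_nonneg _)
    _ = M * (∫ ω in S, h ω ∂P - ∫ ω in Sᶜ, h ω ∂P) := by rw [integral_const_mul, habs]
    _ ≤ M * (c + c) := by
        refine mul_le_mul_of_nonneg_left ?_ hM0
        have h1 := abs_le.mp (hset S hS)
        have h2 := abs_le.mp (hset Sᶜ hS.compl)
        linarith
    _ = 2 * c * M := by ring

/-- The one-sided inequality is used twice: first with `W` as the bounded factor and the indicator
of a set of `m₁` as the integrable one, then with `X` as the bounded factor and `W` as the
integrable one. Each use costs a factor 2. -/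
lemma abs_integral_mul_sub_le_of_mixing {Ω : Type*} {m₁ m₂ mΩ : MeasurableSpace Ω}
    (hm₁ : m₁ ≤ mΩ) (hm₂ : m₂ ≤ mΩ) {P : Measure Ω} [IsProbabilityMeasure P] {X W : Ω → ℝ}
    {c M N : ℝ}
    (hc : ∀ A B, MeasurableSet[m₁] A → MeasurableSet[m₂] B →
      |P.real (A ∩ B) - P.real A * P.real B| ≤ c)
    (hX : StronglyMeasurable[m₁] X) (hXM : ∀ ω, |X ω| ≤ M)
    (hW : StronglyMeasurable[m₂] W) (hWN : ∀ ω, |W ω| ≤ N) :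
    |∫ ω, X ω * W ω ∂P - (∫ ω, X ω ∂P) * ∫ ω, W ω ∂P| ≤ 4 * c * M * N := by
  have hWint : Integrable W P :=
    Integrable.of_bound (hW.mono hm₂).aestronglyMeasurable N (Eventually.of_forall hWN)
  have key : ∀ A, MeasurableSet[m₁] A →
      |∫ ω in A, W ω ∂P - P.real A * ∫ ω, W ω ∂P| ≤ 2 * c * N := by
    intro A hA
    have hi : Integrable (A.indicator (fun _ => (1 : ℝ))) P :=
      (integrable_const _).indicator (hm₁ _ hA)
    have := abs_integral_mul_sub_le_of_setIntegral hm₂ hi (X := W) (c := c) (M := N) ?_ hW hWN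
    · have e : (fun ω => W ω * A.indicator (fun _ => (1 : ℝ)) ω) = A.indicator W := by
        ext ω; by_cases h : ω ∈ A <;> simp [h]
      rw [e, integral_indicator (hm₁ _ hA), integral_indicator_const _ (hm₁ _ hA)] at this
      simpa [mul_comm] using this
    · intro B hB
      have hA' := hm₁ _ hA
      rw [integral_indicator_const _ hA', integral_indicator_const _ hA']
      simp only [smul_eq_mul, mul_one, measureReal_restrict_apply hA']
      rw [mul_comm (P.real B)]
      exact hc A B hA hB
  have := abs_integral_mul_sub_le_of_setIntegral hm₁ hWint key hX hXM
  linarith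

/-! ### Truncation -/

/-- `x` if `|x| ≤ M`, and `0` otherwise. -/
noncomputable def trunc (M x : ℝ) : ℝ := if |x| ≤ M then x else 0

lemma measurable_trunc (M : ℝ) : Measurable (trunc M) :=
  Measurable.ite (measurableSet_le measurable_id.abs measurable_const) measurable_id
    measurable_const

lemma abs_trunc_le {M : ℝ} (hM : 0 ≤ M) (x : ℝ) : |trunc M x| ≤ M := by
  unfold trunc
  split_ifs with h
  · exact h
  · simpa using hM

/-- Truncation sends large values to 0, so one factor above `M` kills the whole truncated product.
The original product is then at most the matching power of its largest factor, which exceeds `M`,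
and the nonpositive exponent `card ι - q` turns this into a power of `M`. -/
lemma abs_prod_sub_prod_trunc_le {ι : Type*} [Fintype ι] {M q : ℝ} (hM : 0 < M)
    (hq : (Fintype.card ι : ℝ) ≤ q) (y : ι → ℝ) :
    |∏ j, y j - ∏ j, trunc M (y j)| ≤ M ^ ((Fintype.card ι : ℝ) - q) * ∑ j, |y j| ^ q := by
  have hpos : 0 ≤ M ^ ((Fintype.card ι : ℝ) - q) * ∑ j, |y j| ^ q :=
    mul_nonneg (Real.rpow_nonneg hM.le _)
      (Finset.sum_nonneg fun j _ => Real.rpow_nonneg (abs_nonneg _) _)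
  by_cases h : ∀ j, |y j| ≤ M
  · have : ∀ j, trunc M (y j) = y j := fun j => if_pos (h j)
    simpa [this] using hpos
  · push Not at h
    obtain ⟨j₀, hj₀⟩ := h
    have hz : ∏ j, trunc M (y j) = 0 :=
      Finset.prod_eq_zero (Finset.mem_univ j₀) (if_neg (not_le.mpr hj₀))
    obtain ⟨k, -, hk⟩ := Finset.exists_max_image Finset.univ (fun j => |y j|)
      ⟨j₀, Finset.mem_univ _⟩
    have hkM : M < |y k| := hj₀.trans_le (hk j₀ (Finset.mem_univ _))
    have hk0 : 0 < |y k| := hM.trans hkM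
    rw [hz, sub_zero, Finset.abs_prod]
    calc ∏ j, |y j| ≤ ∏ _j : ι, |y k| :=
          Finset.prod_le_prod (fun _ _ => abs_nonneg _) fun j hj => hk j hj
      _ = |y k| ^ ((Fintype.card ι : ℝ) - q) * |y k| ^ q := by
          rw [← Real.rpow_add hk0, sub_add_cancel, Real.rpow_natCast, Finset.prod_const,
            Finset.card_univ]
      _ ≤ M ^ ((Fintype.card ι : ℝ) - q) * ∑ j, |y j| ^ q := by
          refine mul_le_mul (Real.rpow_le_rpow_of_nonpos hM hkM.le (by linarith)) ?_
            (Real.rpow_nonneg hk0.le _) (Real.rpow_nonneg hM.le _)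
          exact Finset.single_le_sum (f := fun j => |y j| ^ q)
            (fun j _ => Real.rpow_nonneg (abs_nonneg _) _) (Finset.mem_univ k)

/-- The expectation of a product of which one factor is centred and nearly independent of the
others. -/
lemma abs_integral_prod_le_of_mixing {Ω ι : Type*} [Fintype ι] [DecidableEq ι]
    {m₁ m₂ mΩ : MeasurableSpace Ω}
    (hm₁ : m₁ ≤ mΩ) (hm₂ : m₂ ≤ mΩ) {P : Measure Ω} [IsProbabilityMeasure P] {Y : ι → Ω → ℝ}
    {c M q B : ℝ} (hM : 0 < M) (hq : (Fintype.card ι : ℝ) ≤ q)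
    (hc : ∀ A B, MeasurableSet[m₁] A → MeasurableSet[m₂] B →
      |P.real (A ∩ B) - P.real A * P.real B| ≤ c)
    {j₀ : ι} (h₁ : Measurable[m₁] (Y j₀)) (h₂ : ∀ j, j ≠ j₀ → Measurable[m₂] (Y j))
    (hint : ∀ j, Integrable (fun ω => |Y j ω| ^ q) P) (hB : ∀ j, ∫ ω, |Y j ω| ^ q ∂P ≤ B)
    (hmean : ∫ ω, Y j₀ ω ∂P = 0) (hprod : Integrable (fun ω => ∏ j, Y j ω) P)
    (hY₀ : Integrable (Y j₀) P) :
    |∫ ω, ∏ j, Y j ω ∂P| ≤ 4 * c * M ^ (Fintype.card ι)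
      + ((Fintype.card ι : ℝ) + 1) * B * M ^ ((Fintype.card ι : ℝ) - q) := by
  set n := Fintype.card ι with hn
  have hn1 : 1 ≤ n := Fintype.card_pos_iff.mpr ⟨j₀⟩
  have hmeas : ∀ j, Measurable (Y j) := fun j => by
    by_cases h : j = j₀
    · subst h; exact h₁.mono hm₁ le_rfl
    · exact (h₂ j h).mono hm₂ le_rfl
  have htm : ∀ j, Measurable fun ω => trunc M (Y j ω) := fun j =>
    (measurable_trunc M).comp (hmeas j)
  have htprod : Measurable fun ω => ∏ j, trunc M (Y j ω) :=
    Finset.measurable_fun_prod _ fun j _ => htm j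
  have htpint : Integrable (fun ω => ∏ j, trunc M (Y j ω)) P := by
    refine Integrable.of_bound htprod.aestronglyMeasurable (M ^ n) (Eventually.of_forall fun ω => ?_)
    rw [Real.norm_eq_abs, Finset.abs_prod]
    calc ∏ j, |trunc M (Y j ω)| ≤ ∏ _j : ι, M :=
          Finset.prod_le_prod (fun _ _ => abs_nonneg _) fun j _ => abs_trunc_le hM.le _
      _ = M ^ n := by simp [hn]
  have ht0int : Integrable (fun ω => trunc M (Y j₀ ω)) P :=
    Integrable.of_bound (htm j₀).aestronglyMeasurable M
      (Eventually.of_forall fun ω => abs_trunc_le hM.le _)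
  -- replacing all factors by truncated ones
  have s1 : |∫ ω, ∏ j, Y j ω ∂P - ∫ ω, ∏ j, trunc M (Y j ω) ∂P| ≤ n * B * M ^ ((n : ℝ) - q) := by
    rw [← integral_sub hprod htpint]
    calc |∫ ω, (∏ j, Y j ω - ∏ j, trunc M (Y j ω)) ∂P|
        ≤ ∫ ω, |∏ j, Y j ω - ∏ j, trunc M (Y j ω)| ∂P := abs_integral_le_integral_abs
      _ ≤ ∫ ω, M ^ ((n : ℝ) - q) * ∑ j, |Y j ω| ^ q ∂P := by
          refine integral_mono (hprod.sub htpint).abs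
            ((integrable_finsetSum _ fun j _ => hint j).const_mul _) fun ω => ?_
          exact abs_prod_sub_prod_trunc_le hM hq _
      _ = M ^ ((n : ℝ) - q) * ∑ j, ∫ ω, |Y j ω| ^ q ∂P := by
          rw [integral_const_mul, integral_finsetSum _ fun j _ => hint j]
      _ ≤ M ^ ((n : ℝ) - q) * (n * B) := by
          refine mul_le_mul_of_nonneg_left ?_ (Real.rpow_nonneg hM.le _)
          calc ∑ j, ∫ ω, |Y j ω| ^ q ∂P ≤ ∑ _j : ι, B := Finset.sum_le_sum fun j _ => hB j
            _ = n * B := by simp [hn]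
      _ = _ := by ring
  -- the mean of the truncated factor
  have s2 : |∫ ω, trunc M (Y j₀ ω) ∂P| ≤ B * M ^ (1 - q) := by
    have e : ∫ ω, trunc M (Y j₀ ω) ∂P = - ∫ ω, (Y j₀ ω - trunc M (Y j₀ ω)) ∂P := by
      rw [integral_sub hY₀ ht0int, hmean]; ring
    rw [e, abs_neg]
    -- The one-factor case of the truncation lemma: since `Y j₀` is centred, its truncated mean is
    -- minus the mean of the part cut off.
    have hq1 : ((Fintype.card Unit : ℕ) : ℝ) ≤ q := by
      have : (1 : ℝ) ≤ n := by exact_mod_cast hn1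
      simpa using this.trans hq
    calc |∫ ω, (Y j₀ ω - trunc M (Y j₀ ω)) ∂P|
        ≤ ∫ ω, |Y j₀ ω - trunc M (Y j₀ ω)| ∂P := abs_integral_le_integral_abs
      _ ≤ ∫ ω, M ^ (1 - q) * |Y j₀ ω| ^ q ∂P := by
          refine integral_mono (hY₀.sub ht0int).abs ((hint j₀).const_mul _) fun ω => ?_
          simpa using abs_prod_sub_prod_trunc_le hM hq1 (fun _ : Unit => Y j₀ ω)
      _ = M ^ (1 - q) * ∫ ω, |Y j₀ ω| ^ q ∂P := by rw [integral_const_mul]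
      _ ≤ M ^ (1 - q) * B := mul_le_mul_of_nonneg_left (hB j₀) (Real.rpow_nonneg hM.le _)
      _ = _ := mul_comm _ _
  -- the remaining truncated factors
  set V : Ω → ℝ := fun ω => ∏ j ∈ Finset.univ.erase j₀, trunc M (Y j ω) with hV
  have hVm : Measurable[m₂] V := Finset.measurable_fun_prod _ fun j hj =>
    (measurable_trunc M).comp (h₂ j (Finset.ne_of_mem_erase hj))
  have hVb : ∀ ω, |V ω| ≤ M ^ (n - 1) := fun ω => by
    rw [hV, Finset.abs_prod]
    calc ∏ j ∈ Finset.univ.erase j₀, |trunc M (Y j ω)| ≤ ∏ _j ∈ Finset.univ.erase j₀, M :=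
          Finset.prod_le_prod (fun _ _ => abs_nonneg _) fun j _ => abs_trunc_le hM.le _
      _ = M ^ (n - 1) := by simp [hn, Finset.card_erase_of_mem]
  have s3 := abs_integral_mul_sub_le_of_mixing hm₁ hm₂ hc
    ((measurable_trunc M).comp h₁).stronglyMeasurable (M := M) (fun ω => abs_trunc_le hM.le _)
    hVm.stronglyMeasurable hVb
  have hsplit : ∀ ω, ∏ j, trunc M (Y j ω) = (trunc M ∘ Y j₀) ω * V ω := fun ω =>
    (Finset.mul_prod_erase _ (fun j => trunc M (Y j ω)) (Finset.mem_univ j₀)).symm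
  have s4 : |∫ ω, V ω ∂P| ≤ M ^ (n - 1) := by
    have := norm_integral_le_of_norm_le_const (μ := P) (f := V) (Eventually.of_forall hVb)
    simpa using this
  have hMn : M * M ^ (n - 1) = M ^ n := by
    rw [← pow_succ', Nat.sub_add_cancel hn1]
  have hBn : 0 ≤ B := (integral_nonneg fun ω => Real.rpow_nonneg (abs_nonneg _) _).trans (hB j₀)
  have s5 : |(∫ ω, (trunc M ∘ Y j₀) ω ∂P) * ∫ ω, V ω ∂P| ≤ B * M ^ ((n : ℝ) - q) := by
    rw [abs_mul]
    calc _ ≤ (B * M ^ (1 - q)) * M ^ (n - 1) :=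
          mul_le_mul s2 s4 (abs_nonneg _) (mul_nonneg hBn (Real.rpow_nonneg hM.le _))
      _ = B * M ^ ((n : ℝ) - q) := by
          rw [mul_assoc, ← Real.rpow_natCast, ← Real.rpow_add hM, Nat.cast_sub hn1]
          congr 2; push_cast; ring
  simp_rw [hsplit] at s1
  have hM4 : 4 * c * M * M ^ (n - 1) = 4 * c * M ^ n := by rw [mul_assoc, hMn]
  rw [hM4] at s3
  have a1 := abs_le.mp s1
  have a3 := abs_le.mp s3
  have a5 := abs_le.mp s5
  rw [abs_le]
  constructor <;> linarith

/-! ### Mixed moments of the field -/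

section Field

variable {d p : ℕ} {Ω : Type*} [MeasurableSpace Ω] {P : Measure Ω}
  {Z : (Fin d → ℤ) → Ω → EuclideanSpace ℝ (Fin p)}

/-- The `c`-th coordinate of the centred observation with label `k`. -/
noncomputable def centred (P : Measure Ω) (Z : (Fin d → ℤ) → Ω → EuclideanSpace ℝ (Fin p))
    (c : Fin p) (k : Fin d → ℤ) (ω : Ω) : ℝ := (Z k ω - fieldMean P Z) c

lemma IsStationary.identDistrib_field (hstat : IsStationary P Z) (hZ : ∀ k, Measurable (Z k))
    (h : Fin d → ℤ) :
    IdentDistrib (fun ω k => Z (k + h) ω) (fun ω k => Z k ω) P P where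
  aemeasurable_fst := (measurable_pi_lambda _ fun k => hZ (k + h)).aemeasurable
  aemeasurable_snd := (measurable_pi_lambda _ fun k => hZ k).aemeasurable
  map_eq := hstat h

lemma IsStationary.identDistrib (hstat : IsStationary P Z) (hZ : ∀ k, Measurable (Z k))
    (k : Fin d → ℤ) : IdentDistrib (Z k) (Z 0) P P := by
  have := (hstat.identDistrib_field hZ k).comp (measurable_pi_apply (0 : Fin d → ℤ))
  simpa [Function.comp_def] using this

lemma measurable_centred (hZ : ∀ k, Measurable (Z k)) (c : Fin p) (k : Fin d → ℤ) :
    Measurable (centred P Z c k) := by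
  unfold centred
  have := hZ k
  fun_prop

lemma measurable_centred_sigmaField {T : Set (Fin d → ℤ)} {k : Fin d → ℤ} (hk : k ∈ T)
    (c : Fin p) : Measurable[sigmaField Z T] (centred P Z c k) := by
  have h1 : Measurable[sigmaField Z T] (Z k) := by
    refine Measurable.mono (comap_measurable (Z k)) ?_ le_rfl
    exact le_iSup₂_of_le k hk le_rfl
  have h2 : Measurable fun z : EuclideanSpace ℝ (Fin p) => (z - fieldMean P Z) c := by fun_prop
  exact h2.comp h1

lemma sigmaField_le (hZ : ∀ k, Measurable (Z k)) (T : Set (Fin d → ℤ)) :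
    sigmaField Z T ≤ ‹MeasurableSpace Ω› :=
  iSup₂_le fun k _ => (hZ k).comap_le

variable [IsProbabilityMeasure P]

lemma abs_real_inter_sub_le_one (A B : Set Ω) :
    |P.real (A ∩ B) - P.real A * P.real B| ≤ 1 := by
  have h1 := measureReal_nonneg (μ := P) (s := A ∩ B)
  have h2 := measureReal_le_one (μ := P) (s := A ∩ B)
  have h3 := measureReal_nonneg (μ := P) (s := A)
  have h4 := measureReal_le_one (μ := P) (s := A)
  have h5 := measureReal_nonneg (μ := P) (s := B)
  have h6 := measureReal_le_one (μ := P) (s := B)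
  have h7 := mul_nonneg h3 h5
  have h8 := mul_le_one₀ h4 h5 h6
  rw [abs_le]; constructor <;> linarith

lemma le_alphaSets {T₁ T₂ : Set (Fin d → ℤ)} {A B : Set Ω}
    (hA : MeasurableSet[sigmaField Z T₁] A) (hB : MeasurableSet[sigmaField Z T₂] B) :
    |P.real (A ∩ B) - P.real A * P.real B| ≤ alphaSets P Z T₁ T₂ := by
  refine le_csSup ⟨1, ?_⟩ ⟨A, B, hA, hB, rfl⟩
  rintro x ⟨A, B, -, -, rfl⟩
  exact abs_real_inter_sub_le_one A B

lemma alphaSets_le_one (T₁ T₂ : Set (Fin d → ℤ)) : alphaSets P Z T₁ T₂ ≤ 1 := by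
  refine csSup_le ⟨_, ∅, ∅, @MeasurableSet.empty Ω (sigmaField Z T₁),
    @MeasurableSet.empty Ω (sigmaField Z T₂), rfl⟩ ?_
  rintro x ⟨A, B, -, -, rfl⟩
  exact abs_real_inter_sub_le_one A B

lemma alphaSets_le_alpha {T₁ T₂ : Finset (Fin d → ℤ)} {k l : ℝ} (h₁ : (T₁.card : ℝ) ≤ l)
    (h₂ : (T₂.card : ℝ) ≤ l) (h : Separated (T₁ : Set (Fin d → ℤ)) T₂ k) :
    alphaSets P Z T₁ T₂ ≤ alpha P Z k l := by
  refine le_csSup ⟨1, ?_⟩ ⟨T₁, T₂, h₁, h₂, h, rfl⟩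
  rintro x ⟨T₁, T₂, -, -, -, rfl⟩
  exact alphaSets_le_one _ _

/-- Moments of order `q` of the centred coordinates are finite and uniformly bounded. -/
lemma exists_moment_bound (hZ : ∀ k, Measurable (Z k)) (hstat : IsStationary P Z) {q : ℝ}
    (hq : 1 ≤ q) (hint : Integrable (fun ω => ‖Z 0 ω‖ ^ q) P) :
    (∀ k, MemLp (Z k) (ENNReal.ofReal q) P) ∧
    ∃ B : ℝ, 0 ≤ B ∧ ∀ c k, Integrable (fun ω => |centred P Z c k ω| ^ q) P ∧
      ∫ ω, |centred P Z c k ω| ^ q ∂P ≤ B := by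
  have hq0 : 0 < q := by linarith
  have hne : ENNReal.ofReal q ≠ 0 := by simpa using hq0
  have h0 : MemLp (Z 0) (ENNReal.ofReal q) P := by
    rw [← integrable_norm_rpow_iff (hZ 0).aestronglyMeasurable hne ENNReal.ofReal_ne_top]
    simpa [ENNReal.toReal_ofReal hq0.le] using hint
  have hk : ∀ k, MemLp (Z k) (ENNReal.ofReal q) P := fun k =>
    (hstat.identDistrib hZ k).memLp_iff.mpr h0
  refine ⟨hk, ∫ ω, ‖Z 0 ω - fieldMean P Z‖ ^ q ∂P,
    integral_nonneg fun ω => Real.rpow_nonneg (norm_nonneg _) _, fun c k => ?_⟩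
  have hkm : MemLp (fun ω => Z k ω - fieldMean P Z) (ENNReal.ofReal q) P :=
    (hk k).sub (memLp_const _)
  have hki : Integrable (fun ω => ‖Z k ω - fieldMean P Z‖ ^ q) P := by
    have := hkm.integrable_norm_rpow hne ENNReal.ofReal_ne_top
    simpa [ENNReal.toReal_ofReal hq0.le] using this
  have hle : ∀ ω, |centred P Z c k ω| ^ q ≤ ‖Z k ω - fieldMean P Z‖ ^ q := fun ω =>
    Real.rpow_le_rpow (abs_nonneg _) (PiLp.norm_apply_le (Z k ω - fieldMean P Z) c) hq0.le
  have hci : Integrable (fun ω => |centred P Z c k ω| ^ q) P := by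
    refine hki.mono' ?_ (Eventually.of_forall fun ω => ?_)
    · exact ((measurable_centred hZ c k).abs.pow_const q).aestronglyMeasurable
    · rw [Real.norm_of_nonneg (Real.rpow_nonneg (abs_nonneg _) _)]; exact hle ω
  refine ⟨hci, (integral_mono hci hki hle).trans_eq ?_⟩
  have hm : Measurable fun z : EuclideanSpace ℝ (Fin p) => ‖z - fieldMean P Z‖ ^ q := by fun_prop
  exact ((hstat.identDistrib hZ k).comp hm).integral_eq

lemma integral_centred (hZ : ∀ k, Measurable (Z k)) (hstat : IsStationary P Z)
    (hint : ∀ k, Integrable (Z k) P) (c : Fin p) (k : Fin d → ℤ) :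
    ∫ ω, centred P Z c k ω ∂P = 0 := by
  have h1 : ∫ ω, Z k ω ∂P = fieldMean P Z := (hstat.identDistrib hZ k).integral_eq
  have h2 : ∫ ω, (Z k ω - fieldMean P Z) ∂P = 0 := by
    rw [integral_sub (hint k) (integrable_const _), h1]; simp
  have h3 := ContinuousLinearMap.integral_comp_comm (EuclideanSpace.proj (𝕜 := ℝ) c)
    ((hint k).sub (integrable_const (fieldMean P Z)))
  simp only [Pi.sub_apply] at h3
  rw [h2] at h3
  simpa [centred] using h3

/-- Truncation at level 1. This gives integrability of products from moments of order `q` alone,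
without Hölder's inequality. -/
lemma abs_prod_le_one_add_sum {ι : Type*} [Fintype ι] {q : ℝ}
    (hq : (Fintype.card ι : ℝ) ≤ q) (y : ι → ℝ) :
    |∏ j, y j| ≤ 1 + ∑ j, |y j| ^ q := by
  have h1 := abs_prod_sub_prod_trunc_le one_pos hq y
  rw [Real.one_rpow, one_mul] at h1
  have h2 : |∏ j, trunc 1 (y j)| ≤ 1 := by
    rw [Finset.abs_prod]
    exact Finset.prod_le_one (fun _ _ => abs_nonneg _) fun j _ => abs_trunc_le zero_le_one _
  have h3 := abs_sub_abs_le_abs_sub (∏ j, y j) (∏ j, trunc 1 (y j))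
  linarith

end Field

/-! ### Polynomial decay of mixed moments -/

/-- Centred variables `Y c k` whose mixed moments of order at most `2 r` decay polynomially in the
distance from an isolated site to the other sites. -/
structure MomentDecay {d p : ℕ} {Ω : Type*} [MeasurableSpace Ω] (P : Measure Ω)
    (Y : Fin p → (Fin d → ℤ) → Ω → ℝ) (r : ℕ) (K : ℝ) : Prop where
  nonneg : 0 ≤ K
  measurable : ∀ c k, Measurable (Y c k)
  integrable_prod : ∀ {n : ℕ}, 1 ≤ n → n ≤ 2 * r → ∀ (c : Fin n → Fin p)
    (i : Fin n → (Fin d → ℤ)), Integrable (fun ω => ∏ j, Y (c j) (i j) ω) P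
  integral_eq_zero : ∀ c k, ∫ ω, Y c k ω ∂P = 0
  decay : ∀ {n : ℕ}, 1 ≤ n → n ≤ 2 * r → ∀ (c : Fin n → Fin p)
    (i : Fin n → (Fin d → ℤ)) (j₀ : Fin n) (m : ℕ), (∀ l ≠ j₀, (m : ℝ) ≤ ‖i j₀ - i l‖) →
    |∫ ω, ∏ j, Y (c j) (i j) ω ∂P| ≤ K * ((1 + (m : ℝ)) ^ (r * (d + 1)))⁻¹

/-- A polynomial bound of the mixing rate at integer distances. -/
lemma exists_mixing_rate {α₁ : ℝ → ℝ} (hα : ∀ k, 0 < k → 0 ≤ α₁ k) {e θ : ℝ} (hθ : 0 < θ)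
    (hsum : Summable fun m : ℕ => ((m : ℝ) + 1) ^ e * α₁ ((m : ℝ) + 1) ^ θ) :
    ∃ T : ℝ, 0 ≤ T ∧ ∀ m : ℕ, 1 ≤ m → α₁ m ≤ T * (m : ℝ) ^ (-(e / θ)) := by
  have hnn : ∀ m : ℕ, 0 ≤ ((m : ℝ) + 1) ^ e * α₁ ((m : ℝ) + 1) ^ θ := fun m =>
    mul_nonneg (Real.rpow_nonneg (by positivity) _) (Real.rpow_nonneg (hα _ (by positivity)) _)
  set S := ∑' m : ℕ, ((m : ℝ) + 1) ^ e * α₁ ((m : ℝ) + 1) ^ θ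
  have hS : 0 ≤ S := tsum_nonneg hnn
  refine ⟨S ^ θ⁻¹, Real.rpow_nonneg hS _, fun m hm => ?_⟩
  obtain ⟨m, rfl⟩ : ∃ l, m = l + 1 := ⟨m - 1, by omega⟩
  push_cast
  have hx : (0 : ℝ) < (m : ℝ) + 1 := by positivity
  have h0 := hα _ hx
  -- A single term of a nonnegative series is at most its sum, which is all that the rate requires.
  have h1 : ((m : ℝ) + 1) ^ e * α₁ ((m : ℝ) + 1) ^ θ ≤ S :=
    hsum.le_tsum m fun j _ => hnn j
  have h2 : α₁ ((m : ℝ) + 1) ^ θ ≤ S * ((m : ℝ) + 1) ^ (-e) := by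
    rw [Real.rpow_neg hx.le, ← div_eq_mul_inv, le_div_iff₀ (Real.rpow_pos_of_pos hx _), mul_comm]
    exact h1
  calc α₁ ((m : ℝ) + 1) = (α₁ ((m : ℝ) + 1) ^ θ) ^ θ⁻¹ := by
        rw [← Real.rpow_mul h0, mul_inv_cancel₀ hθ.ne', Real.rpow_one]
    _ ≤ (S * ((m : ℝ) + 1) ^ (-e)) ^ θ⁻¹ :=
        Real.rpow_le_rpow (Real.rpow_nonneg h0 _) h2 (by positivity)
    _ = S ^ θ⁻¹ * ((m : ℝ) + 1) ^ (-(e / θ)) := by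
        rw [Real.mul_rpow hS (Real.rpow_nonneg hx.le _), ← Real.rpow_mul hx.le]
        congr 2; field_simp

/-- Truncate at a power of the distance m. The truncation error is controlled by the `δ` spare
moments and the truncated product by mixing. The level is chosen so that both errors are of order m
to the power `-r (d + 1)`. -/
theorem exists_momentDecay {d p : ℕ} (hd : 2 ≤ d) {Ω : Type*} [MeasurableSpace Ω] {P : Measure Ω}
    [IsProbabilityMeasure P] {Z : (Fin d → ℤ) → Ω → EuclideanSpace ℝ (Fin p)}
    (hZ : ∀ k, Measurable (Z k)) (hstat : IsStationary P Z) {α₁ g : ℝ → ℝ}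
    (hmix : MixingBound P Z α₁ g) {r : ℕ} (hr : 3 ≤ r) (hmom : MomentCondition P Z α₁ g r) :
    (∀ k, MemLp (Z k) (2 * r : ℕ) P) ∧ ∃ K, MomentDecay P (centred P Z) r K := by
  obtain ⟨δ, κ, C, hδ, -, -, -, -, hint, hsum, -⟩ := hmom
  have hrR : (3 : ℝ) ≤ r := by exact_mod_cast hr
  have hdR : (2 : ℝ) ≤ d := by exact_mod_cast hd
  set q : ℝ := 2 * (r : ℝ) + δ with hq
  have hqpos : 0 < q := by linarith
  obtain ⟨hLp, B, hB0, hB⟩ := exists_moment_bound hZ hstat (by linarith : 1 ≤ q) hint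
  have hLp2 : ∀ k, MemLp (Z k) (2 * r : ℕ) P := fun k => by
    refine (hLp k).mono_exponent ?_
    rw [← ENNReal.ofReal_natCast]
    apply ENNReal.ofReal_le_ofReal
    push_cast
    linarith
  have hint1 : ∀ k, Integrable (Z k) P := fun k => by
    refine (hLp2 k).integrable ?_
    exact_mod_cast (by omega : 1 ≤ 2 * r)
  refine ⟨hLp2, ?_⟩
  obtain ⟨T, hT0, hT⟩ := exists_mixing_rate hmix.alpha_nonneg (div_pos hδ hqpos) hsum
  have hcard : ∀ {n : ℕ}, n ≤ 2 * r → ((Fintype.card (Fin n) : ℕ) : ℝ) ≤ q := fun {n} hn => by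
    have : (n : ℝ) ≤ 2 * r := by exact_mod_cast hn
    simp only [Fintype.card_fin]; linarith
  have hprod : ∀ {n : ℕ}, 1 ≤ n → n ≤ 2 * r → ∀ (c : Fin n → Fin p) (i : Fin n → (Fin d → ℤ)),
      Integrable (fun ω => ∏ j, centred P Z (c j) (i j) ω) P := by
    intro n hn hn' c i
    have hdom : Integrable (fun ω => 1 + ∑ j, |centred P Z (c j) (i j) ω| ^ q) P :=
      (integrable_const _).add (integrable_finsetSum _ fun j _ => (hB (c j) (i j)).1)
    refine hdom.mono' ?_ (Eventually.of_forall fun ω => ?_)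
    · exact (Finset.measurable_fun_prod _ fun j _ =>
        measurable_centred hZ (c j) (i j)).aestronglyMeasurable
    · exact abs_prod_le_one_add_sum (hcard hn') _
  have hmean := integral_centred hZ hstat hint1
  set E : ℕ := r * (d + 1) with hE
  -- A mixed moment of order at most `2 r` involves at most `2 r` sites, so the mixing coefficient
  -- is needed for that cardinality only.
  set G : ℝ := g (2 * r) with hG
  have hG0 : 0 ≤ G := hmix.g_nonneg _ (by linarith)
  -- the bound in terms of `m ≥ 1`
  set K₁ : ℝ := 4 * (T * G) + (2 * r + 1) * B with hK₁
  have hK₁0 : 0 ≤ K₁ := by positivity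
  set K₂ : ℝ := 1 + 2 * r * B with hK₂
  have hK₂0 : 0 ≤ K₂ := by positivity
  have main : ∀ {n : ℕ}, 1 ≤ n → n ≤ 2 * r → ∀ (c : Fin n → Fin p)
      (i : Fin n → (Fin d → ℤ)) (j₀ : Fin n) (m : ℕ), 1 ≤ m →
      (∀ l ≠ j₀, (m : ℝ) ≤ ‖i j₀ - i l‖) →
      |∫ ω, ∏ j, centred P Z (c j) (i j) ω ∂P| ≤ K₁ * ((m : ℝ) ^ E)⁻¹ := by
    intro n hn hn' c i j₀ m hm hsep
    have hnR : (n : ℝ) ≤ 2 * r := by exact_mod_cast hn'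
    have hm1 : (1 : ℝ) ≤ m := by exact_mod_cast hm
    have hm0 : (0 : ℝ) < m := by linarith
    set T₁ : Finset (Fin d → ℤ) := {i j₀}
    set T₂ : Finset (Fin d → ℤ) := (Finset.univ.erase j₀).image i
    have hα : ∀ A A', MeasurableSet[sigmaField Z T₁] A → MeasurableSet[sigmaField Z T₂] A' →
        |P.real (A ∩ A') - P.real A * P.real A'| ≤ α₁ m * G := by
      intro A A' hA hA'
      refine (le_alphaSets hA hA').trans ((alphaSets_le_alpha (k := m) (l := 2 * r) ?_ ?_ ?_).trans
        (hmix.bound _ _ hm0 (by linarith)))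
      · simp [T₁]; linarith
      · have : T₂.card ≤ n := by
          refine Finset.card_image_le.trans ?_
          rw [Finset.card_erase_of_mem (Finset.mem_univ _)]; simp
        exact le_trans (by exact_mod_cast this) hnR
      · intro x hx y hy
        simp only [T₁, T₂, Finset.coe_singleton, Set.mem_singleton_iff, Finset.coe_image,
          Set.mem_image, Finset.mem_coe, Finset.mem_erase] at hx hy
        obtain ⟨l, ⟨hl, -⟩, rfl⟩ := hy
        rw [hx]; exact hsep l hl
    -- With this level the truncation error `M ^ (n - q)` is at most `M ^ (-δ)`, that is m to the
    -- power `-E`.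
    set M : ℝ := (m : ℝ) ^ ((E : ℝ) / δ) with hM
    have hM1 : 1 ≤ M := Real.one_le_rpow hm1 (by positivity)
    have hM0 : 0 < M := by linarith
    have key := abs_integral_prod_le_of_mixing (Y := fun j => centred P Z (c j) (i j))
      (j₀ := j₀) (sigmaField_le hZ T₁) (sigmaField_le hZ T₂) hM0 (hcard hn') hα
      (measurable_centred_sigmaField (by simp [T₁]) _)
      (fun j hj => measurable_centred_sigmaField
        (by simp only [T₂, Finset.coe_image]; exact ⟨j, by simpa using hj, rfl⟩) _)
      (fun j => (hB (c j) (i j)).1) (fun j => (hB (c j) (i j)).2) (hmean _ _) (hprod hn hn' c i)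
      (by simpa using hprod (n := 1) le_rfl (by omega) (fun _ => c j₀) (fun _ => i j₀))
    simp only [Fintype.card_fin] at key
    have hMδ : M ^ (-δ) = ((m : ℝ) ^ E)⁻¹ := by
      rw [hM, ← Real.rpow_mul hm0.le, ← Real.rpow_natCast, ← Real.rpow_neg hm0.le]
      congr 1; field_simp
    have k1 : M ^ ((n : ℝ) - q) ≤ ((m : ℝ) ^ E)⁻¹ := by
      rw [← hMδ]
      exact Real.rpow_le_rpow_of_exponent_le hM1 (by rw [hq]; linarith)
    -- The summability condition provides enough mixing: the inequality amounts to (r - 1)(d - 1) ≥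
    -- 2, true for `r ≥ 3` and `d ≥ 2`.
    have hexp : (E : ℝ) ≤ (2 * (r : ℝ) - 1) * d - 1 := by
      rw [hE]; push_cast
      nlinarith [mul_le_mul (sub_le_sub_right hrR 1) (sub_le_sub_right hdR 1) (by norm_num)
        (by linarith : (0 : ℝ) ≤ (r : ℝ) - 1)]
    -- The exponents add up to -E q / δ + 2 r E / δ = -E, because q - 2r = δ.
    have k2 : α₁ m * M ^ n ≤ T * ((m : ℝ) ^ E)⁻¹ := by
      have a1 : α₁ m ≤ T * (m : ℝ) ^ (-((E : ℝ) * q / δ)) := by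
        refine (hT m hm).trans (mul_le_mul_of_nonneg_left ?_ hT0)
        refine Real.rpow_le_rpow_of_exponent_le hm1 ?_
        rw [neg_le_neg_iff, div_div_eq_mul_div]
        gcongr
      have a2 : M ^ n ≤ (m : ℝ) ^ ((E : ℝ) * (2 * r) / δ) := by
        rw [← Real.rpow_natCast, hM, ← Real.rpow_mul hm0.le]
        refine Real.rpow_le_rpow_of_exponent_le hm1 ?_
        rw [div_mul_eq_mul_div]
        gcongr
      calc α₁ m * M ^ n
          ≤ (T * (m : ℝ) ^ (-((E : ℝ) * q / δ))) * (m : ℝ) ^ ((E : ℝ) * (2 * r) / δ) :=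
            mul_le_mul a1 a2 (by positivity) (by positivity)
        _ = T * ((m : ℝ) ^ E)⁻¹ := by
            rw [mul_assoc, ← Real.rpow_add hm0, ← Real.rpow_natCast, ← Real.rpow_neg hm0.le]
            congr 2
            rw [hq]; field_simp; ring
    have hX : 0 ≤ ((m : ℝ) ^ E)⁻¹ := by positivity
    calc _ ≤ _ := key
      _ = 4 * G * (α₁ m * M ^ n) + ((n : ℝ) + 1) * B * M ^ ((n : ℝ) - q) := by ring
      _ ≤ 4 * G * (T * ((m : ℝ) ^ E)⁻¹) + (2 * r + 1) * B * ((m : ℝ) ^ E)⁻¹ := by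
          gcongr
      _ = K₁ * ((m : ℝ) ^ E)⁻¹ := by rw [hK₁]; ring
  have triv : ∀ {n : ℕ}, 1 ≤ n → n ≤ 2 * r → ∀ (c : Fin n → Fin p)
      (i : Fin n → (Fin d → ℤ)), |∫ ω, ∏ j, centred P Z (c j) (i j) ω ∂P| ≤ K₂ := by
    intro n hn hn' c i
    have hnR : (n : ℝ) ≤ 2 * r := by exact_mod_cast hn'
    have hsi : Integrable (fun ω => ∑ j, |centred P Z (c j) (i j) ω| ^ q) P :=
      integrable_finsetSum _ fun j _ => (hB (c j) (i j)).1
    calc |∫ ω, ∏ j, centred P Z (c j) (i j) ω ∂P|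
        ≤ ∫ ω, |∏ j, centred P Z (c j) (i j) ω| ∂P := abs_integral_le_integral_abs
      _ ≤ ∫ ω, (1 + ∑ j, |centred P Z (c j) (i j) ω| ^ q) ∂P :=
          integral_mono (hprod hn hn' c i).abs ((integrable_const _).add hsi) fun ω =>
            abs_prod_le_one_add_sum (hcard hn') _
      _ = 1 + ∑ j, ∫ ω, |centred P Z (c j) (i j) ω| ^ q ∂P := by
          rw [integral_add (integrable_const _) hsi,
            integral_finsetSum _ fun j _ => (hB (c j) (i j)).1]
          simp
      _ ≤ 1 + ∑ _j : Fin n, B := by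
          gcongr with j; exact (hB (c j) (i j)).2
      _ ≤ K₂ := by
          simp only [Finset.sum_const, Finset.card_univ, Fintype.card_fin, nsmul_eq_mul]
          rw [hK₂]; gcongr
  -- `K₂` covers m = 0, where no separation is available. The factor `2 ^ E` pays for replacing m by
  -- 1 + m when m ≥ 1.
  refine ⟨K₂ + K₁ * 2 ^ E, by positivity, fun c k => measurable_centred hZ c k, hprod, hmean, ?_⟩
  intro n hn hn' c i j₀ m hsep
  rcases Nat.eq_zero_or_pos m with rfl | hm
  · have := triv hn hn' c i
    have h2 : 0 ≤ K₁ * 2 ^ E := by positivity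
    simp only [Nat.cast_zero, add_zero, one_pow, inv_one, mul_one]
    linarith
  · have hm1 : (1 : ℝ) ≤ m := by exact_mod_cast hm
    have hm0 : (0 : ℝ) < m := by linarith
    have h1 := main hn hn' c i j₀ m hm hsep
    have h2 : ((m : ℝ) ^ E)⁻¹ ≤ 2 ^ E * ((1 + (m : ℝ)) ^ E)⁻¹ := by
      rw [← div_eq_mul_inv, inv_eq_one_div, div_le_div_iff₀ (by positivity) (by positivity),
        one_mul, ← mul_pow]
      gcongr; linarith
    have h3 : 0 ≤ K₂ * ((1 + (m : ℝ)) ^ E)⁻¹ := by positivity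
    calc _ ≤ _ := h1
      _ ≤ K₁ * (2 ^ E * ((1 + (m : ℝ)) ^ E)⁻¹) := mul_le_mul_of_nonneg_left h2 hK₁0
      _ ≤ _ := by linarith

/-! ### A summable weight on the lattice -/

/-- The weight `(1 + ‖v‖)^(-(d+1))`. -/
noncomputable def latticeWeight {d : ℕ} (v : Fin d → ℤ) : ℝ := ((1 + ‖v‖) ^ (d + 1))⁻¹

lemma latticeWeight_pos {d : ℕ} (v : Fin d → ℤ) : 0 < latticeWeight v := by
  unfold latticeWeight; positivity

/-- Summability over a lattice of rank `d` of the inverse norm to a power above `d`, transported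
from the integer span of the standard basis of the real space. -/
lemma summable_norm_inv_pow_int (d : ℕ) :
    Summable fun v : Fin d → ℤ => ‖v‖⁻¹ ^ (d + 1) := by
  set b := Pi.basisFun ℝ (Fin d)
  set L : Submodule ℤ (Fin d → ℝ) := Submodule.span ℤ (Set.range b)
  have hrank : Module.finrank ℤ L = d := by
    rw [ZLattice.rank ℝ L]; simp
  have hs := ZLattice.summable_norm_pow_inv L (d + 1) (by omega)
  have hmem : ∀ v : Fin d → ℤ, (fun i => (v i : ℝ)) ∈ L := fun v => by
    refine (b.mem_span_iff_repr_mem ℤ _).mpr fun i => ?_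
    exact ⟨v i, by simp [b]⟩
  have hinj : Function.Injective fun v : Fin d → ℤ => (⟨fun i => (v i : ℝ), hmem v⟩ : L) := by
    intro v w h
    ext i
    have := congrFun (congrArg Subtype.val h) i
    simpa using this
  have := hs.comp_injective hinj
  refine this.congr fun v => ?_
  have e : ‖(⟨fun i => (v i : ℝ), hmem v⟩ : L)‖ = ‖v‖ := by
    rw [Submodule.coe_norm]
    have hv : ∀ j, ‖(v j : ℝ)‖₊ = ‖v j‖₊ := fun j => NNReal.eq (by simp [Int.norm_eq_abs])
    simp [Pi.norm_def, hv]
  simp only [Function.comp_apply, e]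

lemma summable_latticeWeight (d : ℕ) : Summable fun v : Fin d → ℤ => latticeWeight v := by
  -- At the origin the comparison function vanishes, since `0⁻¹ = 0`, while the weight is 1. The
  -- added indicator makes up for this.
  have h1 : Summable fun v : Fin d → ℤ => if v = 0 then (1 : ℝ) else 0 :=
    (hasSum_ite_eq (0 : Fin d → ℤ) (1 : ℝ)).summable
  refine Summable.of_nonneg_of_le (fun v => (latticeWeight_pos v).le) (fun v => ?_)
    ((summable_norm_inv_pow_int d).add h1)
  by_cases hv : v = 0
  · subst hv; simp [latticeWeight]
  · have : 0 < ‖v‖ := norm_pos_iff.mpr hv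
    rw [if_neg hv, add_zero, latticeWeight, inv_pow]
    gcongr; linarith

lemma sum_latticeWeight_sub_le {d : ℕ} (A : Finset (Fin d → ℤ)) (y : Fin d → ℤ) :
    ∑ x ∈ A, latticeWeight (x - y) ≤ ∑' v : Fin d → ℤ, latticeWeight v := by
  have h := (summable_latticeWeight d).sum_le_tsum (A.map (Equiv.subRight y).toEmbedding)
    fun v _ => (latticeWeight_pos v).le
  rwa [Finset.sum_map] at h

/-! ### Domination in graphs without isolated vertices -/

/-- Ore's argument: for a dominating set of least size the complement dominates too. If some `j` of
the set had no neighbour in the complement, then its neighbour would lie in the set, and removing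
`j` would leave a smaller dominating set. One of the two has at most `n / 2` elements. It is
enlarged to exactly that size so that every case gives the same exponent later. -/
lemma exists_dominating {n : ℕ} (hn : 2 ≤ n) {adj : Fin n → Fin n → Prop}
    (hsymm : ∀ j l, adj j l → adj l j) (hadj : ∀ j, ∃ l, l ≠ j ∧ adj j l) :
    ∃ D : Finset (Fin n), D.card = n / 2 ∧ ∀ j ∉ D, ∃ l ∈ D, adj j l := by
  classical
  set good : Finset (Fin n) → Prop := fun D => ∀ j ∉ D, ∃ l ∈ D, adj j l with hgood
  obtain ⟨D, hD, hmin⟩ := Finset.exists_min_image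
    (Finset.univ.filter good) Finset.card ⟨Finset.univ, by simp [hgood]⟩
  simp only [Finset.mem_filter, Finset.mem_univ, true_and] at hD hmin
  have hDc : good Dᶜ := by
    intro j hj
    rw [Finset.mem_compl, not_not] at hj
    by_contra hcon
    push Not at hcon
    obtain ⟨l, hlj, hjl⟩ := hadj j
    have hlD : l ∈ D := by
      by_contra h
      exact hcon l (Finset.mem_compl.mpr h) hjl
    have hg : good (D.erase j) := by
      intro x hx
      by_cases hxj : x = j
      · subst hxj
        exact ⟨l, Finset.mem_erase.mpr ⟨hlj, hlD⟩, hjl⟩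
      · have hxD : x ∉ D := fun h => hx (Finset.mem_erase.mpr ⟨hxj, h⟩)
        obtain ⟨y, hy, hxy⟩ := hD x hxD
        refine ⟨y, Finset.mem_erase.mpr ⟨?_, hy⟩, hxy⟩
        rintro rfl
        exact hcon x (Finset.mem_compl.mpr hxD) (hsymm _ _ hxy)
    have := hmin _ hg
    rw [Finset.card_erase_of_mem hj] at this
    have := Finset.card_pos.mpr ⟨j, hj⟩
    omega
  have key : ∃ E : Finset (Fin n), E.card ≤ n / 2 ∧ good E := by
    have hc : D.card + Dᶜ.card = n := by simp
    rcases le_total D.card Dᶜ.card with h | h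
    · exact ⟨D, by omega, hD⟩
    · exact ⟨Dᶜ, by omega, hDc⟩
  obtain ⟨E, hE, hEg⟩ := key
  obtain ⟨F, hEF, hF⟩ := Finset.exists_superset_card_eq hE (by simp; omega)
  exact ⟨F, hF, fun j hj => by
    obtain ⟨l, hl, h⟩ := hEg j fun h => hj (hEF h)
    exact ⟨l, hEF hl, h⟩⟩

/-- Summation of a product of pair weights along a dominated family of indices. -/
lemma sum_prod_pair_le {α : Type*} [Fintype α] {n : ℕ} (D : Finset (Fin n)) (f : Fin n → Fin n)
    (hf : ∀ j ∉ D, f j ∈ D) {w : α → α → ℝ} {W : ℝ} (hw : ∀ x y, 0 ≤ w x y)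
    (hW : ∀ y, ∑ x, w x y ≤ W) :
    ∑ i : Fin n → α, ∏ j ∈ Dᶜ, w (i j) (i (f j)) ≤
      (Fintype.card α : ℝ) ^ D.card * W ^ (n - D.card) := by
  classical
  have e1 : ∀ i : Fin n → α, ∏ j ∈ Dᶜ, w (i j) (i (f j)) =
      ∏ j : {j // j ∉ D}, w (i j) (i (f j)) := fun i =>
    (Finset.prod_subtype Dᶜ (fun j => by simp) fun j => w (i j) (i (f j)))
  have e2 : ∑ i : Fin n → α, ∏ j ∈ Dᶜ, w (i j) (i (f j)) =
      ∑ uv : ({j // j ∈ D} → α) × ({j // j ∉ D} → α),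
        ∏ j : {j // j ∉ D}, w (uv.2 j) (uv.1 ⟨f j, hf j j.2⟩) := by
    refine Fintype.sum_equiv (Equiv.piEquivPiSubtypeProd (fun j => j ∈ D) fun _ => α) _ _ fun i => ?_
    rw [e1]; rfl
  rw [e2, Fintype.sum_prod_type]
  -- With the indices in `D` fixed, the remaining ones are coupled only to these, so their sum
  -- factorizes.
  have e3 : ∀ u : {j // j ∈ D} → α, ∑ v : {j // j ∉ D} → α,
      ∏ j : {j // j ∉ D}, w (v j) (u ⟨f j, hf j j.2⟩) ≤ W ^ (n - D.card) := by
    intro u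
    rw [← Fintype.prod_sum fun (j : {j // j ∉ D}) x => w x (u ⟨f j, hf j j.2⟩)]
    calc ∏ j : {j // j ∉ D}, ∑ x, w x (u ⟨f j, hf j j.2⟩) ≤ ∏ _j : {j // j ∉ D}, W :=
          Finset.prod_le_prod (fun j _ => Finset.sum_nonneg fun x _ => hw _ _) fun j _ => hW _
      _ = W ^ (n - D.card) := by
          rw [Finset.prod_const, Finset.card_univ, Fintype.card_subtype_compl]
          simp
  calc _ ≤ ∑ _u : {j // j ∈ D} → α, W ^ (n - D.card) := Finset.sum_le_sum fun u _ => e3 u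
    _ = _ := by simp

/-! ### Moment inequality for sums over finite sets of sites -/

section

variable {d p : ℕ} {Ω : Type*} [MeasurableSpace Ω] {P : Measure Ω}
  {Y : Fin p → (Fin d → ℤ) → Ω → ℝ} {r : ℕ} {K : ℝ}

/-- A mixed moment is dominated by a product of pair weights along some dominated family. -/
lemma MomentDecay.exists_dominated (h : MomentDecay P Y r K) {n : ℕ} (hn : 2 ≤ n)
    (hnr : n ≤ 2 * r) (c : Fin n → Fin p) (i : Fin n → (Fin d → ℤ)) :
    ∃ (D : Finset (Fin n)) (f : Fin n → Fin n), D.card = n / 2 ∧ (∀ j ∉ D, f j ∈ D) ∧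
      |∫ ω, ∏ j, Y (c j) (i j) ω ∂P| ≤
        K * 2 ^ (r * (d + 1)) * ∏ j ∈ Dᶜ, latticeWeight (i j - i (f j)) := by
  classical
  have hne : ∀ j : Fin n, (Finset.univ.erase j).Nonempty := fun j => by
    rw [← Finset.card_pos, Finset.card_erase_of_mem (Finset.mem_univ _)]
    simp; omega
  choose nb hnb hnbmin using fun j : Fin n =>
    Finset.exists_min_image (Finset.univ.erase j) (fun l => ‖i j - i l‖) (hne j)
  -- Maximizing the nearest-neighbour distance serves two ends: `j₀` is at distance at least `ρ`
  -- from all other indices, so the decay applies at scale `ρ`; and every index has another one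
  -- within `ρ`, so the graph below has no isolated vertex.
  obtain ⟨j₀, -, hmax⟩ := Finset.exists_max_image (Finset.univ : Finset (Fin n))
    (fun j => ‖i j - i (nb j)‖) ⟨⟨0, by omega⟩, Finset.mem_univ _⟩
  set ρ : ℝ := ‖i j₀ - i (nb j₀)‖ with hρ
  have hρ0 : 0 ≤ ρ := norm_nonneg _
  obtain ⟨D, hDcard, hD⟩ := exists_dominating hn (adj := fun j l => ‖i j - i l‖ ≤ ρ)
    (fun j l hjl => by rwa [norm_sub_rev]) fun j =>
      ⟨nb j, Finset.ne_of_mem_erase (hnb j), hmax j (Finset.mem_univ _)⟩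
  have hD' : ∀ j, ∃ l, j ∉ D → (l ∈ D ∧ ‖i j - i l‖ ≤ ρ) := fun j => by
    by_cases hj : j ∈ D
    · exact ⟨j, fun h => absurd hj h⟩
    · obtain ⟨l, h1, h2⟩ := hD j hj
      exact ⟨l, fun _ => ⟨h1, h2⟩⟩
  choose f hf using hD'
  refine ⟨D, f, hDcard, fun j hj => (hf j hj).1, ?_⟩
  have hdec := h.decay (by omega) hnr c i j₀ ⌊ρ⌋₊ fun l hl =>
    (Nat.floor_le hρ0).trans (hnbmin j₀ l (Finset.mem_erase.mpr ⟨hl, Finset.mem_univ _⟩))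
  -- The decay is stated for integer distances. Rounding `ρ` down costs the factor `2 ^ (r * (d +
  -- 1))`.
  have hfl : 1 + ρ ≤ 2 * (1 + (⌊ρ⌋₊ : ℝ)) := by
    have := Nat.lt_floor_add_one ρ
    have : (0 : ℝ) ≤ (⌊ρ⌋₊ : ℝ) := Nat.cast_nonneg _
    linarith
  have h1 : ((1 + (⌊ρ⌋₊ : ℝ)) ^ (r * (d + 1)))⁻¹ ≤
      2 ^ (r * (d + 1)) * ((1 + ρ) ^ (r * (d + 1)))⁻¹ := by
    rw [← div_eq_mul_inv, inv_eq_one_div, div_le_div_iff₀ (by positivity) (by positivity),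
      one_mul, ← mul_pow]
    gcongr
  -- At most `r` indices lie outside `D`, so the decay supplies a factor `(1 + ρ) ^ (-(d + 1))` for
  -- each of them. That factor is at most the weight of the pair, whose distance is at most `ρ`.
  have h2 : ((1 + ρ) ^ (r * (d + 1)))⁻¹ ≤ ∏ j ∈ Dᶜ, latticeWeight (i j - i (f j)) := by
    have hcard : Dᶜ.card ≤ r := by
      rw [Finset.card_compl, Fintype.card_fin, hDcard]; omega
    calc ((1 + ρ) ^ (r * (d + 1)))⁻¹ = (((1 + ρ) ^ (d + 1))⁻¹) ^ r := by
          rw [mul_comm, pow_mul, inv_pow]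
      _ ≤ (((1 + ρ) ^ (d + 1))⁻¹) ^ Dᶜ.card := by
          refine pow_le_pow_of_le_one (by positivity) ?_ hcard
          exact inv_le_one_of_one_le₀ (one_le_pow₀ (by linarith))
      _ = ∏ _j ∈ Dᶜ, ((1 + ρ) ^ (d + 1))⁻¹ := by rw [Finset.prod_const]
      _ ≤ _ := by
          refine Finset.prod_le_prod (fun _ _ => by positivity) fun j hj => ?_
          rw [latticeWeight]
          have := (hf j (Finset.mem_compl.mp hj)).2
          gcongr
  calc _ ≤ _ := hdec
    _ ≤ K * (2 ^ (r * (d + 1)) * ∏ j ∈ Dᶜ, latticeWeight (i j - i (f j))) := by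
        refine mul_le_mul_of_nonneg_left (h1.trans ?_) h.nonneg
        exact mul_le_mul_of_nonneg_left h2 (by positivity)
    _ = _ := by ring

/-- The dominating pattern depends on the sites. Adding up all of the finitely many patterns gives
one bound valid for every configuration, which can then be summed over configurations. -/
lemma MomentDecay.abs_integral_le_sum (h : MomentDecay P Y r K) {n : ℕ} (hn : 2 ≤ n)
    (hnr : n ≤ 2 * r) (c : Fin n → Fin p) (i : Fin n → (Fin d → ℤ)) {K₁ : ℝ}
    (hK₁ : K₁ = K * 2 ^ (r * (d + 1))) (F : Finset (Finset (Fin n) × (Fin n → Fin n)))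
    (hF : ∀ Df, Df ∈ F ↔ Df.1.card = n / 2 ∧ ∀ j ∉ Df.1, Df.2 j ∈ Df.1) :
    |∫ ω, ∏ j, Y (c j) (i j) ω ∂P| ≤
      ∑ Df ∈ F, K₁ * ∏ j ∈ Df.1ᶜ, latticeWeight (i j - i (Df.2 j)) := by
  obtain ⟨D, f, hD, hf, hb⟩ := h.exists_dominated hn hnr c i
  have hK₀ : 0 ≤ K₁ := hK₁ ▸ mul_nonneg h.nonneg (by positivity)
  have hnn : ∀ Df ∈ F, 0 ≤ K₁ * ∏ j ∈ Df.1ᶜ, latticeWeight (i j - i (Df.2 j)) :=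
    fun Df _ => mul_nonneg hK₀ (Finset.prod_nonneg fun j _ => (latticeWeight_pos _).le)
  rw [← hK₁] at hb
  have hle := Finset.single_le_sum hnn ((hF (D, f)).mpr ⟨hD, hf⟩)
  dsimp only at hle
  exact le_trans hb hle

/-- Moment inequality: products of `n` sums over a finite set `A` of sites have expectation
`O(|A|^⌊n/2⌋)`. -/
theorem MomentDecay.exists_prod_sum_bound (h : MomentDecay P Y r K) {n : ℕ} (hn : 2 ≤ n)
    (hnr : n ≤ 2 * r) :
    ∃ K' : ℝ, 0 ≤ K' ∧ ∀ (c : Fin n → Fin p) (A : Finset (Fin d → ℤ)),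
      |∫ ω, ∏ j, ∑ k ∈ A, Y (c j) k ω ∂P| ≤ K' * (A.card : ℝ) ^ (n / 2) := by
  classical
  set W : ℝ := ∑' v : Fin d → ℤ, latticeWeight v
  have hW0 : 0 ≤ W := tsum_nonneg fun v => (latticeWeight_pos v).le
  obtain ⟨K₁, hKe⟩ : ∃ K₁ : ℝ, K₁ = K * 2 ^ (r * (d + 1)) := ⟨_, rfl⟩
  have hK₁ : 0 ≤ K₁ := hKe ▸ mul_nonneg h.nonneg (by positivity)
  obtain ⟨F, hF⟩ : ∃ F : Finset (Finset (Fin n) × (Fin n → Fin n)),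
      ∀ Df, Df ∈ F ↔ Df.1.card = n / 2 ∧ ∀ j ∉ Df.1, Df.2 j ∈ Df.1 :=
    ⟨Finset.univ.filter fun Df => Df.1.card = n / 2 ∧ ∀ j ∉ Df.1, Df.2 j ∈ Df.1, by simp⟩
  refine ⟨K₁ * (F.card * W ^ (n - n / 2)), by positivity, fun c A => ?_⟩
  have hexp : ∀ ω, ∏ j, ∑ k ∈ A, Y (c j) k ω = ∑ i : Fin n → A, ∏ j, Y (c j) (i j) ω := fun ω => by
    rw [← Fintype.prod_sum fun (j : Fin n) (x : A) => Y (c j) x ω]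
    refine Finset.prod_congr rfl fun j _ => ?_
    rw [← Finset.sum_coe_sort]
  simp_rw [hexp]
  rw [integral_finsetSum _ fun i _ => h.integrable_prod (by omega) hnr c _]
  have hWA : ∀ y : A, ∑ x : A, latticeWeight ((x : Fin d → ℤ) - (y : Fin d → ℤ)) ≤ W := fun y => by
    rw [Finset.sum_coe_sort A fun x => latticeWeight (x - (y : Fin d → ℤ))]
    exact sum_latticeWeight_sub_le A y
  calc |∑ i : Fin n → A, ∫ ω, ∏ j, Y (c j) (i j) ω ∂P|
      ≤ ∑ i : Fin n → A, |∫ ω, ∏ j, Y (c j) (i j) ω ∂P| := Finset.abs_sum_le_sum_abs _ _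
    _ ≤ ∑ i : Fin n → A, ∑ Df ∈ F,
          K₁ * ∏ j ∈ Df.1ᶜ, latticeWeight ((i j : Fin d → ℤ) - (i (Df.2 j) : Fin d → ℤ)) := by
        refine Finset.sum_le_sum fun i _ => ?_
        exact h.abs_integral_le_sum hn hnr c (fun j => (i j : Fin d → ℤ)) hKe F hF
    _ = ∑ Df ∈ F, K₁ * ∑ i : Fin n → A,
          ∏ j ∈ Df.1ᶜ, latticeWeight ((i j : Fin d → ℤ) - (i (Df.2 j) : Fin d → ℤ)) := by
        rw [Finset.sum_comm]; simp_rw [Finset.mul_sum]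
    _ ≤ ∑ _Df ∈ F, K₁ * ((A.card : ℝ) ^ (n / 2) * W ^ (n - n / 2)) := by
        refine Finset.sum_le_sum fun Df hDf => mul_le_mul_of_nonneg_left ?_ hK₁
        obtain ⟨hD, hf⟩ := (hF Df).mp hDf
        have := sum_prod_pair_le Df.1 Df.2 hf
          (w := fun x y : A => latticeWeight ((x : Fin d → ℤ) - (y : Fin d → ℤ)))
          (fun x y => (latticeWeight_pos _).le) hWA
        simpa [hD] using this
    _ = _ := by rw [Finset.sum_const, nsmul_eq_mul]; ring

end

/-! ### Third-order Taylor expansion -/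

section Taylor

variable {p : ℕ}

/-- Coordinates are needed on both sides: the growth condition on H concerns partial derivatives,
and the moment bounds concern products of coordinates. -/
lemma multilinear_apply_diag {n : ℕ}
    (f : ContinuousMultilinearMap ℝ (fun _ : Fin n => EuclideanSpace ℝ (Fin p)) ℝ)
    (v : EuclideanSpace ℝ (Fin p)) :
    f (fun _ => v) = ∑ ν : Fin n → Fin p,
      f (fun j => EuclideanSpace.single (ν j) (1 : ℝ)) * ∏ j, v (ν j) := by
  classical
  have hv : v = ∑ c, v c • EuclideanSpace.single c (1 : ℝ) := by
    ext c
    simp [Finset.sum_apply, Pi.single_apply]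
  have h1 : f (fun _ => v) =
      f.toMultilinearMap fun _ : Fin n => ∑ c, v c • EuclideanSpace.single c (1 : ℝ) := by
    rw [← hv]; rfl
  rw [h1, MultilinearMap.map_sum]
  refine Finset.sum_congr rfl fun ν _ => ?_
  rw [MultilinearMap.map_smul_univ, smul_eq_mul, mul_comm]
  rfl

lemma abs_prod_coord_le {n : ℕ} (v : EuclideanSpace ℝ (Fin p)) (ν : Fin n → Fin p) :
    |∏ j, v (ν j)| ≤ ‖v‖ ^ n := by
  rw [Finset.abs_prod]
  calc ∏ j, |v (ν j)| ≤ ∏ _j : Fin n, ‖v‖ :=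
        Finset.prod_le_prod (fun _ _ => abs_nonneg _) fun j _ => PiLp.norm_apply_le v (ν j)
    _ = ‖v‖ ^ n := by simp

lemma iteratedDeriv_comp_line {H : EuclideanSpace ℝ (Fin p) → ℝ} {n : ℕ} (hH : ContDiff ℝ n H)
    (x v : EuclideanSpace ℝ (Fin p)) (s : ℝ) :
    iteratedDeriv n (fun s : ℝ => H (x + s • v)) s =
      iteratedFDeriv ℝ n H (x + s • v) (fun _ => v) := by
  set L : ℝ →L[ℝ] EuclideanSpace ℝ (Fin p) := ContinuousLinearMap.toSpanSingleton ℝ v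
  have hf : ContDiff ℝ n fun y => H (x + y) := hH.comp (contDiff_const.add contDiff_id)
  have e : (fun s : ℝ => H (x + s • v)) = (fun y => H (x + y)) ∘ L := by
    ext s; simp [L]
  rw [iteratedDeriv_eq_iteratedFDeriv, e, L.iteratedFDeriv_comp_right hf _ le_rfl,
    iteratedFDeriv_comp_add_left]
  simp [L]

/-- Second-order Taylor expansion with a remainder controlled by the third derivatives. -/
theorem exists_taylor_bound {H : EuclideanSpace ℝ (Fin p) → ℝ} {a : ℕ}
    (hH : SmoothCondition H 3 a) (x : EuclideanSpace ℝ (Fin p)) :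
    ∃ (C : ℝ) (b : (Fin 2 → Fin p) → ℝ), 0 ≤ C ∧ ∀ v : EuclideanSpace ℝ (Fin p),
      |H (x + v) - H x - fderiv ℝ H x v - ∑ ν, b ν * ∏ j, v (ν j)| ≤
        C * (‖v‖ ^ 3 + ‖v‖ ^ (3 + a)) := by
  obtain ⟨hC3, C, hC, hbound⟩ := hH
  have hC3' : ContDiff ℝ (3 : ℕ) H := hC3
  -- There are `p ^ 3` third partial derivatives. The last factor absorbs the growth at an
  -- intermediate point, whose norm is at most `‖x‖ + ‖v‖`.
  refine ⟨C * (p : ℝ) ^ 3 * (1 + 2 ^ a * ‖x‖ ^ a + 2 ^ a),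
    fun ν => iteratedFDeriv ℝ 2 H x (fun j => EuclideanSpace.single (ν j) (1 : ℝ)) / 2,
    by positivity, fun v => ?_⟩
  set γ : ℝ → ℝ := fun s => H (x + s • v) with hγ
  have hγC : ContDiff ℝ 3 γ :=
    hC3.comp (contDiff_const.add (contDiff_id.smul contDiff_const))
  -- The one-variable Taylor formula along the segment from `x` to `x + v`.
  obtain ⟨ξ, hξ, hrem⟩ := taylor_mean_remainder_lagrange_iteratedDeriv (f := γ) (x := 1) (x₀ := 0)
    (n := 2) zero_ne_one hγC.contDiffOn
  rw [Set.uIoo_of_le zero_le_one] at hξ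
  have hd : ∀ n : ℕ, n ≤ 3 → iteratedDerivWithin n γ (Set.uIcc 0 1) 0 =
      iteratedFDeriv ℝ n H x (fun _ => v) := fun n hn => by
    have hHn : ContDiff ℝ n H := hC3'.of_le (by exact_mod_cast hn)
    have hγn : ContDiff ℝ n γ := hγC.of_le (by exact_mod_cast hn)
    rw [iteratedDerivWithin_eq_iteratedDeriv (uniqueDiffOn_uIcc zero_ne_one) hγn.contDiffAt
      (Set.left_mem_uIcc), iteratedDeriv_comp_line hHn]
    simp
  have hT : taylorWithinEval γ 2 (Set.uIcc 0 1) 0 1 =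
      H x + fderiv ℝ H x v + iteratedFDeriv ℝ 2 H x (fun _ => v) / 2 := by
    rw [taylorWithinEval_succ, taylorWithinEval_succ, taylor_within_zero_eval,
      hd 2 (by norm_num), hd 1 (by norm_num)]
    rw [iteratedFDeriv_one_apply]
    simp [hγ]
    ring
  have h3 : iteratedDeriv 3 γ ξ = iteratedFDeriv ℝ 3 H (x + ξ • v) (fun _ => v) :=
    iteratedDeriv_comp_line hC3' x v ξ
  have h2 : ∑ ν : Fin 2 → Fin p,
      iteratedFDeriv ℝ 2 H x (fun j => EuclideanSpace.single (ν j) (1 : ℝ)) / 2 * ∏ j, v (ν j) =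
      iteratedFDeriv ℝ 2 H x (fun _ => v) / 2 := by
    rw [multilinear_apply_diag, Finset.sum_div]
    exact Finset.sum_congr rfl fun ν _ => by ring
  have h1 : H (x + v) = γ 1 := by simp [hγ]
  have hdiff : H (x + v) - H x - fderiv ℝ H x v - ∑ ν : Fin 2 → Fin p,
      iteratedFDeriv ℝ 2 H x (fun j => EuclideanSpace.single (ν j) (1 : ℝ)) / 2 * ∏ j, v (ν j) =
      iteratedFDeriv ℝ 3 H (x + ξ • v) (fun _ => v) / 6 := by
    rw [h2, h1, ← h3]
    rw [hT] at hrem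
    have : ((2 + 1).factorial : ℝ) = 6 := by norm_num [Nat.factorial]
    rw [this] at hrem
    simp only [sub_zero, one_pow, mul_one] at hrem
    rw [← hrem]; ring
  rw [hdiff]
  have hx : ‖x + ξ • v‖ ≤ ‖x‖ + ‖v‖ := by
    refine (norm_add_le _ _).trans ?_
    rw [norm_smul, Real.norm_of_nonneg hξ.1.le]
    have := mul_le_of_le_one_left (norm_nonneg v) hξ.2.le
    linarith
  have hxa : ‖x + ξ • v‖ ^ a ≤ 2 ^ a * ‖x‖ ^ a + 2 ^ a * ‖v‖ ^ a := by
    calc ‖x + ξ • v‖ ^ a ≤ (‖x‖ + ‖v‖) ^ a := by gcongr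
      _ ≤ 2 ^ (a - 1) * (‖x‖ ^ a + ‖v‖ ^ a) := add_pow_le (norm_nonneg _) (norm_nonneg _) a
      _ ≤ 2 ^ a * (‖x‖ ^ a + ‖v‖ ^ a) := by
          gcongr
          · norm_num
          · omega
      _ = _ := by ring
  have hD : |iteratedFDeriv ℝ 3 H (x + ξ • v) (fun _ => v)| ≤
      (p : ℝ) ^ 3 * (C * (1 + ‖x + ξ • v‖ ^ a) * ‖v‖ ^ 3) := by
    rw [multilinear_apply_diag]
    refine (Finset.abs_sum_le_sum_abs _ _).trans ?_
    calc _ ≤ ∑ _ν : Fin 3 → Fin p, C * (1 + ‖x + ξ • v‖ ^ a) * ‖v‖ ^ 3 := by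
          refine Finset.sum_le_sum fun ν _ => ?_
          rw [abs_mul]
          exact mul_le_mul (hbound _ ν) (abs_prod_coord_le v ν) (abs_nonneg _) (by positivity)
      _ = _ := by simp
  rw [abs_div, abs_of_pos (by norm_num : (0 : ℝ) < 6)]
  have hv3 : (0 : ℝ) ≤ ‖v‖ ^ 3 := by positivity
  have hva : (0 : ℝ) ≤ ‖v‖ ^ a := by positivity
  calc _ ≤ |iteratedFDeriv ℝ 3 H (x + ξ • v) (fun _ => v)| := div_le_self (abs_nonneg _) (by norm_num)
    _ ≤ _ := hD
    _ ≤ (p : ℝ) ^ 3 * (C * (1 + (2 ^ a * ‖x‖ ^ a + 2 ^ a * ‖v‖ ^ a)) * ‖v‖ ^ 3) := by gcongr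
    _ ≤ _ := by
        rw [pow_add]
        have e1 : 0 ≤ (1 + 2 ^ a * ‖x‖ ^ a) * (‖v‖ ^ 3 * ‖v‖ ^ a) + 2 ^ a * ‖v‖ ^ 3 := by positivity
        have e2 : 0 ≤ (p : ℝ) ^ 3 * C := by positivity
        nlinarith [mul_nonneg e2 e1]

end Taylor

/-! ### Moments of sample means and of the linearization error -/

section Moments

variable {d p : ℕ} {Ω : Type*} [MeasurableSpace Ω] {P : Measure Ω}
  {Z : (Fin d → ℤ) → Ω → EuclideanSpace ℝ (Fin p)} {r : ℕ} {K : ℝ}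

/-- The deviation of the sample mean over `A` from the mean of the field. -/
noncomputable def meanDev (P : Measure Ω) (Z : (Fin d → ℤ) → Ω → EuclideanSpace ℝ (Fin p))
    (A : Finset (Fin d → ℤ)) (ω : Ω) : EuclideanSpace ℝ (Fin p) :=
  (A.card : ℝ)⁻¹ • ∑ k ∈ A, Z k ω - fieldMean P Z

lemma meanDev_eq {A : Finset (Fin d → ℤ)} (hA : A.Nonempty) (ω : Ω) :
    meanDev P Z A ω = (A.card : ℝ)⁻¹ • ∑ k ∈ A, (Z k ω - fieldMean P Z) := by
  have hN : (A.card : ℝ) ≠ 0 := by exact_mod_cast hA.card_pos.ne'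
  rw [meanDev, Finset.sum_sub_distrib, smul_sub, Finset.sum_const, ← Nat.cast_smul_eq_nsmul ℝ,
    smul_smul, inv_mul_cancel₀ hN, one_smul]

lemma meanDev_apply {A : Finset (Fin d → ℤ)} (hA : A.Nonempty) (ω : Ω) (c : Fin p) :
    meanDev P Z A ω c = (A.card : ℝ)⁻¹ * ∑ k ∈ A, centred P Z c k ω := by
  rw [meanDev_eq hA]
  simp [centred]

/-- Every coordinate is bounded by the largest one. This reduces even moments of the norm to moments
of single coordinates, which have signed expansions into mixed moments. -/
lemma pow_two_mul_norm_le (v : EuclideanSpace ℝ (Fin p)) {s : ℕ} (hs : 1 ≤ s) :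
    ‖v‖ ^ (2 * s) ≤ (p : ℝ) ^ s * ∑ c, v c ^ (2 * s) := by
  rw [pow_mul, EuclideanSpace.real_norm_sq_eq]
  have hnn : ∀ c, 0 ≤ v c ^ (2 * s) := fun c => by rw [pow_mul]; positivity
  rcases Nat.eq_zero_or_pos p with rfl | hp
  · have hs0 : s ≠ 0 := by omega
    simp [hs0]
  · obtain ⟨c₀, -, hc₀⟩ := Finset.exists_max_image Finset.univ (fun c => v c ^ 2)
      ⟨⟨0, hp⟩, Finset.mem_univ _⟩
    calc (∑ c, v c ^ 2) ^ s ≤ (∑ _c : Fin p, v c₀ ^ 2) ^ s := by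
          refine pow_le_pow_left₀ (Finset.sum_nonneg fun c _ => sq_nonneg _) ?_ s
          exact Finset.sum_le_sum fun c hc => hc₀ c hc
      _ = (p : ℝ) ^ s * v c₀ ^ (2 * s) := by simp [mul_pow, pow_mul]
      _ ≤ _ := by
          gcongr
          exact Finset.single_le_sum (f := fun c => v c ^ (2 * s)) (fun c _ => hnn c)
            (Finset.mem_univ c₀)

/-- The exponent is ⌈n/2⌉. For odd `n` this gains half a power of `N` over Hölder's inequality. For
n = 3 the gain is essential: a cross term of order N^(-3/2) would contribute N^(-1/2) to the scaled
variance, which for d = 2 is of the same order as the bias. -/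
lemma MomentDecay.exists_prod_meanDev_bound (h : MomentDecay P (centred P Z) r K) {n : ℕ}
    (hn : 2 ≤ n) (hnr : n ≤ 2 * r) :
    ∃ K' : ℝ, 0 ≤ K' ∧ ∀ (c : Fin n → Fin p) (A : Finset (Fin d → ℤ)), A.Nonempty →
      |∫ ω, ∏ j, meanDev P Z A ω (c j) ∂P| ≤ K' * ((A.card : ℝ) ^ (n - n / 2))⁻¹ := by
  obtain ⟨K', hK', hb⟩ := h.exists_prod_sum_bound hn hnr
  refine ⟨K', hK', fun c A hA => ?_⟩
  have hN : (0 : ℝ) < A.card := by exact_mod_cast hA.card_pos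
  have e : ∀ ω, ∏ j, meanDev P Z A ω (c j) =
      ((A.card : ℝ) ^ n)⁻¹ * ∏ j, ∑ k ∈ A, centred P Z (c j) k ω := fun ω => by
    simp_rw [meanDev_apply hA, Finset.prod_mul_distrib]
    simp
  simp_rw [e]
  rw [integral_const_mul, abs_mul, abs_of_pos (by positivity)]
  calc _ ≤ ((A.card : ℝ) ^ n)⁻¹ * (K' * (A.card : ℝ) ^ (n / 2)) := by gcongr; exact hb c A
    _ = _ := by
        have hsplit : (A.card : ℝ) ^ n = (A.card : ℝ) ^ (n - n / 2) * (A.card : ℝ) ^ (n / 2) := by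
          rw [← pow_add]; congr 1; omega
        rw [hsplit]
        field_simp

variable [IsProbabilityMeasure P]

lemma memLp_meanDev (hLp : ∀ k, MemLp (Z k) (2 * r : ℕ) P) (A : Finset (Fin d → ℤ)) :
    MemLp (meanDev P Z A) (2 * r : ℕ) P :=
  ((memLp_finsetSum A fun k _ => hLp k).const_smul (A.card : ℝ)⁻¹).sub (memLp_const _)

lemma integrable_norm_meanDev_pow (hLp : ∀ k, MemLp (Z k) (2 * r : ℕ) P)
    (A : Finset (Fin d → ℤ)) {m : ℕ} (hm : m ≤ 2 * r) :
    Integrable (fun ω => ‖meanDev P Z A ω‖ ^ m) P := by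
  have h : MemLp (meanDev P Z A) (m : ℕ) P :=
    (memLp_meanDev hLp A).mono_exponent (by exact_mod_cast hm)
  rcases Nat.eq_zero_or_pos m with rfl | hm0
  · simp
  · exact h.integrable_norm_pow hm0.ne'

/-- Even moments of the deviation of a sample mean. -/
lemma MomentDecay.exists_norm_meanDev_bound (h : MomentDecay P (centred P Z) r K)
    (hLp : ∀ k, MemLp (Z k) (2 * r : ℕ) P) {s : ℕ} (hs : 1 ≤ s) (hsr : s ≤ r) :
    ∃ K' : ℝ, 0 ≤ K' ∧ ∀ A : Finset (Fin d → ℤ), A.Nonempty →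
      ∫ ω, ‖meanDev P Z A ω‖ ^ (2 * s) ∂P ≤ K' * ((A.card : ℝ) ^ s)⁻¹ := by
  obtain ⟨K', hK', hb⟩ := h.exists_prod_meanDev_bound (n := 2 * s) (by omega) (by omega)
  refine ⟨(p : ℝ) ^ s * (p * K'), by positivity, fun A hA => ?_⟩
  have hci : ∀ c, Integrable (fun ω => meanDev P Z A ω c ^ (2 * s)) P := fun c => by
    refine (integrable_norm_meanDev_pow hLp A (m := 2 * s) (by omega)).mono' ?_
      (Eventually.of_forall fun ω => ?_)
    · have := (memLp_meanDev hLp A).aestronglyMeasurable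
      exact ((EuclideanSpace.proj (𝕜 := ℝ) c).continuous.comp_aestronglyMeasurable this).pow _
    · rw [norm_pow]
      exact pow_le_pow_left₀ (norm_nonneg _) (PiLp.norm_apply_le _ c) _
  calc ∫ ω, ‖meanDev P Z A ω‖ ^ (2 * s) ∂P
      ≤ ∫ ω, (p : ℝ) ^ s * ∑ c, meanDev P Z A ω c ^ (2 * s) ∂P :=
        integral_mono (integrable_norm_meanDev_pow hLp A (by omega))
          ((integrable_finsetSum _ fun c _ => hci c).const_mul _) fun ω =>
            pow_two_mul_norm_le _ hs
    _ = (p : ℝ) ^ s * ∑ c, ∫ ω, meanDev P Z A ω c ^ (2 * s) ∂P := by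
        rw [integral_const_mul, integral_finsetSum _ fun c _ => hci c]
    _ ≤ (p : ℝ) ^ s * ∑ _c : Fin p, K' * ((A.card : ℝ) ^ s)⁻¹ := by
        gcongr with c
        have := hb (fun _ => c) A hA
        simp only [Finset.prod_const, Finset.card_univ, Fintype.card_fin,
          show 2 * s - 2 * s / 2 = s by omega] at this
        exact (le_abs_self _).trans this
    _ = _ := by simp; ring

/-- The linear part of the statistic over `A`. -/
noncomputable def linPart (P : Measure Ω) (H : EuclideanSpace ℝ (Fin p) → ℝ)
    (Z : (Fin d → ℤ) → Ω → EuclideanSpace ℝ (Fin p)) (A : Finset (Fin d → ℤ)) (ω : Ω) : ℝ :=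
  fderiv ℝ H (fieldMean P Z) (meanDev P Z A ω)

/-- The linearization error of the statistic over `A`. -/
noncomputable def linError (P : Measure Ω) (H : EuclideanSpace ℝ (Fin p) → ℝ)
    (Z : (Fin d → ℤ) → Ω → EuclideanSpace ℝ (Fin p)) (A : Finset (Fin d → ℤ)) (ω : Ω) : ℝ :=
  H (fieldMean P Z + meanDev P Z A ω) - H (fieldMean P Z) - linPart P H Z A ω

lemma pow_le_pow_add_pow {x : ℝ} (hx : 0 ≤ x) {m n k : ℕ} (h1 : n ≤ m) (h2 : m ≤ k) :
    x ^ m ≤ x ^ n + x ^ k := by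
  rcases le_total x 1 with h | h
  · have := pow_le_pow_of_le_one hx h h1
    have : 0 ≤ x ^ k := by positivity
    linarith
  · have := pow_le_pow_right₀ h h2
    have : 0 ≤ x ^ n := by positivity
    linarith

lemma fderiv_apply_eq_sum (H : EuclideanSpace ℝ (Fin p) → ℝ) (x v : EuclideanSpace ℝ (Fin p)) :
    fderiv ℝ H x v = ∑ c, fderiv ℝ H x (EuclideanSpace.single c 1) * v c := by
  conv_lhs => rw [show v = ∑ c, v c • EuclideanSpace.single c (1 : ℝ) by
    ext c; simp [Finset.sum_apply, Pi.single_apply]]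
  simp [mul_comm]

lemma memLp_linPart (hLp : ∀ k, MemLp (Z k) (2 * r : ℕ) P) (hr : 1 ≤ r)
    (H : EuclideanSpace ℝ (Fin p) → ℝ) (A : Finset (Fin d → ℤ)) :
    MemLp (linPart P H Z A) 2 P := by
  refine (fderiv ℝ H (fieldMean P Z)).comp_memLp' ?_
  exact (memLp_meanDev hLp A).mono_exponent (by exact_mod_cast (by omega : 2 ≤ 2 * r))

lemma aestronglyMeasurable_linError (hLp : ∀ k, MemLp (Z k) (2 * r : ℕ) P)
    {H : EuclideanSpace ℝ (Fin p) → ℝ} (hH : Continuous H) (A : Finset (Fin d → ℤ)) :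
    AEStronglyMeasurable (linError P H Z A) P := by
  have hv := (memLp_meanDev hLp A).aestronglyMeasurable
  have h1 := (hH.comp (continuous_const_add (fieldMean P Z))).comp_aestronglyMeasurable hv
  have h2 := (fderiv ℝ H (fieldMean P Z)).continuous.comp_aestronglyMeasurable hv
  exact (h1.sub aestronglyMeasurable_const).sub h2

/-- The square of the linearization error and its product with the linear part. -/
theorem exists_linError_bound {H : EuclideanSpace ℝ (Fin p) → ℝ} {a : ℕ}
    (hH : SmoothCondition H 3 a) (hLp : ∀ k, MemLp (Z k) (2 * (3 + a) : ℕ) P)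
    (h : MomentDecay P (centred P Z) (3 + a) K) :
    (∀ A, MemLp (linError P H Z A) 2 P) ∧
    ∃ K' : ℝ, 0 ≤ K' ∧ ∀ A : Finset (Fin d → ℤ), A.Nonempty →
      ∫ ω, linError P H Z A ω ^ 2 ∂P ≤ K' * ((A.card : ℝ) ^ 2)⁻¹ ∧
      |∫ ω, linPart P H Z A ω * linError P H Z A ω ∂P| ≤ K' * ((A.card : ℝ) ^ 2)⁻¹ := by
  obtain ⟨C, b, hC, hT⟩ := exists_taylor_bound hH (fieldMean P Z)
  set ℓ := fderiv ℝ H (fieldMean P Z) with hℓ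
  set x : Finset (Fin d → ℤ) → Ω → ℝ := fun A ω => ‖meanDev P Z A ω‖ with hx
  have hx0 : ∀ A ω, 0 ≤ x A ω := fun A ω => norm_nonneg _
  -- All powers of the deviation that need absolute bounds below lie between 4 and 2(3 + a), the top
  -- order with a moment bound, so this one function dominates them.
  set F : Finset (Fin d → ℤ) → Ω → ℝ := fun A ω => x A ω ^ 4 + x A ω ^ (2 * (3 + a)) with hF
  set Q : Finset (Fin d → ℤ) → Ω → ℝ := fun A ω => ∑ ν, b ν * ∏ j, meanDev P Z A ω (ν j) with hQ
  set R : Finset (Fin d → ℤ) → Ω → ℝ := fun A ω => linError P H Z A ω - Q A ω with hR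
  have hFi : ∀ A, Integrable (F A) P := fun A =>
    (integrable_norm_meanDev_pow hLp A (by omega)).add (integrable_norm_meanDev_pow hLp A le_rfl)
  set β : ℝ := ∑ ν, |b ν| with hβ
  have hβ0 : 0 ≤ β := Finset.sum_nonneg fun _ _ => abs_nonneg _
  have hQb : ∀ A ω, |Q A ω| ≤ β * x A ω ^ 2 := fun A ω => by
    refine (Finset.abs_sum_le_sum_abs _ _).trans ?_
    rw [hβ, Finset.sum_mul]
    refine Finset.sum_le_sum fun ν _ => ?_
    rw [abs_mul]
    exact mul_le_mul_of_nonneg_left (abs_prod_coord_le _ ν) (abs_nonneg _)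
  have hRb : ∀ A ω, |R A ω| ≤ C * (x A ω ^ 3 + x A ω ^ (3 + a)) := fun A ω => hT _
  have hWF : ∀ A ω, linError P H Z A ω ^ 2 ≤ 3 * (β ^ 2 + 2 * C ^ 2) * F A ω := fun A ω => by
    have e : linError P H Z A ω = Q A ω + R A ω := by simp only [hR]; ring
    have h1 := hQb A ω
    have h2 := hRb A ω
    have y0 := hx0 A ω
    have p6 : x A ω ^ 6 ≤ F A ω := pow_le_pow_add_pow y0 (by omega) (by omega)
    have p4 : x A ω ^ 4 ≤ F A ω := pow_le_pow_add_pow y0 (by omega) (by omega)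
    have p7 : (x A ω ^ (3 + a)) ^ 2 ≤ F A ω := by
      rw [← pow_mul, mul_comm]; exact pow_le_pow_add_pow y0 (by omega) le_rfl
    have h3 : |linError P H Z A ω| ≤ β * x A ω ^ 2 + (C * x A ω ^ 3 + C * x A ω ^ (3 + a)) := by
      rw [e]; refine (abs_add_le _ _).trans ?_; linarith
    have h4 : ∀ u v w : ℝ, (u + (v + w)) ^ 2 ≤ 3 * (u ^ 2 + v ^ 2 + w ^ 2) := fun u v w => by
      nlinarith [sq_nonneg (u - v), sq_nonneg (v - w), sq_nonneg (u - w)]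
    calc linError P H Z A ω ^ 2 = |linError P H Z A ω| ^ 2 := (sq_abs _).symm
      _ ≤ (β * x A ω ^ 2 + (C * x A ω ^ 3 + C * x A ω ^ (3 + a))) ^ 2 := by gcongr
      _ ≤ _ := h4 _ _ _
      _ = 3 * (β ^ 2 * x A ω ^ 4 + C ^ 2 * x A ω ^ 6 + C ^ 2 * (x A ω ^ (3 + a)) ^ 2) := by ring
      _ ≤ 3 * (β ^ 2 * F A ω + C ^ 2 * F A ω + C ^ 2 * F A ω) := by gcongr
      _ = _ := by ring
  have hLRF : ∀ A ω, |linPart P H Z A ω * R A ω| ≤ 2 * ‖ℓ‖ * C * F A ω := fun A ω => by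
    have y0 := hx0 A ω
    have p4 : x A ω ^ 4 ≤ F A ω := pow_le_pow_add_pow y0 (by omega) (by omega)
    have p5 : x A ω ^ (4 + a) ≤ F A ω := pow_le_pow_add_pow y0 (by omega) (by omega)
    rw [abs_mul]
    calc _ ≤ (‖ℓ‖ * x A ω) * (C * (x A ω ^ 3 + x A ω ^ (3 + a))) :=
          mul_le_mul (ℓ.le_opNorm _) (hRb A ω) (abs_nonneg _) (by positivity)
      _ = ‖ℓ‖ * C * (x A ω ^ 4 + x A ω ^ (4 + a)) := by ring
      _ ≤ ‖ℓ‖ * C * (F A ω + F A ω) := by gcongr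
      _ = _ := by ring
  have hWm : ∀ A, AEStronglyMeasurable (linError P H Z A) P := fun A =>
    aestronglyMeasurable_linError hLp hH.1.continuous A
  have hWi : ∀ A, Integrable (fun ω => linError P H Z A ω ^ 2) P := fun A => by
    refine ((hFi A).const_mul (3 * (β ^ 2 + 2 * C ^ 2))).mono' ((hWm A).pow 2)
      (Eventually.of_forall fun ω => ?_)
    rw [Real.norm_of_nonneg (sq_nonneg _)]
    exact hWF A ω
  have hW2 : ∀ A, MemLp (linError P H Z A) 2 P := fun A =>
    (memLp_two_iff_integrable_sq (hWm A)).mpr (hWi A)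
  refine ⟨hW2, ?_⟩
  obtain ⟨K₂, hK₂, hb₂⟩ := h.exists_norm_meanDev_bound hLp (s := 2) (by omega) (by omega)
  obtain ⟨Kr, hKr, hbr⟩ := h.exists_norm_meanDev_bound hLp (s := 3 + a) (by omega) le_rfl
  obtain ⟨K₃, hK₃, hb₃⟩ := h.exists_prod_meanDev_bound (n := 3) (by omega) (by omega)
  have hFb : ∀ A : Finset (Fin d → ℤ), A.Nonempty →
      ∫ ω, F A ω ∂P ≤ (K₂ + Kr) * ((A.card : ℝ) ^ 2)⁻¹ := fun A hA => by
    have hN : (1 : ℝ) ≤ A.card := by exact_mod_cast hA.card_pos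
    rw [hF, integral_add (integrable_norm_meanDev_pow hLp A (by omega))
      (integrable_norm_meanDev_pow hLp A le_rfl), add_mul]
    have h1 := hb₂ A hA
    have h2 := hbr A hA
    have h3 : ((A.card : ℝ) ^ (3 + a))⁻¹ ≤ ((A.card : ℝ) ^ 2)⁻¹ := by
      gcongr
      omega
    have h4 := mul_le_mul_of_nonneg_left h3 hKr
    exact add_le_add h1 (h2.trans h4)
  set γ : ℝ := ∑ c, |ℓ (EuclideanSpace.single c 1)| with hγ
  have hγ0 : 0 ≤ γ := Finset.sum_nonneg fun _ _ => abs_nonneg _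
  set K₄ : ℝ := 3 * (β ^ 2 + 2 * C ^ 2) * (K₂ + Kr)
  set K₅ : ℝ := γ * β * K₃ + 2 * ‖ℓ‖ * C * (K₂ + Kr)
  have hK₄ : 0 ≤ K₄ := by positivity
  have hK₅ : 0 ≤ K₅ := by positivity
  refine ⟨K₄ + K₅, by positivity, fun A hA => ⟨?_, ?_⟩⟩
  · have hN : (0 : ℝ) < A.card := by exact_mod_cast hA.card_pos
    calc _ ≤ ∫ ω, 3 * (β ^ 2 + 2 * C ^ 2) * F A ω ∂P :=
          integral_mono (hWi A) ((hFi A).const_mul _) (hWF A)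
      _ = 3 * (β ^ 2 + 2 * C ^ 2) * ∫ ω, F A ω ∂P := integral_const_mul _ _
      _ ≤ 3 * (β ^ 2 + 2 * C ^ 2) * ((K₂ + Kr) * ((A.card : ℝ) ^ 2)⁻¹) := by
          gcongr; exact hFb A hA
      _ = K₄ * ((A.card : ℝ) ^ 2)⁻¹ := by ring
      _ ≤ _ := by gcongr; linarith
  · have hN : (0 : ℝ) < A.card := by exact_mod_cast hA.card_pos
    have hLm := (memLp_linPart hLp (by omega) H A).aestronglyMeasurable
    have hvm := (memLp_meanDev hLp A).aestronglyMeasurable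
    have hcm : ∀ c, AEStronglyMeasurable (fun ω => meanDev P Z A ω c) P := fun c =>
      (EuclideanSpace.proj (𝕜 := ℝ) c).continuous.comp_aestronglyMeasurable hvm
    have hpi : ∀ c : Fin 3 → Fin p, Integrable (fun ω => ∏ j, meanDev P Z A ω (c j)) P := fun c => by
      refine (integrable_norm_meanDev_pow hLp A (m := 3) (by omega)).mono' ?_
        (Eventually.of_forall fun ω => abs_prod_coord_le _ c)
      exact Finset.aestronglyMeasurable_fun_prod _ fun j _ => hcm (c j)
    -- Linear times quadratic is a combination of cubic monomials. Their signed expectations are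
    -- O(N⁻²), whereas bounding their absolute values by even moments would give only N^(-3/2).
    have hLQ : ∀ ω, linPart P H Z A ω * Q A ω = ∑ c, ∑ ν : Fin 2 → Fin p,
        ℓ (EuclideanSpace.single c 1) * b ν *
          ∏ j, meanDev P Z A ω ((Fin.cons c ν : Fin 3 → Fin p) j) := fun ω => by
      rw [linPart, fderiv_apply_eq_sum, hQ, Finset.sum_mul_sum]
      refine Finset.sum_congr rfl fun c _ => Finset.sum_congr rfl fun ν _ => ?_
      rw [Fin.prod_univ_succ (n := 2)]
      simp only [Fin.cons_zero, Fin.cons_succ]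
      ring
    have hLQi : Integrable (fun ω => linPart P H Z A ω * Q A ω) P := by
      simp_rw [hLQ]
      exact integrable_finsetSum _ fun c _ => integrable_finsetSum _ fun ν _ =>
        (hpi _).const_mul _
    have hLWi : Integrable (fun ω => linPart P H Z A ω * linError P H Z A ω) P :=
      (memLp_linPart hLp (by omega) H A).integrable_mul (hW2 A)
    have hLRe : ∀ ω, linPart P H Z A ω * R A ω =
        linPart P H Z A ω * linError P H Z A ω - linPart P H Z A ω * Q A ω := fun ω => by
      simp only [hR]; ring
    have hLRi : Integrable (fun ω => linPart P H Z A ω * R A ω) P := by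
      simp_rw [hLRe]; exact hLWi.sub hLQi
    have hsum : ∫ ω, linPart P H Z A ω * linError P H Z A ω ∂P =
        ∫ ω, linPart P H Z A ω * Q A ω ∂P + ∫ ω, linPart P H Z A ω * R A ω ∂P := by
      rw [← integral_add hLQi hLRi]
      refine integral_congr_ae (Eventually.of_forall fun ω => ?_)
      simp only [hLRe]; ring
    have b1 : |∫ ω, linPart P H Z A ω * Q A ω ∂P| ≤ γ * β * K₃ * ((A.card : ℝ) ^ 2)⁻¹ := by
      simp_rw [hLQ]
      rw [integral_finsetSum _ fun c _ => integrable_finsetSum _ fun ν _ => (hpi _).const_mul _]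
      refine (Finset.abs_sum_le_sum_abs _ _).trans ?_
      rw [hγ, Finset.sum_mul, Finset.sum_mul, Finset.sum_mul]
      refine Finset.sum_le_sum fun c _ => ?_
      rw [integral_finsetSum _ fun ν _ => (hpi _).const_mul _]
      refine (Finset.abs_sum_le_sum_abs _ _).trans ?_
      rw [hβ, Finset.mul_sum, Finset.sum_mul, Finset.sum_mul]
      refine Finset.sum_le_sum fun ν _ => ?_
      rw [integral_const_mul, abs_mul, abs_mul, mul_assoc (_ * _) K₃]
      exact mul_le_mul_of_nonneg_left (hb₃ _ A hA) (by positivity)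
    have b2 : |∫ ω, linPart P H Z A ω * R A ω ∂P| ≤
        2 * ‖ℓ‖ * C * (K₂ + Kr) * ((A.card : ℝ) ^ 2)⁻¹ := by
      calc _ ≤ ∫ ω, |linPart P H Z A ω * R A ω| ∂P := abs_integral_le_integral_abs
        _ ≤ ∫ ω, 2 * ‖ℓ‖ * C * F A ω ∂P :=
            integral_mono hLRi.abs ((hFi A).const_mul _) (hLRF A)
        _ = 2 * ‖ℓ‖ * C * ∫ ω, F A ω ∂P := integral_const_mul _ _
        _ ≤ 2 * ‖ℓ‖ * C * ((K₂ + Kr) * ((A.card : ℝ) ^ 2)⁻¹) := by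
            gcongr; exact hFb A hA
        _ = _ := by ring
    rw [hsum]
    calc _ ≤ _ := abs_add_le _ _
      _ ≤ K₅ * ((A.card : ℝ) ^ 2)⁻¹ := by
          rw [add_mul]; exact add_le_add b1 b2
      _ ≤ _ := by gcongr; linarith

end Moments

/-! ### Second moments of the linear part -/

section Linear

variable {d p : ℕ} {Ω : Type*} [MeasurableSpace Ω] {P : Measure Ω}
  {Z : (Fin d → ℤ) → Ω → EuclideanSpace ℝ (Fin p)} {r : ℕ} {K : ℝ}
  {H : EuclideanSpace ℝ (Fin p) → ℝ}

/-- The linearized contribution of the observation with label `k`. -/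
noncomputable def influence (P : Measure Ω) (H : EuclideanSpace ℝ (Fin p) → ℝ)
    (Z : (Fin d → ℤ) → Ω → EuclideanSpace ℝ (Fin p)) (k : Fin d → ℤ) (ω : Ω) : ℝ :=
  fderiv ℝ H (fieldMean P Z) (Z k ω - fieldMean P Z)

lemma influence_eq_sum (k : Fin d → ℤ) (ω : Ω) :
    influence P H Z k ω =
      ∑ c, fderiv ℝ H (fieldMean P Z) (EuclideanSpace.single c 1) * centred P Z c k ω :=
  fderiv_apply_eq_sum H _ _

lemma linPart_eq {A : Finset (Fin d → ℤ)} (hA : A.Nonempty) (ω : Ω) :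
    linPart P H Z A ω = (A.card : ℝ)⁻¹ * ∑ k ∈ A, influence P H Z k ω := by
  simp [linPart, meanDev_eq hA, influence, map_sum]

variable [IsProbabilityMeasure P]

lemma memLp_two_of_memLp (hLp : ∀ k, MemLp (Z k) (2 * r : ℕ) P) (hr : 1 ≤ r) (k : Fin d → ℤ) :
    MemLp (Z k) 2 P :=
  (hLp k).mono_exponent (by exact_mod_cast (by omega : 2 ≤ 2 * r))

lemma memLp_influence (hL2 : ∀ k, MemLp (Z k) 2 P) (k : Fin d → ℤ) :
    MemLp (influence P H Z k) 2 P :=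
  (fderiv ℝ H (fieldMean P Z)).comp_memLp' ((hL2 k).sub (memLp_const _))

lemma integral_influence (hZ : ∀ k, Measurable (Z k)) (hstat : IsStationary P Z)
    (hL2 : ∀ k, MemLp (Z k) 2 P) (k : Fin d → ℤ) : ∫ ω, influence P H Z k ω ∂P = 0 := by
  have hi : ∀ k, Integrable (Z k) P := fun k => (hL2 k).integrable one_le_two
  have hci : ∀ c, Integrable (centred P Z c k) P := fun c =>
    (EuclideanSpace.proj (𝕜 := ℝ) c).integrable_comp ((hi k).sub (integrable_const _))
  simp_rw [influence_eq_sum]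
  rw [integral_finsetSum _ fun c _ => (hci c).const_mul _]
  simp [integral_const_mul, integral_centred hZ hstat hi]

lemma sigma_eq_integral (hZ : ∀ k, Measurable (Z k)) (hstat : IsStationary P Z)
    (hL2 : ∀ k, MemLp (Z k) 2 P) (k : Fin d → ℤ) :
    sigma P Z H k = ∫ ω, influence P H Z 0 ω * influence P H Z k ω ∂P := by
  have hm : ∀ k, ∫ ω, fderiv ℝ H (fieldMean P Z) (Z k ω) ∂P =
      fderiv ℝ H (fieldMean P Z) (fieldMean P Z) := fun k => by
    rw [ContinuousLinearMap.integral_comp_comm _ ((hL2 k).integrable one_le_two)]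
    congr 1
    exact (hstat.identDistrib hZ k).integral_eq
  simp only [sigma, covariance, hm, influence, map_sub]

lemma integral_influence_mul (hZ : ∀ k, Measurable (Z k)) (hstat : IsStationary P Z)
    (hL2 : ∀ k, MemLp (Z k) 2 P) (i j : Fin d → ℤ) :
    ∫ ω, influence P H Z i ω * influence P H Z j ω ∂P = sigma P Z H (j - i) := by
  rw [sigma_eq_integral hZ hstat hL2]
  set F : ((Fin d → ℤ) → EuclideanSpace ℝ (Fin p)) → ℝ := fun z =>
    fderiv ℝ H (fieldMean P Z) (z 0 - fieldMean P Z) *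
      fderiv ℝ H (fieldMean P Z) (z (j - i) - fieldMean P Z) with hF
  have hFm : Measurable F := by
    have := (fderiv ℝ H (fieldMean P Z)).measurable
    have hk : ∀ k, Measurable fun z : (Fin d → ℤ) → EuclideanSpace ℝ (Fin p) =>
        fderiv ℝ H (fieldMean P Z) (z k - fieldMean P Z) := fun k =>
      this.comp ((measurable_pi_apply k).sub_const _)
    exact (hk 0).mul (hk (j - i))
  have := ((hstat.identDistrib_field hZ i).comp hFm).integral_eq
  simpa [hF, Function.comp_def, influence] using this

/-- The covariances of the linearized field decay polynomially. -/
lemma MomentDecay.exists_sigma_bound (h : MomentDecay P (centred P Z) r K) (hr : 2 ≤ r)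
    (hZ : ∀ k, Measurable (Z k)) (hstat : IsStationary P Z) (hL2 : ∀ k, MemLp (Z k) 2 P) :
    ∃ K' : ℝ, 0 ≤ K' ∧ ∀ k : Fin d → ℤ,
      (1 + ‖k‖) * |sigma P Z H k| ≤ K' * latticeWeight k := by
  set ℓ : Fin p → ℝ := fun c => fderiv ℝ H (fieldMean P Z) (EuclideanSpace.single c 1) with hℓ
  set E : ℕ := r * (d + 1) with hE
  set γ : ℝ := ∑ b, ∑ c, |ℓ b * ℓ c| with hγ
  have hγ0 : 0 ≤ γ := Finset.sum_nonneg fun _ _ => Finset.sum_nonneg fun _ _ => abs_nonneg _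
  have hK := h.nonneg
  refine ⟨γ * (K * 2 ^ E), by positivity, fun k => ?_⟩
  have hpair : ∀ b c ω, centred P Z b 0 ω * centred P Z c k ω =
      ∏ j : Fin 2, centred P Z (![b, c] j) (![0, k] j) ω := fun b c ω => by
    simp [Fin.prod_univ_two]
  have hpi : ∀ b c, Integrable (fun ω => centred P Z b 0 ω * centred P Z c k ω) P := fun b c => by
    simp_rw [hpair]
    exact h.integrable_prod (by omega) (by omega) _ _
  set m : ℕ := ⌊‖k‖⌋₊
  have hdec : ∀ b c, |∫ ω, centred P Z b 0 ω * centred P Z c k ω ∂P| ≤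
      K * ((1 + (m : ℝ)) ^ E)⁻¹ := fun b c => by
    simp_rw [hpair]
    refine h.decay (by omega) (by omega) _ _ 0 m fun l hl => ?_
    obtain rfl : l = 1 := by omega
    simpa using Nat.floor_le (norm_nonneg k)
  have hfl : 1 + ‖k‖ ≤ 2 * (1 + (m : ℝ)) := by
    have h1 := Nat.lt_floor_add_one ‖k‖
    have h2 : (0 : ℝ) ≤ (m : ℝ) := Nat.cast_nonneg _
    have h3 : ‖k‖ < (m : ℝ) + 1 := h1
    linarith
  have hk0 := norm_nonneg k
  have h1 : ((1 + (m : ℝ)) ^ E)⁻¹ ≤ 2 ^ E * ((1 + ‖k‖) ^ E)⁻¹ := by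
    rw [← div_eq_mul_inv, inv_eq_one_div, div_le_div_iff₀ (by positivity) (by positivity),
      one_mul, ← mul_pow]
    gcongr
  -- Since `r ≥ 2`, the exponent is at least `d + 2`, one more than the lattice weight uses. The
  -- spare power pays for the factor `1 + ‖k‖` that the linear growth of the excess will require.
  have h2 : (1 + ‖k‖) * ((1 + ‖k‖) ^ E)⁻¹ ≤ latticeWeight k := by
    have hx : (1 : ℝ) ≤ 1 + ‖k‖ := by linarith
    have h3 : (1 + ‖k‖) ^ (d + 2) ≤ (1 + ‖k‖) ^ E := by
      refine pow_le_pow_right₀ hx ?_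
      rw [hE]; nlinarith
    have h4 : (1 + ‖k‖) * ((1 + ‖k‖) ^ (d + 2))⁻¹ = latticeWeight k := by
      rw [latticeWeight, pow_succ (1 + ‖k‖) (d + 1)]
      have : (1 + ‖k‖) ≠ 0 := by positivity
      field_simp
    rw [← h4]
    gcongr
  have hs : |sigma P Z H k| ≤ γ * (K * ((1 + (m : ℝ)) ^ E)⁻¹) := by
    rw [sigma_eq_integral hZ hstat hL2]
    have e : ∀ ω, influence P H Z 0 ω * influence P H Z k ω =
        ∑ b, ∑ c, ℓ b * ℓ c * (centred P Z b 0 ω * centred P Z c k ω) := fun ω => by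
      rw [influence_eq_sum, influence_eq_sum, Finset.sum_mul_sum]
      refine Finset.sum_congr rfl fun b _ => Finset.sum_congr rfl fun c _ => ?_
      ring
    simp_rw [e]
    rw [integral_finsetSum _ fun b _ => integrable_finsetSum _ fun c _ => (hpi b c).const_mul _]
    refine (Finset.abs_sum_le_sum_abs _ _).trans ?_
    rw [hγ, Finset.sum_mul]
    refine Finset.sum_le_sum fun b _ => ?_
    rw [integral_finsetSum _ fun c _ => (hpi b c).const_mul _]
    refine (Finset.abs_sum_le_sum_abs _ _).trans ?_
    rw [Finset.sum_mul]
    refine Finset.sum_le_sum fun c _ => ?_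
    rw [integral_const_mul, abs_mul]
    exact mul_le_mul_of_nonneg_left (hdec b c) (abs_nonneg _)
  calc (1 + ‖k‖) * |sigma P Z H k|
      ≤ (1 + ‖k‖) * (γ * (K * (2 ^ E * ((1 + ‖k‖) ^ E)⁻¹))) := by
        refine mul_le_mul_of_nonneg_left (hs.trans ?_) (by positivity)
        gcongr
    _ = γ * (K * 2 ^ E) * ((1 + ‖k‖) * ((1 + ‖k‖) ^ E)⁻¹) := by ring
    _ ≤ _ := by gcongr

/-- The second moment of a sum of linearized contributions over a family of sites. -/
lemma integral_sum_influence_sq (hZ : ∀ k, Measurable (Z k)) (hstat : IsStationary P Z)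
    (hL2 : ∀ k, MemLp (Z k) 2 P) {β : Type*} (Q : Finset β) (φ : β → (Fin d → ℤ)) :
    ∫ ω, (∑ q ∈ Q, influence P H Z (φ q) ω) ^ 2 ∂P =
      ∑ q ∈ Q, ∑ q' ∈ Q, sigma P Z H (φ q' - φ q) := by
  have hi : ∀ i j, Integrable (fun ω => influence P H Z i ω * influence P H Z j ω) P := fun i j =>
    (memLp_influence hL2 i).integrable_mul (memLp_influence hL2 j)
  simp_rw [sq, Finset.sum_mul_sum]
  rw [integral_finsetSum _ fun q _ => integrable_finsetSum _ fun q' _ => hi _ _]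
  refine Finset.sum_congr rfl fun q _ => ?_
  rw [integral_finsetSum _ fun q' _ => hi _ _]
  exact Finset.sum_congr rfl fun q' _ => integral_influence_mul hZ hstat hL2 _ _

/-- If every site occurs at most `κ` times, the second moment of the sum is at most
`κ |Q| ∑ |σ|`. -/
lemma integral_sum_influence_sq_le (hZ : ∀ k, Measurable (Z k)) (hstat : IsStationary P Z)
    (hL2 : ∀ k, MemLp (Z k) 2 P) (hsum : Summable fun k => |sigma P Z H k|)
    {β : Type*} (Q : Finset β) (φ : β → (Fin d → ℤ)) {κ : ℕ}
    (hκ : ∀ z, (Q.filter fun q => φ q = z).card ≤ κ) :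
    ∫ ω, (∑ q ∈ Q, influence P H Z (φ q) ω) ^ 2 ∂P ≤
      Q.card * (κ * ∑' k, |sigma P Z H k|) := by
  classical
  rw [integral_sum_influence_sq hZ hstat hL2, ← nsmul_eq_mul]
  refine Finset.sum_le_card_nsmul _ _ _ fun q _ => ?_
  calc ∑ q' ∈ Q, sigma P Z H (φ q' - φ q) ≤ ∑ q' ∈ Q, |sigma P Z H (φ q' - φ q)| :=
        Finset.sum_le_sum fun _ _ => le_abs_self _
    -- Repeated sites are grouped so that their multiplicities can be bounded by `κ`.
    _ = ∑ z ∈ Q.image φ, (Q.filter fun q' => φ q' = z).card • |sigma P Z H (z - φ q)| :=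
        Finset.sum_comp (fun z => |sigma P Z H (z - φ q)|) φ
    _ ≤ ∑ z ∈ Q.image φ, κ * |sigma P Z H (z - φ q)| := by
        refine Finset.sum_le_sum fun z _ => ?_
        rw [nsmul_eq_mul]
        gcongr
        exact hκ z
    _ = κ * ∑ z ∈ Q.image φ, |sigma P Z H (z - φ q)| := by rw [Finset.mul_sum]
    _ ≤ κ * ∑' k, |sigma P Z H k| := by
        gcongr
        have := hsum.sum_le_tsum ((Q.image φ).map (Equiv.subRight (φ q)).toEmbedding)
          fun _ _ => abs_nonneg _
        rwa [Finset.sum_map] at this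

/-! ### Sites lost under translation -/

/-- The number of sites of `A` that are not in `k + A`. -/
def excess (A : Finset (Fin d → ℤ)) (k : Fin d → ℤ) : ℕ :=
  (A.filter fun x => x - k ∉ A).card

lemma card_filter_add_excess (A : Finset (Fin d → ℤ)) (k : Fin d → ℤ) :
    (A.filter fun x => x - k ∈ A).card + excess A k = A.card :=
  Finset.card_filter_add_card_filter_not _

lemma excess_le_card (A : Finset (Fin d → ℤ)) (k : Fin d → ℤ) : excess A k ≤ A.card :=
  Finset.card_filter_le _ _

lemma excess_zero (A : Finset (Fin d → ℤ)) : excess A 0 = 0 := by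
  simp [excess]

/-- If `x` is lost under `k + l`, then either `x` is lost under `k`, or `x - k` is still in `A` and
is lost under `l`. -/
lemma excess_add_le (A : Finset (Fin d → ℤ)) (k l : Fin d → ℤ) :
    excess A (k + l) ≤ excess A k + excess A l := by
  classical
  have h : (A.filter fun x => x - (k + l) ∉ A) ⊆ (A.filter fun x => x - k ∉ A) ∪
      (A.filter fun x => x - l ∉ A).map (addRightEmbedding k) := by
    intro x hx
    rw [Finset.mem_filter] at hx
    rw [Finset.mem_union, Finset.mem_filter, Finset.mem_map]
    by_cases hk : x - k ∈ A
    · right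
      refine ⟨x - k, Finset.mem_filter.mpr ⟨hk, ?_⟩, by simp⟩
      rw [sub_sub]; exact hx.2
    · exact Or.inl ⟨hx.1, hk⟩
  refine (Finset.card_le_card h).trans ((Finset.card_union_le _ _).trans_eq ?_)
  rw [Finset.card_map]; rfl

/-- Translation by `k` matches the sites that are kept in the two directions, so equally many are
lost. -/
lemma excess_neg (A : Finset (Fin d → ℤ)) (k : Fin d → ℤ) : excess A (-k) = excess A k := by
  have h : (A.filter fun x => x - -k ∈ A).card = (A.filter fun x => x - k ∈ A).card := by
    refine Finset.card_bij (fun x _ => x + k) ?_ ?_ ?_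
    · intro x hx
      simp only [Finset.mem_filter, sub_neg_eq_add] at hx
      simpa using ⟨hx.2, hx.1⟩
    · intro x _ y _ hxy
      simpa using hxy
    · intro y hy
      rw [Finset.mem_filter] at hy
      exact ⟨y - k, by simpa using ⟨hy.2, hy.1⟩, by simp⟩
  have h1 := card_filter_add_excess A k
  have h2 := card_filter_add_excess A (-k)
  omega

lemma excess_nsmul_le (A : Finset (Fin d → ℤ)) (k : Fin d → ℤ) (m : ℕ) :
    excess A (m • k) ≤ m * excess A k := by
  induction m with
  | zero => simp [excess_zero]
  | succ m ih =>
    rw [succ_nsmul]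
    refine (excess_add_le A _ _).trans ?_
    rw [add_mul, one_mul]
    omega

lemma excess_zsmul_le (A : Finset (Fin d → ℤ)) (k : Fin d → ℤ) (m : ℤ) :
    excess A (m • k) ≤ m.natAbs * excess A k := by
  rcases Int.natAbs_eq m with h | h
  · conv_lhs => rw [h]
    rw [natCast_zsmul]; exact excess_nsmul_le A k _
  · conv_lhs => rw [h]
    rw [neg_smul, natCast_zsmul, excess_neg]; exact excess_nsmul_le A k _

lemma excess_sum_le {β : Type*} (A : Finset (Fin d → ℤ)) (s : Finset β) (f : β → (Fin d → ℤ)) :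
    excess A (∑ b ∈ s, f b) ≤ ∑ b ∈ s, excess A (f b) := by
  classical
  induction s using Finset.induction_on with
  | empty => simp [excess_zero]
  | insert b s hb ih =>
    rw [Finset.sum_insert hb, Finset.sum_insert hb]
    exact (excess_add_le A _ _).trans (by omega)

/-- Subadditivity and symmetry along a path of unit steps. Control of the unit translations thus
yields a bound for all `k`, linear in the norm, as dominated convergence needs. -/
lemma excess_le_norm_mul (A : Finset (Fin d → ℤ)) (k : Fin d → ℤ) :
    (excess A k : ℝ) ≤ ‖k‖ * ∑ i, (excess A (Pi.single i 1) : ℝ) := by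
  have hk : k = ∑ i, k i • (Pi.single i (1 : ℤ) : Fin d → ℤ) := by
    ext j
    simp [Finset.sum_apply, Pi.single_apply]
  have h1 : excess A k ≤ ∑ i, (k i).natAbs * excess A (Pi.single i 1) := by
    conv_lhs => rw [hk]
    refine (excess_sum_le A _ _).trans (Finset.sum_le_sum fun i _ => excess_zsmul_le A _ _)
  calc (excess A k : ℝ) ≤ ∑ i, ((k i).natAbs : ℝ) * excess A (Pi.single i 1) := by
        exact_mod_cast h1
    _ ≤ ∑ i, ‖k‖ * (excess A (Pi.single i 1) : ℝ) := by
        refine Finset.sum_le_sum fun i _ => mul_le_mul_of_nonneg_right ?_ (Nat.cast_nonneg _)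
        rw [Nat.cast_natAbs, Int.cast_abs, ← Int.norm_eq_abs]
        exact norm_le_pi_norm k i
    _ = _ := by rw [Finset.mul_sum]

/-- The scaled variance of the linear part. -/
lemma card_mul_integral_linPart_sq (hZ : ∀ k, Measurable (Z k)) (hstat : IsStationary P Z)
    (hL2 : ∀ k, MemLp (Z k) 2 P) (hsum : Summable fun k => |sigma P Z H k|)
    {A : Finset (Fin d → ℤ)} (hA : A.Nonempty) :
    A.card * ∫ ω, linPart P H Z A ω ^ 2 ∂P =
      ∑' k, sigma P Z H k - (A.card : ℝ)⁻¹ * ∑' k, excess A k * sigma P Z H k := by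
  classical
  have hN : (A.card : ℝ) ≠ 0 := by exact_mod_cast hA.card_pos.ne'
  have hs : Summable fun k => sigma P Z H k := hsum.of_abs
  have hse : Summable fun k => (excess A k : ℝ) * sigma P Z H k := by
    refine Summable.of_norm_bounded (hsum.mul_left (A.card : ℝ)) fun k => ?_
    rw [norm_mul, Real.norm_natCast, Real.norm_eq_abs]
    gcongr
    exact excess_le_card A k
  -- Pairs of sites are grouped by their difference. The difference `k` occurs once for every site
  -- of `A` that also lies in `k + A`.
  have e0 : ∑ x ∈ A, ∑ y ∈ A, sigma P Z H (y - x) =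
      ∑' k, ((A.filter fun x => x - k ∈ A).card : ℝ) * sigma P Z H k := by
    set D := (A ×ˢ A).image fun q => q.2 - q.1
    have hcard : ∀ k, ((A ×ˢ A).filter fun q => q.2 - q.1 = k).card =
        (A.filter fun x => x - k ∈ A).card := fun k => by
      refine Finset.card_bij (fun q _ => q.2) ?_ ?_ ?_
      · rintro ⟨x, y⟩ hq
        simp only [Finset.mem_filter, Finset.mem_product] at hq ⊢
        refine ⟨hq.1.2, ?_⟩
        rw [← hq.2]; simpa using hq.1.1
      · rintro ⟨x, y⟩ hq ⟨x', y'⟩ hq' h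
        simp only [Finset.mem_filter] at hq hq' h
        have : x = x' := by
          have h1 := hq.2.trans hq'.2.symm
          rw [h] at h1
          exact sub_right_injective h1
        rw [this, h]
      · intro y hy
        rw [Finset.mem_filter] at hy
        exact ⟨(y - k, y), by simp [hy.1, hy.2], rfl⟩
    rw [tsum_eq_sum (s := D), ← Finset.sum_product',
      Finset.sum_comp (fun k => sigma P Z H k) fun q : (Fin d → ℤ) × (Fin d → ℤ) => q.2 - q.1]
    · refine Finset.sum_congr rfl fun k _ => ?_
      rw [nsmul_eq_mul, hcard]
    · intro k hk
      have : (A.filter fun x => x - k ∈ A) = ∅ := by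
        refine Finset.filter_eq_empty_iff.mpr fun x hx hxk => hk ?_
        exact Finset.mem_image.mpr ⟨(x - k, x), by simp [hx, hxk], by simp⟩
      simp [this]
  have e1 : ∀ k, ((A.filter fun x => x - k ∈ A).card : ℝ) = A.card - excess A k := fun k => by
    rw [← card_filter_add_excess A k]; push_cast; ring
  have e2 : ∫ ω, linPart P H Z A ω ^ 2 ∂P =
      ((A.card : ℝ)⁻¹) ^ 2 * ∑ x ∈ A, ∑ y ∈ A, sigma P Z H (y - x) := by
    simp_rw [linPart_eq hA, mul_pow]
    rw [integral_const_mul]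
    congr 1
    exact integral_sum_influence_sq hZ hstat hL2 A id
  rw [e2, e0]
  simp_rw [e1, sub_mul]
  rw [(hs.mul_left _).tsum_sub hse, tsum_mul_left]
  field_simp

end Linear

/-! ### Variance of the statistic and mean of the subsample estimator -/

section Estimator

/-- The mean of the subsample estimator is the common scaled variance minus the scaled variance of
the average. -/
lemma integral_subsample_average {Ω β : Type*} [MeasurableSpace Ω] {P : Measure Ω}
    [IsProbabilityMeasure P] {J : Finset β} (hJ : J.Nonempty) {X : β → Ω → ℝ}
    (hX : ∀ i, MemLp (X i) 2 P) {m V : ℝ} (hm : ∀ i, ∫ ω, X i ω ∂P = m)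
    (hV : ∀ i, Var[X i; P] = V) (N : ℝ) :
    ∫ ω, (J.card : ℝ)⁻¹ * ∑ i ∈ J, N * (X i ω - (J.card : ℝ)⁻¹ * ∑ j ∈ J, X j ω) ^ 2 ∂P =
      N * (V - Var[fun ω => (J.card : ℝ)⁻¹ * ∑ j ∈ J, X j ω; P]) := by
  have hN : (J.card : ℝ) ≠ 0 := by exact_mod_cast hJ.card_pos.ne'
  set T : Ω → ℝ := fun ω => (J.card : ℝ)⁻¹ * ∑ j ∈ J, X j ω with hT
  have hTL : MemLp T 2 P := (memLp_finsetSum J fun j _ => hX j).const_mul _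
  have hXi : ∀ i, Integrable (X i) P := fun i => (hX i).integrable one_le_two
  have hTm : ∫ ω, T ω ∂P = m := by
    rw [hT, integral_const_mul, integral_finsetSum _ fun j _ => hXi j]
    simp only [hm, Finset.sum_const, nsmul_eq_mul]
    field_simp
  have hXs : ∀ i, Integrable (fun ω => (X i ω - m) ^ 2) P := fun i =>
    ((hX i).sub (memLp_const m)).integrable_sq
  have hTs : Integrable (fun ω => (T ω - m) ^ 2) P := (hTL.sub (memLp_const m)).integrable_sq
  have hVi : ∀ i, ∫ ω, (X i ω - m) ^ 2 ∂P = V := fun i => by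
    rw [← hV i, variance_eq_integral (hX i).aemeasurable, hm i]
  have hVT : ∫ ω, (T ω - m) ^ 2 ∂P = Var[T; P] := by
    rw [variance_eq_integral hTL.aemeasurable, hTm]
  -- The usual decomposition of a sample variance around the true mean `m`, with Σ Xᵢ = |J| T in the
  -- cross term.
  have hpt : ∀ ω, (J.card : ℝ)⁻¹ * ∑ i ∈ J, N * (X i ω - T ω) ^ 2 =
      N * ((J.card : ℝ)⁻¹ * ∑ i ∈ J, (X i ω - m) ^ 2 - (T ω - m) ^ 2) := fun ω => by
    have e1 : ∑ i ∈ J, X i ω = J.card * T ω := by rw [hT]; field_simp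
    have e2 : ∑ i ∈ J, N * (X i ω - T ω) ^ 2 =
        N * (∑ i ∈ J, (X i ω - m) ^ 2 - 2 * (T ω - m) * ∑ i ∈ J, X i ω +
          J.card * ((T ω) ^ 2 - m ^ 2)) := by
      rw [Finset.mul_sum, ← Finset.sum_sub_distrib, ← nsmul_eq_mul, ← Finset.sum_const,
        ← Finset.sum_add_distrib, Finset.mul_sum]
      exact Finset.sum_congr rfl fun i _ => by ring
    rw [e2, e1]
    field_simp
    ring
  change ∫ ω, (J.card : ℝ)⁻¹ * ∑ i ∈ J, N * (X i ω - T ω) ^ 2 ∂P = N * (V - Var[T; P])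
  simp_rw [hpt]
  rw [integral_const_mul, integral_sub ((integrable_finsetSum _ fun i _ => hXs i).const_mul _) hTs,
    integral_const_mul, integral_finsetSum _ fun i _ => hXs i, hVT]
  simp only [hVi, Finset.sum_const, nsmul_eq_mul]
  field_simp

lemma integrable_subsample_average {Ω β : Type*} [MeasurableSpace Ω] {P : Measure Ω}
    [IsProbabilityMeasure P] (J : Finset β) {X : β → Ω → ℝ}
    (hX : ∀ i, MemLp (X i) 2 P) (N : β → ℝ) :
    Integrable (fun ω => (J.card : ℝ)⁻¹ *
      ∑ i ∈ J, N i * (X i ω - (J.card : ℝ)⁻¹ * ∑ j ∈ J, X j ω) ^ 2) P := by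
  have hTL : MemLp (fun ω => (J.card : ℝ)⁻¹ * ∑ j ∈ J, X j ω) 2 P :=
    (memLp_finsetSum J fun j _ => hX j).const_mul _
  exact (integrable_finsetSum _ fun i _ => ((hX i).sub hTL).integrable_sq.const_mul _).const_mul _

variable {d p : ℕ} {Ω : Type*} [MeasurableSpace Ω] {P : Measure Ω}
  {Z : (Fin d → ℤ) → Ω → EuclideanSpace ℝ (Fin p)} {K : ℝ}
  {H : EuclideanSpace ℝ (Fin p) → ℝ}

/-- The statistic computed from the observations with labels in `A`. -/
noncomputable def finStat (H : EuclideanSpace ℝ (Fin p) → ℝ)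
    (Z : (Fin d → ℤ) → Ω → EuclideanSpace ℝ (Fin p)) (A : Finset (Fin d → ℤ)) (ω : Ω) : ℝ :=
  H ((A.card : ℝ)⁻¹ • ∑ k ∈ A, Z k ω)

lemma finStat_eq (P : Measure Ω) (A : Finset (Fin d → ℤ)) (ω : Ω) :
    finStat H Z A ω = H (fieldMean P Z) + (linPart P H Z A ω + linError P H Z A ω) := by
  simp only [finStat, linError, meanDev, add_sub_cancel]

/-- The translate `A + h`. -/
def shift (A : Finset (Fin d → ℤ)) (h : Fin d → ℤ) : Finset (Fin d → ℤ) :=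
  A.map (addRightEmbedding h)

lemma card_shift (A : Finset (Fin d → ℤ)) (h : Fin d → ℤ) : (shift A h).card = A.card :=
  Finset.card_map _

lemma sum_shift {M : Type*} [AddCommMonoid M] (A : Finset (Fin d → ℤ)) (h : Fin d → ℤ)
    (f : (Fin d → ℤ) → M) : ∑ k ∈ shift A h, f k = ∑ k ∈ A, f (k + h) :=
  Finset.sum_map _ _ _

lemma shift_nonempty {A : Finset (Fin d → ℤ)} (hA : A.Nonempty) (h : Fin d → ℤ) :
    (shift A h).Nonempty := hA.map

lemma identDistrib_finStat_shift (hZ : ∀ k, Measurable (Z k)) (hstat : IsStationary P Z)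
    (hH : Continuous H) (A : Finset (Fin d → ℤ)) (h : Fin d → ℤ) :
    IdentDistrib (finStat H Z (shift A h)) (finStat H Z A) P P := by
  set F : ((Fin d → ℤ) → EuclideanSpace ℝ (Fin p)) → ℝ := fun z =>
    H ((A.card : ℝ)⁻¹ • ∑ k ∈ A, z k) with hF
  have hFm : Measurable F := by
    refine hH.measurable.comp ?_
    have hk : ∀ k, Measurable fun z : (Fin d → ℤ) → EuclideanSpace ℝ (Fin p) => z k := fun k =>
      measurable_pi_apply k
    have hs : Measurable fun z : (Fin d → ℤ) → EuclideanSpace ℝ (Fin p) => ∑ k ∈ A, z k :=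
      Finset.measurable_fun_sum A fun k _ => hk k
    exact hs.const_smul (A.card : ℝ)⁻¹
  have := (hstat.identDistrib_field hZ h).comp hFm
  have e : finStat H Z (shift A h) = F ∘ fun ω k => Z (k + h) ω := by
    ext ω
    simp [finStat, hF, card_shift, sum_shift]
  rw [e]
  exact this

variable [IsProbabilityMeasure P]

lemma integral_linPart (hZ : ∀ k, Measurable (Z k)) (hstat : IsStationary P Z)
    (hL2 : ∀ k, MemLp (Z k) 2 P) {A : Finset (Fin d → ℤ)} (hA : A.Nonempty) :
    ∫ ω, linPart P H Z A ω ∂P = 0 := by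
  simp_rw [linPart_eq hA]
  rw [integral_const_mul, integral_finsetSum _ fun k _ =>
    (memLp_influence hL2 k).integrable one_le_two]
  simp [integral_influence hZ hstat hL2]

/-- Second-order asymptotics of the variance of the statistic, and the bias of the subsample
variance estimator built from translates of one set of sites. -/
theorem exists_bias_bounds {a : ℕ} (hZ : ∀ k, Measurable (Z k)) (hstat : IsStationary P Z)
    (hH : SmoothCondition H 3 a) (hLp : ∀ k, MemLp (Z k) (2 * (3 + a) : ℕ) P)
    (h : MomentDecay P (centred P Z) (3 + a) K) :
    (∀ A, MemLp (finStat H Z A) 2 P) ∧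
    ∃ K' : ℝ, 0 ≤ K' ∧
      (∀ A : Finset (Fin d → ℤ), A.Nonempty →
        |A.card * Var[finStat H Z A; P] -
          (∑' k, sigma P Z H k - (A.card : ℝ)⁻¹ * ∑' k, excess A k * sigma P Z H k)| ≤
            K' * (A.card : ℝ)⁻¹) ∧
      ∀ (A J : Finset (Fin d → ℤ)) (u : (Fin d → ℤ) → (Fin d → ℤ)) (κ : ℕ), A.Nonempty →
        J.Nonempty → (∀ z, ((J ×ˢ A).filter fun q => q.2 + u q.1 = z).card ≤ κ) →
        |∫ ω, (J.card : ℝ)⁻¹ * ∑ i ∈ J, A.card * (finStat H Z (shift A (u i)) ω -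
            (J.card : ℝ)⁻¹ * ∑ j ∈ J, finStat H Z (shift A (u j)) ω) ^ 2 ∂P -
          A.card * Var[finStat H Z A; P]| ≤ K' * (κ * (J.card : ℝ)⁻¹ + (A.card : ℝ)⁻¹) := by
  have hL2 := memLp_two_of_memLp hLp (by omega)
  obtain ⟨hW2, KW, hKW, hWb⟩ := exists_linError_bound hH hLp h
  have hlin : ∀ A, MemLp (linPart P H Z A) 2 P := memLp_linPart hLp (by omega) H
  have hθ : ∀ A, finStat H Z A = fun ω => H (fieldMean P Z) +
      (linPart P H Z A + linError P H Z A) ω := fun A => funext fun ω => finStat_eq P A ω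
  have hLW : ∀ A, MemLp (linPart P H Z A + linError P H Z A) 2 P := fun A => (hlin A).add (hW2 A)
  have hθL : ∀ A, MemLp (finStat H Z A) 2 P := fun A => by
    have hc := (memLp_const (μ := P) (p := 2) (H (fieldMean P Z))).add (hLW A)
    rw [hθ A]; exact hc
  obtain ⟨Kσ, hKσ, hσ⟩ := h.exists_sigma_bound (H := H) (by omega) hZ hstat hL2
  have hsum : Summable fun k => |sigma P Z H k| := by
    refine Summable.of_nonneg_of_le (fun k => abs_nonneg _) (fun k => ?_)
      ((summable_latticeWeight d).mul_left Kσ)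
    refine le_trans ?_ (hσ k)
    exact le_mul_of_one_le_left (abs_nonneg _) (by linarith [norm_nonneg k])
  set S := ∑' k, |sigma P Z H k| with hS
  have hS0 : 0 ≤ S := tsum_nonneg fun k => abs_nonneg _
  -- The part `3 * KW` bounds twice the cross moment plus the variance of the linearization error.
  -- The part `2 * S` comes from (L + W)² ≤ 2 L² + 2 W² for the average.
  refine ⟨hθL, 3 * KW + 2 * S, by positivity, fun A hA => ?_, fun A J u κ hA hJ hκ => ?_⟩
  · have hN : (0 : ℝ) < A.card := by exact_mod_cast hA.card_pos
    obtain ⟨b1, b2⟩ := hWb A hA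
    have hVar : Var[finStat H Z A; P] = ∫ ω, linPart P H Z A ω ^ 2 ∂P +
        2 * ∫ ω, linPart P H Z A ω * linError P H Z A ω ∂P + Var[linError P H Z A; P] := by
      rw [hθ A, variance_const_add (hLW A).aestronglyMeasurable, variance_add (hlin A) (hW2 A),
        covariance_eq_sub (hlin A) (hW2 A), integral_linPart hZ hstat hL2 hA,
        variance_of_integral_eq_zero (hlin A).aemeasurable (integral_linPart hZ hstat hL2 hA)]
      simp
    have b3 : Var[linError P H Z A; P] ≤ KW * ((A.card : ℝ) ^ 2)⁻¹ :=
      (variance_le_expectation_sq (hW2 A).aestronglyMeasurable).trans b1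
    have b4 := variance_nonneg (linError P H Z A) P
    rw [hVar, ← card_mul_integral_linPart_sq hZ hstat hL2 hsum hA]
    have e : (A.card : ℝ) * (∫ ω, linPart P H Z A ω ^ 2 ∂P +
        2 * ∫ ω, linPart P H Z A ω * linError P H Z A ω ∂P + Var[linError P H Z A; P]) -
        A.card * ∫ ω, linPart P H Z A ω ^ 2 ∂P = A.card *
        (2 * ∫ ω, linPart P H Z A ω * linError P H Z A ω ∂P + Var[linError P H Z A; P]) := by
      ring
    rw [e, abs_mul, Nat.abs_cast]
    have b5 : |2 * ∫ ω, linPart P H Z A ω * linError P H Z A ω ∂P + Var[linError P H Z A; P]| ≤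
        3 * KW * ((A.card : ℝ) ^ 2)⁻¹ := by
      refine (abs_add_le _ _).trans ?_
      rw [abs_mul, abs_two, abs_of_nonneg b4]
      linarith
    calc _ ≤ (A.card : ℝ) * (3 * KW * ((A.card : ℝ) ^ 2)⁻¹) := by gcongr
      _ = 3 * KW * (A.card : ℝ)⁻¹ := by field_simp
      _ ≤ _ := by gcongr; linarith
  · have hN : (0 : ℝ) < A.card := by exact_mod_cast hA.card_pos
    have hM : (0 : ℝ) < J.card := by exact_mod_cast hJ.card_pos
    have hid := fun i => identDistrib_finStat_shift hZ hstat hH.1.continuous A (u i)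
    rw [integral_subsample_average hJ (fun i => hθL (shift A (u i)))
      (fun i => (hid i).integral_eq) (fun i => (hid i).variance_eq)]
    set T : Ω → ℝ := fun ω => (J.card : ℝ)⁻¹ * ∑ j ∈ J, finStat H Z (shift A (u j)) ω
    set L : Ω → ℝ := fun ω => (J.card : ℝ)⁻¹ * ∑ j ∈ J, linPart P H Z (shift A (u j)) ω with hL
    set W : Ω → ℝ := fun ω => (J.card : ℝ)⁻¹ * ∑ j ∈ J, linError P H Z (shift A (u j)) ω with hW
    have hLm : MemLp L 2 P := (memLp_finsetSum J fun j _ => hlin _).const_mul _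
    have hWm : MemLp W 2 P := (memLp_finsetSum J fun j _ => hW2 _).const_mul _
    have hT : T = fun ω => H (fieldMean P Z) + (L + W) ω := by
      ext ω
      simp only [T, L, W, finStat_eq P, Finset.sum_add_distrib, Pi.add_apply, mul_add,
        Finset.sum_const, nsmul_eq_mul]
      field_simp
    have hVT : Var[T; P] ≤ 2 * ∫ ω, L ω ^ 2 ∂P + 2 * ∫ ω, W ω ^ 2 ∂P := by
      rw [hT, variance_const_add (hLm.add hWm).aestronglyMeasurable]
      refine (variance_le_expectation_sq (hLm.add hWm).aestronglyMeasurable).trans ?_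
      rw [← integral_const_mul, ← integral_const_mul,
        ← integral_add (hLm.integrable_sq.const_mul 2) (hWm.integrable_sq.const_mul 2)]
      refine integral_mono (hLm.add hWm).integrable_sq
        ((hLm.integrable_sq.const_mul 2).add (hWm.integrable_sq.const_mul 2)) fun ω => ?_
      simp only [Pi.pow_apply, Pi.add_apply]
      nlinarith [sq_nonneg (L ω - W ω)]
    -- The averaged linear parts form a single sum over pairs (index, site) in which each site
    -- occurs at most `κ` times. Only this part needs cancellation between subsamples.
    have hLb : ∫ ω, L ω ^ 2 ∂P ≤ κ * S * ((J.card : ℝ) * A.card)⁻¹ := by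
      have e : ∀ ω, L ω ^ 2 = (((J.card : ℝ) * A.card)⁻¹) ^ 2 *
          (∑ q ∈ J ×ˢ A, influence P H Z (q.2 + u q.1) ω) ^ 2 := fun ω => by
        rw [← mul_pow, hL]
        simp only [linPart_eq (shift_nonempty hA _), card_shift, sum_shift, ← Finset.mul_sum]
        rw [Finset.sum_product, mul_inv, mul_assoc]
      simp_rw [e]
      rw [integral_const_mul]
      have := integral_sum_influence_sq_le (H := H) hZ hstat hL2 hsum (J ×ˢ A)
        (fun q => q.2 + u q.1) hκ
      rw [Finset.card_product, Nat.cast_mul] at this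
      calc _ ≤ (((J.card : ℝ) * A.card)⁻¹) ^ 2 * ((J.card : ℝ) * A.card * (κ * S)) := by gcongr
        _ = _ := by field_simp
    -- No weak dependence is used for the errors: by Cauchy–Schwarz their average is no worse than a
    -- single one, which is already small enough.
    have hWb' : ∫ ω, W ω ^ 2 ∂P ≤ KW * ((A.card : ℝ) ^ 2)⁻¹ := by
      have hWi : ∀ j, Integrable (fun ω => linError P H Z (shift A (u j)) ω ^ 2) P := fun j =>
        (hW2 _).integrable_sq
      calc ∫ ω, W ω ^ 2 ∂P
          ≤ ∫ ω, (J.card : ℝ)⁻¹ * ∑ j ∈ J, linError P H Z (shift A (u j)) ω ^ 2 ∂P := by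
            refine integral_mono hWm.integrable_sq
              ((integrable_finsetSum _ fun j _ => hWi j).const_mul _) fun ω => ?_
            have := sq_sum_le_card_mul_sum_sq (s := J)
              (f := fun j => linError P H Z (shift A (u j)) ω)
            simp only [hW, mul_pow]
            calc _ ≤ ((J.card : ℝ)⁻¹) ^ 2 *
                  (J.card * ∑ j ∈ J, linError P H Z (shift A (u j)) ω ^ 2) := by gcongr
              _ = _ := by field_simp
        _ = (J.card : ℝ)⁻¹ * ∑ j ∈ J, ∫ ω, linError P H Z (shift A (u j)) ω ^ 2 ∂P := by
            rw [integral_const_mul, integral_finsetSum _ fun j _ => hWi j]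
        _ ≤ (J.card : ℝ)⁻¹ * ∑ _j ∈ J, KW * ((A.card : ℝ) ^ 2)⁻¹ := by
            gcongr with j
            have := (hWb _ (shift_nonempty hA (u j))).1
            rwa [card_shift] at this
        _ = _ := by rw [Finset.sum_const, nsmul_eq_mul]; field_simp
    have hV0 := variance_nonneg T P
    have e : (A.card : ℝ) * (Var[finStat H Z A; P] - Var[T; P]) - A.card * Var[finStat H Z A; P] =
        -(A.card * Var[T; P]) := by ring
    rw [e, abs_neg, abs_of_nonneg (by positivity)]
    calc (A.card : ℝ) * Var[T; P]
        ≤ A.card * (2 * (κ * S * ((J.card : ℝ) * A.card)⁻¹) +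
            2 * (KW * ((A.card : ℝ) ^ 2)⁻¹)) := by gcongr; linarith
      _ = 2 * S * (κ * (J.card : ℝ)⁻¹) + 2 * KW * (A.card : ℝ)⁻¹ := by field_simp
      _ ≤ (3 * KW + 2 * S) * (κ * (J.card : ℝ)⁻¹) + (3 * KW + 2 * S) * (A.card : ℝ)⁻¹ := by
          gcongr <;> linarith
      _ = _ := by ring

end Estimator

/-! ### Lattice points in scaled templates -/

section Geometry

variable {d : ℕ} {R0 : Set (Fin d → ℝ)} {t : Fin d → ℝ}

lemma mem_scaleSet_iff {c : Fin d → ℝ} (hc : ∀ i, 0 < c i) {A : Set (Fin d → ℝ)}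
    {x : Fin d → ℝ} : x ∈ scaleSet c A ↔ (fun i => x i / c i) ∈ A := by
  constructor
  · rintro ⟨y, hy, rfl⟩
    have : (fun i => c i * y i / c i) = y := funext fun i => by
      have := (hc i).ne'
      field_simp
    simpa only [this] using hy
  · intro h
    refine ⟨_, h, funext fun i => ?_⟩
    have := (hc i).ne'
    simp only
    field_simp

lemma mem_translate_iff {k : Fin d → ℤ} {A : Set (Fin d → ℝ)} {x : Fin d → ℝ} :
    x ∈ translate k A ↔ (fun i => x i - k i) ∈ A := by
  constructor
  · rintro ⟨y, hy, rfl⟩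
    simpa using hy
  · intro h
    exact ⟨_, h, funext fun i => by simp⟩

lemma mem_sites_scaleSet_iff {c : Fin d → ℝ} (hc : ∀ i, 0 < c i) {k : Fin d → ℤ} :
    k ∈ sites t (scaleSet c R0) ↔ (fun i => (t i + k i) / c i) ∈ R0 :=
  mem_scaleSet_iff hc

lemma mem_sites_translate_iff {h k : Fin d → ℤ} {A : Set (Fin d → ℝ)} :
    k ∈ sites t (translate h A) ↔ k - h ∈ sites t A := by
  rw [sites, sites, Set.mem_ofPred_eq, Set.mem_ofPred_eq, mem_translate_iff]
  have : (fun i => t i + (k i : ℝ) - h i) = fun i => t i + ((k - h) i : ℝ) := funext fun i => by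
    simp; ring
  rw [this]

lemma IsTemplate.abs_apply_le (hR0 : IsTemplate R0) {x : Fin d → ℝ} (hx : x ∈ closure R0) (i : Fin d) :
    |x i| ≤ 1 / 2 := by
  have hcl : IsClosed {x : Fin d → ℝ | |x i| ≤ 1 / 2} :=
    isClosed_le (continuous_apply i).abs continuous_const
  refine closure_minimal (fun y hy => ?_) hcl hx
  have := hR0.subset_unitCube hy i
  rw [Set.mem_ofPred_eq, abs_le]
  constructor <;> linarith [this.1, this.2]

lemma finite_of_forall_abs_le {S : Set (Fin d → ℤ)} (B : Fin d → ℝ)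
    (h : ∀ k ∈ S, ∀ i, |(k i : ℝ)| ≤ B i) : S.Finite := by
  refine (Set.finite_Icc (fun i => -⌈B i⌉) (fun i => ⌈B i⌉)).subset fun k hk => ?_
  rw [Set.mem_Icc]
  refine ⟨fun i => ?_, fun i => ?_⟩
  · have h1 := (abs_le.mp (h k hk i)).1
    have h2 := Int.le_ceil (B i)
    have : ((-⌈B i⌉ : ℤ) : ℝ) ≤ k i := by push_cast; linarith
    exact_mod_cast this
  · have h1 := (abs_le.mp (h k hk i)).2
    have h2 := Int.le_ceil (B i)
    have : (k i : ℝ) ≤ (⌈B i⌉ : ℤ) := by linarith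
    exact_mod_cast this

lemma finite_sites (hR0 : IsTemplate R0) {c : Fin d → ℝ} (hc : ∀ i, 0 < c i) :
    (sites t (scaleSet c R0)).Finite := by
  refine finite_of_forall_abs_le (fun i => c i / 2 + |t i|) fun k hk i => ?_
  have h1 := hR0.abs_apply_le (subset_closure ((mem_sites_scaleSet_iff hc).mp hk)) i
  rw [abs_div, abs_of_pos (hc i), div_le_iff₀ (hc i)] at h1
  have h2 := abs_sub_abs_le_abs_sub (k i : ℝ) (-t i)
  rw [abs_neg] at h2
  have h3 : (k i : ℝ) - -t i = t i + k i := by ring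
  rw [h3] at h2
  linarith

/-- The finite set of labels of the sites in a scaled template. -/
noncomputable def siteFinset (hR0 : IsTemplate R0) (t : Fin d → ℝ) {c : Fin d → ℝ}
    (hc : ∀ i, 0 < c i) : Finset (Fin d → ℤ) :=
  (finite_sites (t := t) hR0 hc).toFinset

lemma mem_siteFinset {hR0 : IsTemplate R0} {c : Fin d → ℝ} {hc : ∀ i, 0 < c i}
    {k : Fin d → ℤ} : k ∈ siteFinset hR0 t hc ↔ (fun i => (t i + k i) / c i) ∈ R0 := by
  rw [siteFinset, Set.Finite.mem_toFinset, mem_sites_scaleSet_iff hc]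

lemma coe_siteFinset (hR0 : IsTemplate R0) {c : Fin d → ℝ} (hc : ∀ i, 0 < c i) :
    (siteFinset hR0 t hc : Set (Fin d → ℤ)) = sites t (scaleSet c R0) :=
  Set.Finite.coe_toFinset _

/-- The indices of the cubes of `a ℤ^d` that meet the boundary of the template. -/
def boundaryCubes (R0 : Set (Fin d → ℝ)) (a : ℝ) : Set (Fin d → ℤ) :=
  {j | (latticeCube a j ∩ closure R0).Nonempty ∧ (latticeCube a j ∩ closure R0ᶜ).Nonempty}

lemma finite_cubes (hR0 : IsTemplate R0) {a : ℝ} (ha : 0 < a) :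
    {j : Fin d → ℤ | (latticeCube a j ∩ closure R0).Nonempty}.Finite := by
  refine finite_of_forall_abs_le (fun _ => a⁻¹ + 1) fun j hj i => ?_
  obtain ⟨x, hx, hxR⟩ := hj
  have h1 := abs_le.mp (hR0.abs_apply_le hxR i)
  obtain ⟨h2, h3⟩ := hx i
  have h4 : (j i : ℝ) ≤ a⁻¹ := by
    rw [← one_div, le_div_iff₀ ha]; linarith
  have h5 : -a⁻¹ ≤ (j i : ℝ) + 1 := by
    rw [← one_div, ← neg_div, div_le_iff₀ ha]; linarith
  rw [abs_le]
  constructor <;> linarith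

lemma finite_boundaryCubes (hR0 : IsTemplate R0) {a : ℝ} (ha : 0 < a) :
    (boundaryCubes R0 a).Finite :=
  (finite_cubes hR0 ha).subset fun _ hj => hj.1

/-- A cube that touches the template but is not a boundary cube cannot meet the complement. One
point of the closure therefore decides membership for the whole cube. -/
lemma latticeCube_subset_of_mem {a : ℝ} {j : Fin d → ℤ} {x : Fin d → ℝ} (hj : j ∉ boundaryCubes R0 a)
    (hx : x ∈ latticeCube a j) (hxR : x ∈ closure R0) : latticeCube a j ⊆ R0 := by
  intro y hy
  by_contra h
  exact hj ⟨⟨x, hx, hxR⟩, ⟨y, hy, subset_closure h⟩⟩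

lemma mem_latticeCube_floor {a : ℝ} (ha : 0 < a) (x : Fin d → ℝ) :
    x ∈ latticeCube a fun i => ⌊x i / a⌋ := by
  intro i
  have h1 := Int.floor_le (x i / a)
  have h2 := (Int.lt_floor_add_one (x i / a)).le
  rw [le_div_iff₀ ha] at h1
  rw [div_le_iff₀ ha] at h2
  constructor <;> linarith

/-- The half-open cubes of `a ℤ^d`. -/
def halfOpenCube (a : ℝ) (j : Fin d → ℤ) : Set (Fin d → ℝ) :=
  Set.univ.pi fun i => Set.Ico (a * j i) (a * (j i + 1))

lemma mem_halfOpenCube_iff {a : ℝ} (ha : 0 < a) {j : Fin d → ℤ} {x : Fin d → ℝ} :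
    x ∈ halfOpenCube a j ↔ ∀ i, ⌊x i / a⌋ = j i := by
  simp only [halfOpenCube, Set.mem_univ_pi, Set.mem_Ico, Int.floor_eq_iff, le_div_iff₀ ha,
    div_lt_iff₀ ha, mul_comm a]

lemma halfOpenCube_subset {a : ℝ} (j : Fin d → ℤ) : halfOpenCube a j ⊆ latticeCube a j :=
  fun _ hx i => ⟨(hx i trivial).1, (hx i trivial).2.le⟩

lemma measurableSet_halfOpenCube (a : ℝ) (j : Fin d → ℤ) : MeasurableSet (halfOpenCube a j) :=
  MeasurableSet.univ_pi fun _ => measurableSet_Ico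

lemma volume_real_halfOpenCube {a : ℝ} (ha : 0 < a) (j : Fin d → ℤ) :
    volume.real (halfOpenCube a j) = a ^ d := by
  rw [Measure.real, halfOpenCube, Real.volume_pi_Ico_toReal]
  · simp [mul_add]
  · intro i; simp only; nlinarith

lemma IsTemplate.volume_ne_top (hR0 : IsTemplate R0) : volume R0 ≠ ⊤ := by
  have h : R0 ⊆ Set.Icc (fun _ => -(1 / 2)) (fun _ => 1 / 2) := fun x hx =>
    ⟨fun i => (hR0.subset_unitCube hx i).1.le, fun i => (hR0.subset_unitCube hx i).2⟩
  exact ((measure_mono h).trans_lt isCompact_Icc.measure_lt_top).ne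

lemma IsTemplate.volume_pos (hR0 : IsTemplate R0) : 0 < volume.real R0 :=
  ENNReal.toReal_pos (Measure.measure_pos_of_mem_nhds volume hR0.mem_nhds_zero).ne' hR0.volume_ne_top

/-- The number of sites in a scaled template differs from its volume by at most the number of
boundary cubes. -/
lemma abs_card_siteFinset_sub_le (hR0 : IsTemplate R0) {s : ℝ} (hs : 0 < s) :
    |((siteFinset hR0 t (fun _ => hs)).card : ℝ) - s ^ d * volume.real R0| ≤
      (boundaryCubes R0 s⁻¹).ncard := by
  classical
  set a := s⁻¹ with ha
  have ha0 : 0 < a := inv_pos.mpr hs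
  set B := (finite_boundaryCubes hR0 ha0).toFinset
  set F := (finite_cubes hR0 ha0).toFinset with hF
  have hmemF : ∀ {j : Fin d → ℤ} {x : Fin d → ℝ}, x ∈ latticeCube a j → x ∈ R0 → j ∈ F :=
    fun {j x} hx hxR => by
      rw [hF, Set.Finite.mem_toFinset]; exact ⟨x, hx, subset_closure hxR⟩
  -- Scaling by `a = 1 / s` places exactly one site in every half-open cube, always at the relative
  -- position given by the fractional part of `t`.
  set pt : (Fin d → ℤ) → (Fin d → ℝ) := fun j i => a * (j i + Int.fract (t i)) with hpt
  have hptm : ∀ j, pt j ∈ halfOpenCube a j := fun j i _ => by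
    have h1 := Int.fract_nonneg (t i)
    have h2 := Int.fract_lt_one (t i)
    simp only [hpt, Set.mem_Ico]
    constructor <;> gcongr
    linarith
  -- sites correspond to cubes
  have hcard : (siteFinset hR0 t (fun _ => hs)).card = (F.filter fun j => pt j ∈ R0).card := by
    refine Finset.card_bij (fun k _ i => k i + ⌊t i⌋) ?_ ?_ ?_
    · intro k hk
      rw [mem_siteFinset] at hk
      have e : pt (fun i => k i + ⌊t i⌋) = fun i => (t i + k i) / s := funext fun i => by
        have := Int.floor_add_fract (t i)
        simp only [hpt, ha, Int.cast_add]
        rw [div_eq_inv_mul, add_assoc, this, add_comm]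
      rw [Finset.mem_filter]
      have h2 : pt (fun i => k i + ⌊t i⌋) ∈ R0 := by rw [e]; exact hk
      exact ⟨hmemF (halfOpenCube_subset _ (hptm _)) h2, h2⟩
    · intro k _ l _ h
      ext i
      have := congrFun h i
      omega
    · intro j hj
      rw [Finset.mem_filter] at hj
      refine ⟨fun i => j i - ⌊t i⌋, ?_, funext fun i => by ring⟩
      rw [mem_siteFinset]
      convert hj.2 using 1
      ext i
      have := Int.floor_add_fract (t i)
      simp only [hpt, ha, Int.cast_sub]
      rw [div_eq_inv_mul]
      congr 1
      linarith
  have hRfin : ∀ j ∈ F, volume (R0 ∩ halfOpenCube a j) ≠ ⊤ := fun j _ =>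
    ((measure_mono Set.inter_subset_left).trans_lt hR0.volume_ne_top.lt_top).ne
  have hvol : volume.real R0 = ∑ j ∈ F, volume.real (R0 ∩ halfOpenCube a j) := by
    rw [← measureReal_biUnion_finset (h := hRfin)]
    · congr 1
      ext x
      simp only [Set.mem_iUnion, Set.mem_inter_iff]
      constructor
      · intro hx
        exact ⟨_, hmemF (mem_latticeCube_floor ha0 x) hx, hx,
          (mem_halfOpenCube_iff ha0).mpr fun _ => rfl⟩
      · rintro ⟨_, _, hx, _⟩; exact hx
    · intro j _ l _ hjl
      refine Set.disjoint_left.mpr fun x hx hx' => hjl ?_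
      ext i
      rw [← (mem_halfOpenCube_iff ha0).mp hx.2 i, (mem_halfOpenCube_iff ha0).mp hx'.2 i]
    · exact fun j _ => hR0.measurableSet.inter (measurableSet_halfOpenCube a j)
  have hsa : s ^ d * a ^ d = 1 := by
    rw [← mul_pow, ha, mul_inv_cancel₀ hs.ne', one_pow]
  have hfin : ∀ j, volume (halfOpenCube a j) ≠ ⊤ := fun j h => by
    have := volume_real_halfOpenCube ha0 j
    rw [Measure.real, h] at this
    exact (pow_pos ha0 d).ne this
  -- The discrepancy between count and normalized volume within one cube. It vanishes on cubes
  -- inside the template and never exceeds 1 in absolute value.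
  set f : (Fin d → ℤ) → ℝ := fun j =>
    (if pt j ∈ R0 then (1 : ℝ) else 0) - s ^ d * volume.real (R0 ∩ halfOpenCube a j) with hf
  have hsum : ((siteFinset hR0 t (fun _ => hs)).card : ℝ) - s ^ d * volume.real R0 =
      ∑ j ∈ F, f j := by
    rw [hcard, hvol, hf, Finset.sum_sub_distrib, Finset.mul_sum, Finset.sum_boole]
  have hf0 : ∀ j ∈ F, j ∉ B → f j = 0 := fun j hj hjB => by
    rw [hF, Set.Finite.mem_toFinset] at hj
    rw [Set.Finite.mem_toFinset] at hjB
    obtain ⟨x, hx, hxR⟩ := hj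
    have hsub := latticeCube_subset_of_mem hjB hx hxR
    have h1 : pt j ∈ R0 := hsub (halfOpenCube_subset j (hptm j))
    have h2 : R0 ∩ halfOpenCube a j = halfOpenCube a j :=
      Set.inter_eq_right.mpr ((halfOpenCube_subset j).trans hsub)
    simp only [hf, if_pos h1, h2, volume_real_halfOpenCube ha0, hsa, sub_self]
  have hf1 : ∀ j, |f j| ≤ 1 := fun j => by
    have h1 : 0 ≤ s ^ d * volume.real (R0 ∩ halfOpenCube a j) := by positivity
    have h2 : s ^ d * volume.real (R0 ∩ halfOpenCube a j) ≤ 1 := by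
      rw [← hsa, ← volume_real_halfOpenCube ha0 j]
      gcongr
      · exact hfin j
      · exact Set.inter_subset_right
    rw [hf, abs_le]
    simp only
    split_ifs <;> constructor <;> linarith
  have hBF : B ⊆ F := fun j hj => by
    rw [Set.Finite.mem_toFinset] at hj
    rw [hF, Set.Finite.mem_toFinset]; exact hj.1
  rw [hsum, ← Finset.sum_subset hBF hf0]
  calc |∑ j ∈ B, f j| ≤ ∑ j ∈ B, |f j| := Finset.abs_sum_le_sum_abs _ _
    _ ≤ ∑ _j ∈ B, (1 : ℝ) := Finset.sum_le_sum fun j _ => hf1 j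
    _ = _ := by
        rw [Finset.sum_const, nsmul_eq_mul, mul_one, Set.ncard_eq_toFinset_card _
          (finite_boundaryCubes hR0 ha0)]

/-- The number of sites lost under a unit translation is at most a multiple of the number of
boundary cubes. -/
lemma excess_siteFinset_le (hR0 : IsTemplate R0) {c : Fin d → ℝ} (hc : ∀ i, 0 < c i) {a D : ℝ}
    (ha : 0 < a) (h1 : ∀ i, 1 ≤ a * c i) (h2 : ∀ i, a * c i ≤ D) (i : Fin d) :
    excess (siteFinset hR0 t hc) (Pi.single i 1) ≤
      2 * ((boundaryCubes R0 a).ncard * (⌊D⌋₊ + 1) ^ d) := by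
  classical
  set B := (finite_boundaryCubes hR0 ha).toFinset
  set pt : (Fin d → ℤ) → (Fin d → ℝ) := fun k l => (t l + k l) / c l with hpt
  set cube : (Fin d → ℤ) → (Fin d → ℤ) := fun k l => ⌊pt k l / a⌋ with hcube
  -- A cube spans at most `D` lattice steps in each direction, so the labels of the sites in it lie
  -- in a box with `⌊D⌋₊ + 1` integers per side starting at `lo`.
  set lo : (Fin d → ℤ) → (Fin d → ℤ) := fun j l => ⌈c l * (a * j l) - t l⌉ with hlo
  set fib : (Fin d → ℤ) → Finset (Fin d → ℤ) := fun j =>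
    Finset.Icc (lo j) (fun l => lo j l + (⌊D⌋₊ : ℤ)) with hfib
  have hfibcard : ∀ j, (fib j).card = (⌊D⌋₊ + 1) ^ d := fun j => by
    rw [hfib, Pi.card_Icc]
    simp only [Int.card_Icc]
    have : ∀ l, (lo j l + (⌊D⌋₊ : ℤ) + 1 - lo j l).toNat = ⌊D⌋₊ + 1 := fun l => by omega
    simp [this]
  have hmem : ∀ k, k ∈ fib (cube k) := fun k => by
    rw [hfib, Finset.mem_Icc, Pi.le_def, Pi.le_def]
    have key : ∀ l, c l * (a * cube k l) ≤ t l + k l ∧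
        t l + k l < c l * (a * cube k l) + D := fun l => by
      have e1 := Int.floor_le (pt k l / a)
      have e2 := Int.lt_floor_add_one (pt k l / a)
      rw [le_div_iff₀ ha, hpt, le_div_iff₀ (hc l)] at e1
      rw [div_lt_iff₀ ha, hpt, div_lt_iff₀ (hc l)] at e2
      simp only [hcube, hpt]
      refine ⟨by linarith, ?_⟩
      have := h2 l
      linarith
    refine ⟨fun l => ?_, fun l => ?_⟩
    · simp only [hlo]
      exact Int.ceil_le.mpr (by linarith [(key l).1])
    · have h3 := Int.le_ceil (c l * (a * cube k l) - t l)
      have h4 := (key l).2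
      have h5 : k l - lo (cube k) l ≤ ⌊D⌋ := by
        rw [Int.le_floor]
        push_cast
        simp only [hlo]
        linarith
      have h6 : 0 ≤ D := by linarith [h1 l, h2 l]
      have h7 : ((⌊D⌋₊ : ℕ) : ℤ) = ⌊D⌋ := Int.natCast_floor_eq_floor h6
      rw [h7]; omega
  set T := B.biUnion fib with hT
  have hTcard : T.card ≤ B.card * (⌊D⌋₊ + 1) ^ d :=
    Finset.card_biUnion_le_card_mul _ _ _ fun j _ => (hfibcard j).le
  have hTmem : ∀ k, cube k ∈ boundaryCubes R0 a → k ∈ T := fun k hk =>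
    Finset.mem_biUnion.mpr ⟨cube k, by rwa [Set.Finite.mem_toFinset], hmem k⟩
  have hcm : ∀ k, pt k ∈ latticeCube a (cube k) := fun k => mem_latticeCube_floor ha (pt k)
  have hsub : ((siteFinset hR0 t hc).filter fun x => x - Pi.single i 1 ∉ siteFinset hR0 t hc) ⊆
      T ∪ T.map (addRightEmbedding (Pi.single i 1)) := by
    intro k hk
    rw [Finset.mem_filter, mem_siteFinset, mem_siteFinset] at hk
    obtain ⟨hk1, hk2⟩ := hk
    set k' := k - Pi.single i 1 with hk'
    by_contra hcon
    rw [Finset.mem_union, not_or] at hcon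
    have c1 : cube k ∉ boundaryCubes R0 a := fun h => hcon.1 (hTmem k h)
    have c2 : cube k' ∉ boundaryCubes R0 a := fun h => hcon.2 (by
      rw [Finset.mem_map]; exact ⟨k', hTmem k' h, by simp [hk']⟩)
    have s1 : latticeCube a (cube k) ⊆ R0 :=
      latticeCube_subset_of_mem c1 (hcm k) (subset_closure hk1)
    -- A unit step moves the rescaled site by at most one cube width, so the cubes of `k` and `k'`
    -- coincide or are adjacent. The lower corner of the first belongs to both closed cubes, and
    -- membership in the template is passed on through it.
    set z : Fin d → ℝ := fun l => a * cube k l with hz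
    have z1 : z ∈ latticeCube a (cube k) := fun l => ⟨le_rfl, by simp only [hz]; gcongr; linarith⟩
    have z2 : z ∈ latticeCube a (cube k') := fun l => by
      by_cases hl : l = i
      · subst hl
        have e : pt k' l / a = pt k l / a - 1 / (a * c l) := by
          have := hc l
          simp only [hpt, hk', Pi.sub_apply, Pi.single_eq_same, Int.cast_sub, Int.cast_one]
          field_simp
          ring
        have hq1 : 1 / (a * c l) ≤ 1 := by
          rw [div_le_one (by linarith [h1 l])]; exact h1 l
        have hq0 : 0 ≤ 1 / (a * c l) := by
          have := h1 l
          positivity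
        have f1 : cube k' l ≤ cube k l := Int.floor_le_floor (by rw [e]; linarith)
        have f2 : cube k l ≤ cube k' l + 1 := by
          have : ⌊pt k l / a - 1⌋ ≤ cube k' l := Int.floor_le_floor (by rw [e]; linarith)
          rw [Int.floor_sub_one] at this
          simp only [hcube] at this ⊢
          omega
        have g1 : (cube k' l : ℝ) ≤ cube k l := by exact_mod_cast f1
        have g2 : (cube k l : ℝ) ≤ cube k' l + 1 := by exact_mod_cast f2
        exact ⟨by simp only [hz]; gcongr, by simp only [hz]; gcongr⟩
      · have e : cube k' l = cube k l := by
          simp [hcube, hpt, hk', Pi.single_eq_of_ne hl]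
        rw [e]
        exact z1 l
    have s2 : pt k' ∈ R0 :=
      latticeCube_subset_of_mem c2 z2 (subset_closure (s1 z1)) (hcm k')
    exact hk2 s2
  have hb : (boundaryCubes R0 a).ncard = B.card :=
    Set.ncard_eq_toFinset_card _ (finite_boundaryCubes hR0 ha)
  calc excess (siteFinset hR0 t hc) (Pi.single i 1) ≤ _ := Finset.card_le_card hsub
    _ ≤ T.card + T.card := (Finset.card_union_le _ _).trans_eq (by rw [Finset.card_map])
    _ ≤ _ := by rw [hb]; omega

lemma exists_box_subset (hR0 : IsTemplate R0) :
    ∃ ε : ℝ, 0 < ε ∧ ∀ x : Fin d → ℝ, (∀ i, |x i| ≤ ε) → x ∈ R0 := by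
  obtain ⟨ε, hε, h⟩ := Metric.nhds_basis_closedBall.mem_iff.mp hR0.mem_nhds_zero
  refine ⟨ε, hε, fun x hx => h ?_⟩
  rw [mem_closedBall_zero_iff, pi_norm_le_iff_of_nonneg hε.le]
  exact hx

/-- A set of labels that contains a box has at least as many elements as the box has volume. -/
lemma prod_le_card {S : Finset (Fin d → ℤ)} {y : Fin d → ℝ} (hy : ∀ i, 0 ≤ y i)
    (h : ∀ k : Fin d → ℤ, (∀ i, |(k i : ℝ)| ≤ y i) → k ∈ S) : ∏ i, y i ≤ S.card := by
  classical
  set T : Finset (Fin d → ℤ) := Finset.Icc (fun i => -⌊y i⌋) (fun i => ⌊y i⌋) with hT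
  have hTS : T ⊆ S := fun k hk => by
    rw [hT, Finset.mem_Icc] at hk
    refine h k fun i => abs_le.mpr ⟨?_, ?_⟩
    · have h1 := Int.floor_le (y i)
      have h2 : ((-⌊y i⌋ : ℤ) : ℝ) ≤ k i := by exact_mod_cast hk.1 i
      push_cast at h2
      linarith
    · have h1 := Int.floor_le (y i)
      have h2 : (k i : ℝ) ≤ (⌊y i⌋ : ℤ) := by exact_mod_cast hk.2 i
      linarith
  have hTcard : T.card = ∏ i, (⌊y i⌋ + 1 - -⌊y i⌋).toNat := by
    rw [hT, Pi.card_Icc]; simp only [Int.card_Icc]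
  calc ∏ i, y i ≤ ∏ i, ((⌊y i⌋ + 1 - -⌊y i⌋).toNat : ℝ) := by
        refine Finset.prod_le_prod (fun i _ => hy i) fun i _ => ?_
        have h0 : 0 ≤ ⌊y i⌋ := Int.floor_nonneg.mpr (hy i)
        have h1 := Int.lt_floor_add_one (y i)
        have h2 : ⌊y i⌋ + 1 ≤ ((⌊y i⌋ + 1 - -⌊y i⌋).toNat : ℤ) := by omega
        have h3 : ((⌊y i⌋ : ℝ)) + 1 ≤ ((⌊y i⌋ + 1 - -⌊y i⌋).toNat : ℝ) := by exact_mod_cast h2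
        linarith
    _ = (T.card : ℝ) := by rw [hTcard]; push_cast; rfl
    _ ≤ S.card := by exact_mod_cast Finset.card_le_card hTS

end Geometry

/-! ### From regions to finite sets of labels -/

section Translation

variable {d p : ℕ} {Ω : Type*} {Z : (Fin d → ℤ) → Ω → EuclideanSpace ℝ (Fin p)}
  {H : EuclideanSpace ℝ (Fin p) → ℝ} {t : Fin d → ℝ}

lemma siteCount_eq_card {R : Set (Fin d → ℝ)} {B : Finset (Fin d → ℤ)}
    (hB : (B : Set (Fin d → ℤ)) = sites t R) : siteCount t R = B.card := by
  rw [siteCount, ← hB, Set.ncard_coe_finset]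

lemma statistic_eq_finStat {R : Set (Fin d → ℝ)} {B : Finset (Fin d → ℤ)}
    (hB : (B : Set (Fin d → ℤ)) = sites t R) : statistic H Z t R = finStat H Z B := by
  ext ω
  rw [statistic, siteMean, siteCount_eq_card hB, ← hB, finsum_mem_coe_finset, finStat]

lemma indexAverage_eq {J : Finset (Fin d → ℤ)} (f : (Fin d → ℤ) → ℝ) :
    indexAverage (J : Set (Fin d → ℤ)) f = (J.card : ℝ)⁻¹ * ∑ i ∈ J, f i := by
  rw [indexAverage, Set.ncard_coe_finset, finsum_mem_coe_finset]

lemma coe_shift {A : Finset (Fin d → ℤ)} {R : Set (Fin d → ℝ)} (h : Fin d → ℤ)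
    (hA : (A : Set (Fin d → ℤ)) = sites t R) :
    (shift A h : Set (Fin d → ℤ)) = sites t (translate h R) := by
  ext k
  rw [mem_sites_translate_iff, ← hA, shift, Finset.coe_map, Set.mem_image]
  constructor
  · rintro ⟨x, hx, rfl⟩
    simpa using hx
  · intro hk
    exact ⟨k - h, hk, by simp⟩

lemma subsampleEstimator_eq {A J : Finset (Fin d → ℤ)} {u : (Fin d → ℤ) → (Fin d → ℤ)}
    {R : (Fin d → ℤ) → Set (Fin d → ℝ)}
    (hR : ∀ i, (shift A (u i) : Set (Fin d → ℤ)) = sites t (R i)) (ω : Ω) :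
    subsampleEstimator H Z t J R ω = (J.card : ℝ)⁻¹ * ∑ i ∈ J, A.card *
      (finStat H Z (shift A (u i)) ω -
        (J.card : ℝ)⁻¹ * ∑ j ∈ J, finStat H Z (shift A (u j)) ω) ^ 2 := by
  rw [subsampleEstimator]
  simp_rw [indexAverage_eq, statistic_eq_finStat (hR _), siteCount_eq_card (hR _), card_shift]

/-- Identifies the counts in the limit hypothesis with `excess`, for which the variance formula is
written. -/
lemma siteCount_sub_siteCount_inter {A : Finset (Fin d → ℤ)} {R : Set (Fin d → ℝ)}
    (hA : (A : Set (Fin d → ℤ)) = sites t R) (k : Fin d → ℤ) :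
    (siteCount t R : ℝ) - siteCount t (R ∩ translate k R) = excess A k := by
  have h1 : ((A.filter fun x => x - k ∈ A : Finset (Fin d → ℤ)) : Set (Fin d → ℤ)) =
      sites t (R ∩ translate k R) := by
    ext x
    have e : x ∈ sites t (R ∩ translate k R) ↔ x ∈ sites t R ∧ x ∈ sites t (translate k R) :=
      Iff.rfl
    rw [e, mem_sites_translate_iff, ← hA]
    simp
  rw [siteCount_eq_card hA, siteCount_eq_card h1, ← card_filter_add_excess A k]
  push_cast
  ring

end Translation

/-! ### Asymptotics -/

section Asymptotics

/-- Both forms of the expansion express one limit. In the relative form the error sequence is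
obtained by solving the required identity for it. -/
lemma biasExpansion_of_tendsto {b s : ℕ → ℝ} {v S : ℝ} (hs : ∀ n, 0 < s n) (hv : 0 < v)
    (h : Tendsto (fun n => s n * b n) atTop (𝓝 (-(S / v)))) : BiasExpansion b s v S := by
  refine ⟨?_, fun hS => ⟨fun n => -(s n * b n) * (v / S) - 1, ?_, fun n => ?_⟩⟩
  · rw [isLittleO_iff_tendsto fun n hn => absurd hn (one_div_pos.mpr (hs n)).ne']
    have e : ∀ n, (b n - -1 / (s n * v) * S) / (1 / s n) = s n * b n - -(S / v) := fun n => by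
      have := (hs n).ne'
      field_simp
    simp_rw [e]
    simpa using h.sub_const (-(S / v))
  · have := (h.neg.mul_const (v / S)).sub_const 1
    have e : - -(S / v) * (v / S) - 1 = 0 := by
      rw [neg_neg]; field_simp; ring
    rwa [e] at this
  · have := (hs n).ne'
    field_simp
    ring

variable {d p : ℕ} {Ω : Type*} [MeasurableSpace Ω] {P : Measure Ω}
  {Z : (Fin d → ℤ) → Ω → EuclideanSpace ℝ (Fin p)} {H : EuclideanSpace ℝ (Fin p) → ℝ}

/-- A scaled sum of excesses against the covariances converges if the scaled excesses do. -/
lemma tendsto_tsum_excess {w : (Fin d → ℤ) → ℝ} (hw : Summable fun k => (1 + ‖k‖) * |w k|)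
    {A : ℕ → Finset (Fin d → ℤ)} {q : ℕ → ℝ} (hq : ∀ n, 0 < q n) {C : (Fin d → ℤ) → ℝ}
    (hC : ∀ k, Tendsto (fun n => (excess (A n) k : ℝ) / q n) atTop (𝓝 (C k))) :
    (Summable fun k => C k * w k) ∧
    Tendsto (fun n => (∑' k, excess (A n) k * w k) / q n) atTop (𝓝 (∑' k, C k * w k)) := by
  set D : ℝ := ∑ i, C (Pi.single i 1) with hD
  have hE : Tendsto (fun n => ∑ i, (excess (A n) (Pi.single i 1) : ℝ) / q n) atTop (𝓝 D) :=
    tendsto_finsetSum _ fun i _ => hC _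
  have hC0 : ∀ k, 0 ≤ C k := fun k => ge_of_tendsto' (hC k) fun n =>
    div_nonneg (Nat.cast_nonneg _) (hq n).le
  have hD0 : 0 ≤ D := Finset.sum_nonneg fun i _ => hC0 _
  have hle : ∀ n k, (excess (A n) k : ℝ) / q n ≤
      ‖k‖ * ∑ i, (excess (A n) (Pi.single i 1) : ℝ) / q n := fun n k => by
    rw [← Finset.sum_div, ← mul_div_assoc]
    exact div_le_div_of_nonneg_right (excess_le_norm_mul _ k) (hq n).le
  have hCle : ∀ k, C k ≤ ‖k‖ * D := fun k =>
    le_of_tendsto_of_tendsto' (hC k) (hE.const_mul ‖k‖) fun n => hle n k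
  -- `D` is the limit of the scaled unit excesses, which eventually stay below `D + 1`. This
  -- constant therefore serves all large `n`.
  have hsum : Summable fun k => (D + 1) * ((1 + ‖k‖) * |w k|) := hw.mul_left _
  have hb : ∀ k (x B : ℝ), 0 ≤ x → x ≤ ‖k‖ * B → B ≤ D + 1 →
      ‖x * w k‖ ≤ (D + 1) * ((1 + ‖k‖) * |w k|) := fun k x B hx hxB hB => by
    rw [norm_mul, Real.norm_of_nonneg hx, Real.norm_eq_abs, ← mul_assoc]
    refine mul_le_mul_of_nonneg_right ?_ (abs_nonneg _)
    have := norm_nonneg k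
    calc x ≤ ‖k‖ * B := hxB
      _ ≤ ‖k‖ * (D + 1) := by gcongr
      _ ≤ (D + 1) * (1 + ‖k‖) := by nlinarith
  refine ⟨Summable.of_norm_bounded hsum fun k => hb k _ D (hC0 k) (hCle k) (by linarith), ?_⟩
  have e : ∀ n, (∑' k, excess (A n) k * w k) / q n =
      ∑' k, (excess (A n) k : ℝ) / q n * w k := fun n => by
    rw [← tsum_div_const]
    exact tsum_congr fun k => by ring
  simp_rw [e]
  refine tendsto_tsum_of_dominated_convergence hsum (fun k => (hC k).mul_const _) ?_
  filter_upwards [hE.eventually (gt_mem_nhds (show D < D + 1 by linarith))] with n hn k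
  exact hb k _ _ (div_nonneg (Nat.cast_nonneg _) (hq n).le) (hle n k) hn.le

/-- The nonasymptotic counterpart for the full region, where no limits of scaled excesses are
assumed and only unit translations are estimated. -/
lemma abs_tsum_excess_le {w : (Fin d → ℤ) → ℝ} (hw : Summable fun k => (1 + ‖k‖) * |w k|)
    (A : Finset (Fin d → ℤ)) :
    |∑' k, excess A k * w k| ≤
      (∑ i, (excess A (Pi.single i 1) : ℝ)) * ∑' k, (1 + ‖k‖) * |w k| := by
  rw [← tsum_mul_left, ← Real.norm_eq_abs]
  refine tsum_of_norm_bounded (hw.mul_left _).hasSum fun k => ?_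
  rw [norm_mul, Real.norm_natCast, Real.norm_eq_abs, ← mul_assoc]
  refine mul_le_mul_of_nonneg_right ?_ (abs_nonneg _)
  have h0 : 0 ≤ ∑ i, (excess A (Pi.single i 1) : ℝ) := Finset.sum_nonneg fun _ _ => Nat.cast_nonneg _
  have := excess_le_norm_mul A k
  nlinarith

/-- The limit of the scaled bias of an estimator whose mean is close to the scaled variance of the
statistic on the subsample. -/
theorem tendsto_scaled_bias {K v : ℝ} (hd : 2 ≤ d)
    (hK : ∀ A : Finset (Fin d → ℤ), A.Nonempty →
      |A.card * Var[finStat H Z A; P] -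
        (∑' k, sigma P Z H k - (A.card : ℝ)⁻¹ * ∑' k, excess A k * sigma P Z H k)| ≤
          K * (A.card : ℝ)⁻¹)
    (hσ : Summable fun k => (1 + ‖k‖) * |sigma P Z H k|)
    {A G : ℕ → Finset (Fin d → ℤ)} {s : ℕ → ℝ} (hs : ∀ n, 0 < s n) (hs' : Tendsto s atTop atTop)
    (hv : 0 < v) (hA : Tendsto (fun n => ((A n).card : ℝ) / s n ^ d) atTop (𝓝 v))
    {C : (Fin d → ℤ) → ℝ}
    (hC : ∀ k, Tendsto (fun n => (excess (A n) k : ℝ) / s n ^ (d - 1)) atTop (𝓝 (C k)))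
    (hG : Tendsto (fun n => s n * ((G n).card : ℝ)⁻¹) atTop (𝓝 0))
    (hG' : ∀ᶠ n in atTop, (G n).Nonempty)
    (hGe : ∀ i, Tendsto (fun n => s n * ((excess (G n) (Pi.single i 1) : ℝ) *
      ((G n).card : ℝ)⁻¹)) atTop (𝓝 0))
    {e : ℕ → ℝ} {η : ℕ → ℝ} (hη : Tendsto (fun n => s n * η n) atTop (𝓝 0))
    (he : ∀ᶠ n in atTop, |e n - (A n).card * Var[finStat H Z (A n); P]| ≤
      K * (η n + ((A n).card : ℝ)⁻¹)) :
    Tendsto (fun n => s n * (e n - (G n).card * Var[finStat H Z (G n); P])) atTop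
      (𝓝 (-((∑' k, C k * sigma P Z H k) / v))) := by
  set τ := ∑' k, sigma P Z H k
  set S := ∑' k, C k * sigma P Z H k
  set X : Finset (Fin d → ℤ) → ℝ := fun B => ∑' k, excess B k * sigma P Z H k with hX
  have hsd : ∀ n, s n ^ d = s n ^ (d - 1) * s n := fun n => by
    rw [← pow_succ]; congr 1; omega
  have hAinv : Tendsto (fun n => s n ^ d * ((A n).card : ℝ)⁻¹) atTop (𝓝 v⁻¹) := by
    refine (hA.inv₀ hv.ne').congr fun n => ?_
    rw [inv_div, div_eq_mul_inv]
  -- Here `d ≥ 2` enters: 1/N is of order s^(-d), hence o(1/s).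
  have hAs : Tendsto (fun n => s n * ((A n).card : ℝ)⁻¹) atTop (𝓝 0) := by
    have h1 : Tendsto (fun n => (s n ^ (d - 1))⁻¹) atTop (𝓝 0) :=
      ((tendsto_pow_atTop (by omega)).comp hs').inv_tendsto_atTop
    have h3 : Tendsto (fun n => s n / s n ^ d * (s n ^ d * ((A n).card : ℝ)⁻¹)) atTop
        (𝓝 (0 * v⁻¹)) := by
      refine Tendsto.mul ?_ hAinv
      refine h1.congr fun n => ?_
      have hp := (hs n).ne'
      rw [hsd]; field_simp
    rw [zero_mul] at h3
    refine h3.congr fun n => ?_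
    have hp := (hs n).ne'
    field_simp
  have hAne : ∀ᶠ n in atTop, (A n).Nonempty := by
    filter_upwards [hA.eventually (lt_mem_nhds hv)] with n hn
    rw [← Finset.card_pos]
    by_contra h0
    have : (A n).card = 0 := by omega
    simp [this] at hn
  -- the leading term
  obtain ⟨-, hXA⟩ := tendsto_tsum_excess hσ (fun n => pow_pos (hs n) (d - 1)) hC
  have hlead : Tendsto (fun n => s n * (((A n).card : ℝ)⁻¹ * X (A n))) atTop (𝓝 (S / v)) := by
    have := hXA.mul hAinv
    rw [← div_eq_mul_inv] at this
    refine this.congr fun n => ?_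
    have hp := (hs n).ne'
    rw [hsd, hX]; field_simp
  -- the negligible terms
  have hz : ∀ {f g : ℕ → ℝ}, (∀ᶠ n in atTop, |f n| ≤ g n) →
      Tendsto (fun n => s n * g n) atTop (𝓝 0) → Tendsto (fun n => s n * f n) atTop (𝓝 0) :=
    fun {f g} hfg hg => by
      refine squeeze_zero_norm' ?_ hg
      filter_upwards [hfg] with n hn
      rw [norm_mul, Real.norm_of_nonneg (hs n).le]
      exact mul_le_mul_of_nonneg_left hn (hs n).le
  have z1 : Tendsto (fun n => s n * (e n - (A n).card * Var[finStat H Z (A n); P])) atTop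
      (𝓝 0) := by
    refine hz he ?_
    have := (hη.add hAs).const_mul K
    simp only [add_zero, mul_zero] at this
    exact this.congr fun n => by ring
  have z2 : Tendsto (fun n => s n * ((A n).card * Var[finStat H Z (A n); P] -
      (τ - ((A n).card : ℝ)⁻¹ * X (A n)))) atTop (𝓝 0) := by
    refine hz (g := fun n => K * ((A n).card : ℝ)⁻¹) (hAne.mono fun n hn => hK _ hn) ?_
    have := hAs.const_mul K
    rw [mul_zero] at this
    exact this.congr fun n => by ring
  have z3 : Tendsto (fun n => s n * ((G n).card * Var[finStat H Z (G n); P] -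
      (τ - ((G n).card : ℝ)⁻¹ * X (G n)))) atTop (𝓝 0) := by
    refine hz (g := fun n => K * ((G n).card : ℝ)⁻¹) (hG'.mono fun n hn => hK _ hn) ?_
    have := hG.const_mul K
    rw [mul_zero] at this
    exact this.congr fun n => by ring
  have z4 : Tendsto (fun n => s n * (((G n).card : ℝ)⁻¹ * X (G n))) atTop (𝓝 0) := by
    refine hz (g := fun n => ((G n).card : ℝ)⁻¹ * ((∑ i, (excess (G n) (Pi.single i 1) : ℝ)) *
      ∑' k, (1 + ‖k‖) * |sigma P Z H k|)) (Eventually.of_forall fun n => ?_) ?_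
    · rw [abs_mul, abs_of_nonneg (by positivity)]
      exact mul_le_mul_of_nonneg_left (abs_tsum_excess_le hσ _) (by positivity)
    · have := (tendsto_finsetSum Finset.univ fun i _ => hGe i).mul_const
        (∑' k, (1 + ‖k‖) * |sigma P Z H k|)
      simp only [Finset.sum_const_zero, zero_mul] at this
      refine this.congr fun n => ?_
      rw [← Finset.mul_sum, ← Finset.sum_mul]
      ring
  -- The covariance sum `τ` appears in `z2` and `z3` with opposite signs and drops out. Only the
  -- boundary term of the subsample has a nonzero limit.
  have total := (((z1.add z2).sub z3).add z4).sub hlead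
  simp only [add_zero, sub_zero, zero_sub] at total
  refine total.congr fun n => ?_
  ring

end Asymptotics

/-! ### Consequences of the scaling conditions -/

section Scaling

variable {d : ℕ} {lam : ℕ → Fin d → ℝ} {slam : ℕ → ℝ} {R0 : Set (Fin d → ℝ)} {t : Fin d → ℝ}

lemma ScalingCondition.tendsto_summands (h : ScalingCondition lam slam) :
    Tendsto (fun n => (d : ℝ) / slam n) atTop (𝓝 0) ∧
    (∀ i, Tendsto (fun n => slam n / lam n i) atTop (𝓝 0)) ∧
    Tendsto (fun n => slam n ^ (d + 1) / ∏ i, lam n i) atTop (𝓝 0) := by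
  have h1 : ∀ n, 0 ≤ ∑ _i : Fin d, 1 / slam n := fun n =>
    Finset.sum_nonneg fun _ _ => (one_div_pos.mpr (h.slam_pos n)).le
  have h2' : ∀ n i, 0 ≤ slam n / lam n i := fun n i => (div_pos (h.slam_pos n) (h.lam_pos n i)).le
  have h2 : ∀ n, 0 ≤ ∑ i, slam n / lam n i := fun n => Finset.sum_nonneg fun i _ => h2' n i
  have h3 : ∀ n, 0 ≤ slam n ^ (d + 1) / ∏ i, lam n i := fun n =>
    div_nonneg (pow_nonneg (h.slam_pos n).le _) (Finset.prod_nonneg fun i _ => (h.lam_pos n i).le)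
  refine ⟨squeeze_zero (fun n => ?_) (fun n => ?_) h.small, fun i =>
    squeeze_zero (fun n => h2' n i) (fun n => ?_) h.small, squeeze_zero h3 (fun n => ?_) h.small⟩
  · exact div_nonneg (Nat.cast_nonneg _) (h.slam_pos n).le
  · have e : (d : ℝ) / slam n = ∑ _i : Fin d, 1 / slam n := by simp [div_eq_mul_inv]
    rw [e]; linarith [h2 n, h3 n]
  · have := Finset.single_le_sum (f := fun i => slam n / lam n i) (fun i _ => h2' n i)
      (Finset.mem_univ i)
    linarith [h1 n, h3 n]
  · linarith [h1 n, h2 n]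

lemma ScalingCondition.tendsto_slam (h : ScalingCondition lam slam) (hd : 2 ≤ d) :
    Tendsto slam atTop atTop := by
  have hd0 : (0 : ℝ) < d := by exact_mod_cast (by omega : 0 < d)
  have h1 : Tendsto (fun n => (slam n)⁻¹) atTop (𝓝[>] 0) := by
    refine tendsto_nhdsWithin_iff.mpr ⟨?_, Eventually.of_forall fun n => inv_pos.mpr (h.slam_pos n)⟩
    have := h.tendsto_summands.1.div_const (d : ℝ)
    rw [zero_div] at this
    refine this.congr fun n => ?_
    have := (h.slam_pos n).ne'
    field_simp
  refine h1.inv_tendsto_nhdsGT_zero.congr fun n => by simp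

lemma ScalingCondition.tendsto_lam (h : ScalingCondition lam slam) (hd : 2 ≤ d) (i : Fin d) :
    Tendsto (fun n => lam n i) atTop atTop := by
  refine tendsto_atTop_mono' _ ?_ (h.tendsto_slam hd)
  filter_upwards [(h.tendsto_summands.2.1 i).eventually (gt_mem_nhds one_pos)] with n hn
  rw [div_lt_one (h.lam_pos n i)] at hn
  exact hn.le

/-- The number of boundary cubes of side `a n`, relative to `(1 / a n)^d`. -/
lemma exists_boundaryCubes_le (hR0 : IsTemplate R0) {a : ℕ → ℝ} (ha : ∀ n, 0 < a n)
    (ha' : Tendsto a atTop (𝓝 0)) :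
    ∃ K : ℝ, 0 ≤ K ∧ ∀ᶠ n in atTop,
      ((boundaryCubes R0 (a n)).ncard : ℝ) ≤ K * ((a n)⁻¹) ^ (d - 1) := by
  obtain ⟨K, hK, hb⟩ := (hR0.boundary a ha ha').exists_nonneg
  refine ⟨K, hK, hb.bound.mono fun n hn => ?_⟩
  rwa [Real.norm_natCast, Real.norm_of_nonneg (pow_nonneg (inv_pos.mpr (ha n)).le _)] at hn

lemma tendsto_card_siteFinset (hR0 : IsTemplate R0) (hd : 2 ≤ d) {s : ℕ → ℝ} (hs : ∀ n, 0 < s n)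
    (hs' : Tendsto s atTop atTop) :
    Tendsto (fun n => ((siteFinset hR0 t (fun _ => hs n)).card : ℝ) / s n ^ d) atTop
      (𝓝 (volume.real R0)) := by
  obtain ⟨K, hK, hb⟩ := exists_boundaryCubes_le hR0 (fun n => inv_pos.mpr (hs n))
    hs'.inv_tendsto_atTop
  rw [tendsto_iff_norm_sub_tendsto_zero]
  have h0 : Tendsto (fun n => K * (s n)⁻¹) atTop (𝓝 0) := by
    simpa using hs'.inv_tendsto_atTop.const_mul K
  refine squeeze_zero' (Eventually.of_forall fun n => norm_nonneg _) ?_ h0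
  filter_upwards [hb] with n hn
  have hp := hs n
  have e : ((siteFinset hR0 t (fun _ => hs n)).card : ℝ) / s n ^ d - volume.real R0 =
      (((siteFinset hR0 t (fun _ => hs n)).card : ℝ) - s n ^ d * volume.real R0) / s n ^ d := by
    field_simp
  rw [e, norm_div, Real.norm_of_nonneg (pow_pos hp d).le, Real.norm_eq_abs,
    div_le_iff₀ (pow_pos hp d)]
  refine (abs_card_siteFinset_sub_le hR0 hp).trans (hn.trans_eq ?_)
  have : s n ^ d = s n ^ (d - 1) * s n := by rw [← pow_succ]; congr 1; omega
  rw [this, inv_inv]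
  field_simp

/-- A box around the origin inside the template already has the right order. Halving `ε` leaves room
for the shift, since |t_i| ≤ 1/2 ≤ ε λ_i / 2 eventually. -/
lemma exists_prod_le_card_siteFinset (hR0 : IsTemplate R0) (hd : 2 ≤ d)
    (ht : ∀ i, t i ∈ Set.Icc (-(1 / 2) : ℝ) (1 / 2)) (h : ScalingCondition lam slam) :
    ∃ c : ℝ, 0 < c ∧ ∀ᶠ n in atTop,
      c * ∏ i, lam n i ≤ ((siteFinset hR0 t (h.lam_pos n)).card : ℝ) := by
  obtain ⟨ε, hε, hbox⟩ := exists_box_subset hR0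
  refine ⟨(ε / 2) ^ d, by positivity, ?_⟩
  have hev : ∀ᶠ n in atTop, ∀ i, ε⁻¹ ≤ lam n i :=
    eventually_all.mpr fun i => (h.tendsto_lam hd i).eventually_ge_atTop _
  filter_upwards [hev] with n hn
  have e : (ε / 2) ^ d * ∏ i, lam n i = ∏ i, (ε / 2 * lam n i) := by
    rw [Finset.prod_mul_distrib, Finset.prod_const, Finset.card_univ, Fintype.card_fin]
  rw [e]
  refine prod_le_card (fun i => by have := h.lam_pos n i; positivity) fun k hk => ?_
  rw [mem_siteFinset]
  refine hbox _ fun i => ?_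
  have hl := h.lam_pos n i
  rw [abs_div, abs_of_pos hl, div_le_iff₀ hl]
  have h1 := abs_add_le (t i) (k i)
  have h2 : |t i| ≤ 1 / 2 := abs_le.mpr (ht i)
  have h3 : 1 ≤ ε * lam n i := by
    have := mul_le_mul_of_nonneg_left (hn i) hε.le
    rwa [mul_inv_cancel₀ hε.ne'] at this
  have h4 := hk i
  linarith

/-- For s ≥ 1 one has s ≤ s^(d+1), so the last summand of the scaling condition suffices. -/
lemma tendsto_slam_mul_inv_card (hR0 : IsTemplate R0) (hd : 2 ≤ d)
    (ht : ∀ i, t i ∈ Set.Icc (-(1 / 2) : ℝ) (1 / 2)) (h : ScalingCondition lam slam) :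
    Tendsto (fun n => slam n * ((siteFinset hR0 t (h.lam_pos n)).card : ℝ)⁻¹) atTop (𝓝 0) ∧
    ∀ᶠ n in atTop, (siteFinset hR0 t (h.lam_pos n)).Nonempty := by
  obtain ⟨c, hc, hev⟩ := exists_prod_le_card_siteFinset hR0 hd ht h
  have hprod : ∀ n, 0 < ∏ i, lam n i := fun n => Finset.prod_pos fun i _ => h.lam_pos n i
  constructor
  · have h0 := h.tendsto_summands.2.2.const_mul c⁻¹
    rw [mul_zero] at h0
    refine squeeze_zero' (Eventually.of_forall fun n => ?_) ?_ h0
    · have := (h.slam_pos n).le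
      positivity
    · filter_upwards [hev, (h.tendsto_slam hd).eventually_ge_atTop 1] with n hn hs
      have hp := hprod n
      calc slam n * ((siteFinset hR0 t (h.lam_pos n)).card : ℝ)⁻¹
          ≤ slam n ^ (d + 1) * (c * ∏ i, lam n i)⁻¹ := by
            gcongr
            exact le_self_pow₀ hs (by omega)
        _ = _ := by field_simp
  · filter_upwards [hev] with n hn
    rw [← Finset.card_pos]
    exact_mod_cast (mul_pos hc (hprod n)).trans_le hn

/-- With cubes of side `a`, the loss is O(a^(-(d-1))) and the count is at least a multiple of
a^(-d), so the ratio is O(a). -/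
lemma tendsto_slam_mul_excess (hR0 : IsTemplate R0) (hd : 2 ≤ d)
    (ht : ∀ i, t i ∈ Set.Icc (-(1 / 2) : ℝ) (1 / 2)) (h : ScalingCondition lam slam) (i : Fin d) :
    Tendsto (fun n => slam n * ((excess (siteFinset hR0 t (h.lam_pos n)) (Pi.single i 1) : ℝ) *
      ((siteFinset hR0 t (h.lam_pos n)).card : ℝ)⁻¹)) atTop (𝓝 0) := by
  obtain ⟨c, hc, hev⟩ := exists_prod_le_card_siteFinset hR0 hd ht h
  obtain ⟨K, hK⟩ := h.comparable
  -- This side makes each cube at least one lattice step wide in every direction and, by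
  -- comparability of the factors, at most `d * K` steps wide. Moreover s a is the sum of the ratios
  -- s / λ_i, which tends to 0.
  set a : ℕ → ℝ := fun n => ∑ i, (lam n i)⁻¹ with ha
  have hinv : ∀ n i, 0 < (lam n i)⁻¹ := fun n i => inv_pos.mpr (h.lam_pos n i)
  have hai : ∀ n i, (lam n i)⁻¹ ≤ a n := fun n i =>
    Finset.single_le_sum (f := fun i => (lam n i)⁻¹) (fun i _ => (hinv n i).le) (Finset.mem_univ i)
  have ha0 : ∀ n, 0 < a n := fun n => (hinv n i).trans_le (hai n i)
  have ha' : Tendsto a atTop (𝓝 0) := by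
    have := tendsto_finsetSum (Finset.univ : Finset (Fin d)) fun i _ =>
      (h.tendsto_lam hd i).inv_tendsto_atTop
    simpa using this
  have hsa : Tendsto (fun n => slam n * a n) atTop (𝓝 0) := by
    have := tendsto_finsetSum (Finset.univ : Finset (Fin d)) fun i _ => h.tendsto_summands.2.1 i
    simp only [Finset.sum_const_zero] at this
    refine this.congr fun n => ?_
    rw [ha, Finset.mul_sum]
    rfl
  obtain ⟨B, hB, hBb⟩ := exists_boundaryCubes_le hR0 ha0 ha'
  set M : ℕ := (⌊(d : ℝ) * K⌋₊ + 1) ^ d with hM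
  have h0 := hsa.const_mul (2 * (B * M) * c⁻¹)
  rw [mul_zero] at h0
  refine squeeze_zero' (Eventually.of_forall fun n => ?_) ?_ h0
  · have := (h.slam_pos n).le
    positivity
  · filter_upwards [hev, hK, hBb] with n hn hKn hBn
    have hp : 0 < ∏ i, lam n i := Finset.prod_pos fun i _ => h.lam_pos n i
    have hs := h.slam_pos n
    have han := ha0 n
    have h1 : ∀ l, 1 ≤ a n * lam n l := fun l => by
      have := mul_le_mul_of_nonneg_right (hai n l) (h.lam_pos n l).le
      rwa [inv_mul_cancel₀ (h.lam_pos n l).ne'] at this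
    have h2 : ∀ l, a n * lam n l ≤ d * K := fun l => by
      rw [ha, Finset.sum_mul]
      calc ∑ i, (lam n i)⁻¹ * lam n l ≤ ∑ _i : Fin d, K := by
            refine Finset.sum_le_sum fun i _ => ?_
            rw [inv_mul_le_iff₀ (h.lam_pos n i), mul_comm]
            exact hKn l i
        _ = d * K := by simp
    have h3 : (excess (siteFinset hR0 t (h.lam_pos n)) (Pi.single i 1) : ℝ) ≤
        2 * ((boundaryCubes R0 (a n)).ncard * M) := by
      exact_mod_cast excess_siteFinset_le hR0 (h.lam_pos n) han h1 h2 i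
    have h4 : ((a n)⁻¹) ^ d ≤ ∏ i, lam n i := by
      calc ((a n)⁻¹) ^ d = ∏ _i : Fin d, (a n)⁻¹ := by simp
        _ ≤ ∏ i, lam n i := by
          refine Finset.prod_le_prod (fun _ _ => (inv_pos.mpr han).le) fun l _ => ?_
          rw [inv_le_iff_one_le_mul₀ han, mul_comm]
          exact h1 l
    have h5 : ((siteFinset hR0 t (h.lam_pos n)).card : ℝ)⁻¹ ≤ (c * ((a n)⁻¹) ^ d)⁻¹ := by
      refine inv_anti₀ (by positivity) (le_trans ?_ hn)
      gcongr
    have h6 : ((a n)⁻¹) ^ d = ((a n)⁻¹) ^ (d - 1) * (a n)⁻¹ := by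
      rw [← pow_succ]; congr 1; omega
    calc slam n * ((excess (siteFinset hR0 t (h.lam_pos n)) (Pi.single i 1) : ℝ) *
          ((siteFinset hR0 t (h.lam_pos n)).card : ℝ)⁻¹)
        ≤ slam n * ((2 * ((B * ((a n)⁻¹) ^ (d - 1)) * M)) * (c * ((a n)⁻¹) ^ d)⁻¹) := by
          gcongr
          exact h3.trans (by gcongr)
      _ = _ := by
          rw [h6]
          field_simp

/-! ### The index sets of the estimators -/

lemma scaleSet_bounds (hR0 : IsTemplate R0) {c : Fin d → ℝ} (hc : ∀ i, 0 < c i) {x : Fin d → ℝ}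
    (hx : x ∈ scaleSet c R0) (i : Fin d) : |x i| ≤ c i / 2 := by
  have := hR0.abs_apply_le (subset_closure ((mem_scaleSet_iff hc).mp hx)) i
  rw [abs_div, abs_of_pos (hc i), div_le_iff₀ (hc i)] at this
  linarith

lemma zero_mem_template (hR0 : IsTemplate R0) : (0 : Fin d → ℝ) ∈ R0 := mem_of_mem_nhds hR0.mem_nhds_zero

lemma finite_indexOL (hR0 : IsTemplate R0) (h : ScalingCondition lam slam) (n : ℕ) :
    {i : Fin d → ℤ | translate i (scaleSet (fun _ => slam n) R0) ⊆ scaleSet (lam n) R0}.Finite := by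
  refine finite_of_forall_abs_le (fun l => lam n l / 2) fun k hk l => ?_
  refine scaleSet_bounds hR0 (h.lam_pos n) (x := fun i => (k i : ℝ)) (hk ?_) l
  rw [mem_translate_iff, mem_scaleSet_iff fun _ => h.slam_pos n]
  convert zero_mem_template hR0 using 1
  ext i
  simp

lemma finite_indexNOL (hR0 : IsTemplate R0) (h : ScalingCondition lam slam) (n : ℕ) :
    {i : Fin d → ℤ | scaleSet (fun _ => slam n) (translate i (unitCube d)) ⊆
      scaleSet (lam n) R0}.Finite := by
  have hs := h.slam_pos n
  refine finite_of_forall_abs_le (fun l => lam n l / 2 / slam n) fun k hk l => ?_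
  have := scaleSet_bounds hR0 (h.lam_pos n) (x := fun i => slam n * (k i : ℝ)) (hk ?_) l
  · rw [abs_mul, abs_of_pos hs] at this
    rw [le_div_iff₀ hs]
    linarith
  · rw [mem_scaleSet_iff fun _ => hs, mem_translate_iff]
    intro i
    have : slam n * (k i : ℝ) / slam n - k i = 0 := by field_simp; ring
    simp only [this]
    norm_num

lemma exists_card_indexOL (hR0 : IsTemplate R0) (h : ScalingCondition lam slam) :
    ∃ c : ℝ, 0 < c ∧ ∀ᶠ n in atTop,
      c * ∏ i, lam n i ≤ ((finite_indexOL hR0 h n).toFinset.card : ℝ) := by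
  obtain ⟨ε, hε, hbox⟩ := exists_box_subset hR0
  refine ⟨(ε / 2) ^ d, by positivity, ?_⟩
  -- A translated subregion extends at most s/2 < ε λ_i / 2 from its index, and the index itself is
  -- kept within ε λ_i / 2.
  have hev : ∀ᶠ n in atTop, ∀ i, slam n / lam n i < ε :=
    eventually_all.mpr fun i => (h.tendsto_summands.2.1 i).eventually (gt_mem_nhds hε)
  filter_upwards [hev] with n hn
  have e : (ε / 2) ^ d * ∏ i, lam n i = ∏ i, (ε / 2 * lam n i) := by
    rw [Finset.prod_mul_distrib, Finset.prod_const, Finset.card_univ, Fintype.card_fin]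
  rw [e]
  refine prod_le_card (fun i => by have := h.lam_pos n i; positivity) fun k hk => ?_
  rw [Set.Finite.mem_toFinset]
  intro x hx
  rw [mem_translate_iff] at hx
  rw [mem_scaleSet_iff (h.lam_pos n)]
  refine hbox _ fun i => ?_
  have hl := h.lam_pos n i
  have h1 := scaleSet_bounds hR0 (fun _ => h.slam_pos n) hx i
  have h2 := hn i
  rw [div_lt_iff₀ hl] at h2
  rw [abs_div, abs_of_pos hl, div_le_iff₀ hl]
  have h3 := abs_add_le (x i - k i) (k i)
  rw [sub_add_cancel] at h3
  have h4 := hk i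
  linarith

lemma exists_card_indexNOL (hR0 : IsTemplate R0) (h : ScalingCondition lam slam) :
    ∃ c : ℝ, 0 < c ∧ ∀ᶠ n in atTop,
      c * ((∏ i, lam n i) / slam n ^ d) ≤ ((finite_indexNOL hR0 h n).toFinset.card : ℝ) := by
  obtain ⟨ε, hε, hbox⟩ := exists_box_subset hR0
  refine ⟨(ε / 2) ^ d, by positivity, ?_⟩
  have hev : ∀ᶠ n in atTop, ∀ i, slam n / lam n i < ε :=
    eventually_all.mpr fun i => (h.tendsto_summands.2.1 i).eventually (gt_mem_nhds hε)
  filter_upwards [hev] with n hn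
  have hs := h.slam_pos n
  have e : (ε / 2) ^ d * ((∏ i, lam n i) / slam n ^ d) = ∏ i, (ε / 2 * (lam n i / slam n)) := by
    rw [Finset.prod_mul_distrib, Finset.prod_const, Finset.prod_div_distrib, Finset.prod_const,
      Finset.card_univ, Fintype.card_fin]
  rw [e]
  refine prod_le_card (fun i => by have := h.lam_pos n i; positivity) fun k hk => ?_
  rw [Set.Finite.mem_toFinset]
  intro x hx
  rw [mem_scaleSet_iff fun _ => hs, mem_translate_iff] at hx
  rw [mem_scaleSet_iff (h.lam_pos n)]
  refine hbox _ fun i => ?_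
  have hl := h.lam_pos n i
  have h1 : |x i / slam n - k i| ≤ 1 / 2 := abs_le.mpr ⟨(hx i).1.le, (hx i).2⟩
  have h2 := hn i
  rw [div_lt_iff₀ hl] at h2
  rw [abs_div, abs_of_pos hl, div_le_iff₀ hl]
  have h3 := abs_add_le (x i / slam n - k i) (k i)
  rw [sub_add_cancel, abs_div, abs_of_pos hs] at h3
  have h4 := hk i
  have h5 : |x i| / slam n ≤ 1 / 2 + ε / 2 * (lam n i / slam n) := by linarith
  rw [div_le_iff₀ hs] at h5
  have h6 : (1 / 2 + ε / 2 * (lam n i / slam n)) * slam n = slam n / 2 + ε / 2 * lam n i := by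
    field_simp
  linarith

/-- Nonoverlapping regions are disjoint. -/
lemma card_fiber_nonoverlapping_le_one (hR0 : IsTemplate R0) {s : ℝ} (hs : 0 < s) {m : ℕ} (hm : s = m)
    (J : Finset (Fin d → ℤ)) (z : Fin d → ℤ) :
    ((J ×ˢ siteFinset hR0 t (fun _ => hs)).filter
      fun q => q.2 + (m : ℤ) • q.1 = z).card ≤ 1 := by
  rw [Finset.card_le_one]
  rintro ⟨i, x⟩ hq ⟨j, y⟩ hq'
  simp only [Finset.mem_filter, Finset.mem_product, mem_siteFinset] at hq hq'
  obtain ⟨⟨-, hx⟩, hxz⟩ := hq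
  obtain ⟨⟨-, hy⟩, hyz⟩ := hq'
  have hij : i = j := by
    ext l
    have e1 : (x l : ℝ) + s * i l = z l := by
      rw [hm, ← hxz]; simp
    have e2 : (y l : ℝ) + s * j l = z l := by
      rw [hm, ← hyz]; simp
    have b1 := hR0.subset_unitCube hx l
    have b2 := hR0.subset_unitCube hy l
    -- Both points lie in the cube (-1/2, 1/2]^d and differ by `i - j`. As the cube is half-open,
    -- each coordinate of this integer vector is strictly between -1 and 1.
    have d1 : (t l + x l) / s = (t l + z l) / s - i l := by
      rw [← e1]; field_simp; ring
    have d2 : (t l + y l) / s = (t l + z l) / s - j l := by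
      rw [← e2]; field_simp; ring
    simp only [d1, d2] at b1 b2
    have h1 : (i l : ℝ) < j l + 1 := by linarith [b1.1, b1.2, b2.1, b2.2]
    have h2 : (j l : ℝ) < i l + 1 := by linarith [b1.1, b1.2, b2.1, b2.2]
    have h1' : i l < j l + 1 := by exact_mod_cast h1
    have h2' : j l < i l + 1 := by exact_mod_cast h2
    omega
  subst hij
  have : x = y := add_right_cancel (hxz.trans hyz.symm)
  rw [this]

/-- For a given `z` the relative position in the subregion determines the index, so a site is shared
by at most as many translates as a translate has sites. -/
lemma card_fiber_le_card (A J : Finset (Fin d → ℤ)) (z : Fin d → ℤ) :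
    ((J ×ˢ A).filter fun q => q.2 + q.1 = z).card ≤ A.card := by
  refine Finset.card_le_card_of_injOn (fun q => q.2) ?_ ?_
  · rintro ⟨i, x⟩ hq
    have hq := Finset.mem_coe.mp hq
    simp only [Finset.mem_filter, Finset.mem_product] at hq
    exact Finset.mem_coe.mpr hq.1.2
  · rintro ⟨i, x⟩ hq ⟨j, y⟩ hq' hxy
    have hq := Finset.mem_coe.mp hq
    have hq' := Finset.mem_coe.mp hq'
    simp only [Finset.mem_filter] at hq hq' hxy
    have hij : i = j := by
      have := hq.2.trans hq'.2.symm
      rw [hxy] at this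
      exact add_left_cancel this
    rw [hij, hxy]

/-- Integrality of the scale turns the nonoverlapping regions into integer translates of one
prototype. Their sites are then shifts of a single set, and stationarity applies. -/
lemma scaleSet_translate {s : ℝ} (hs : 0 < s) {m : ℕ} (hm : s = m) (i : Fin d → ℤ)
    (R : Set (Fin d → ℝ)) : scaleSet (fun _ => s) (translate i R) =
      translate ((m : ℤ) • i) (scaleSet (fun _ => s) R) := by
  ext x
  rw [mem_scaleSet_iff fun _ => hs, mem_translate_iff, mem_translate_iff,
    mem_scaleSet_iff fun _ => hs]
  have : (fun l => x l / s - i l) = fun l => (x l - (((m : ℤ) • i) l : ℤ)) / s := funext fun l => by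
    simp [← hm]
    field_simp
  rw [this]

end Scaling

/-- A bound of order `s ^ (d + 1) / ∏ λ` is negligible. -/
lemma tendsto_mul_inv_of_prod_le {d : ℕ} {lam : ℕ → Fin d → ℝ} {slam : ℕ → ℝ}
    (h : ScalingCondition lam slam) {κ M : ℕ → ℝ} {c v : ℝ} (hc : 0 < c) (hκ : ∀ n, 0 ≤ κ n)
    (hκ' : Tendsto (fun n => κ n / slam n ^ d) atTop (𝓝 v))
    (hM : ∀ᶠ n in atTop, c * ∏ i, lam n i ≤ M n) :
    Tendsto (fun n => slam n * (κ n * (M n)⁻¹)) atTop (𝓝 0) := by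
  have h0 := (hκ'.mul h.tendsto_summands.2.2).const_mul c⁻¹
  rw [mul_zero, mul_zero] at h0
  have hprod : ∀ n, 0 < ∏ i, lam n i := fun n => Finset.prod_pos fun i _ => h.lam_pos n i
  refine squeeze_zero' ?_ ?_ h0
  · filter_upwards [hM] with n hn
    have h1 := (mul_pos hc (hprod n)).trans_le hn
    exact mul_nonneg (h.slam_pos n).le (mul_nonneg (hκ n) (inv_pos.mpr h1).le)
  · filter_upwards [hM] with n hn
    have hs := h.slam_pos n
    have hp := hprod n
    have hk := hκ n
    calc slam n * (κ n * (M n)⁻¹) ≤ slam n * (κ n * (c * ∏ i, lam n i)⁻¹) := by gcongr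
      _ = _ := by rw [pow_succ]; field_simp

end SpatialSubsampling

/-! ### Assembly of the bias expansions -/

open SpatialSubsampling in
theorem theorem4p1 {d p : ℕ} (hd : 2 ≤ d)
    {Ω : Type*} [MeasurableSpace Ω] (P : Measure Ω) [IsProbabilityMeasure P]
    -- the lattice translate and the stationary random field
    (t : Fin d → ℝ) (ht : ∀ i, t i ∈ Set.Icc (-(1 / 2) : ℝ) (1 / 2))
    (Z : (Fin d → ℤ) → Ω → EuclideanSpace ℝ (Fin p)) (hZ : ∀ k, Measurable (Z k))
    (hstat : SpatialSubsampling.IsStationary P Z)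
    -- the template and the scaling factors
    (R0 : Set (Fin d → ℝ)) (hR0 : SpatialSubsampling.IsTemplate R0)
    (lam : ℕ → Fin d → ℝ) (slam : ℕ → ℝ)
    (hscale : SpatialSubsampling.ScalingCondition lam slam)
    -- mixing, smoothness and moments
    (H : EuclideanSpace ℝ (Fin p) → ℝ) (a : ℕ)
    (hH : SpatialSubsampling.SmoothCondition H 3 a)
    (α₁ g : ℝ → ℝ) (hmix : SpatialSubsampling.MixingBound P Z α₁ g)
    (hpoint : SpatialSubsampling.PointMixing P Z)
    (hmom : SpatialSubsampling.MomentCondition P Z α₁ g (3 + a))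
    (hτ : 0 < ∑' k : Fin d → ℤ, SpatialSubsampling.sigma P Z H k)
    -- the scaled differences of lattice counts converge
    (C : (Fin d → ℤ) → ℝ)
    (hC : ∀ k : Fin d → ℤ, Tendsto (fun n =>
      ((SpatialSubsampling.siteCount t (SpatialSubsampling.scaleSet (fun _ => slam n) R0) : ℝ)
        - (SpatialSubsampling.siteCount t (SpatialSubsampling.scaleSet (fun _ => slam n) R0 ∩
            SpatialSubsampling.translate k
              (SpatialSubsampling.scaleSet (fun _ => slam n) R0)) : ℝ))
        / slam n ^ (d - 1)) atTop (𝓝 (C k))) :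
    -- the quantities in the expansion are well defined
    Summable (fun k => C k * SpatialSubsampling.sigma P Z H k) ∧
    (∀ n, MemLp (SpatialSubsampling.statistic H Z t
      (SpatialSubsampling.scaleSet (lam n) R0)) 2 P) ∧
    -- overlapping subsamples
    ((∀ n, Integrable (SpatialSubsampling.estimatorOL H Z t R0
        (SpatialSubsampling.scaleSet (lam n) R0) (fun _ => slam n)) P) ∧
      SpatialSubsampling.BiasExpansion
        (fun n => (∫ ω, SpatialSubsampling.estimatorOL H Z t R0
            (SpatialSubsampling.scaleSet (lam n) R0) (fun _ => slam n) ω ∂P)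
          - SpatialSubsampling.targetVariance P H Z t (SpatialSubsampling.scaleSet (lam n) R0))
        slam (volume.real R0) (∑' k, C k * SpatialSubsampling.sigma P Z H k)) ∧
    -- nonoverlapping subsamples
    ((∀ n, ∃ m : ℕ, slam n = m) →
      (∀ n, Integrable (SpatialSubsampling.estimatorNOL H Z t R0
        (SpatialSubsampling.scaleSet (lam n) R0) (fun _ => slam n)) P) ∧
      SpatialSubsampling.BiasExpansion
        (fun n => (∫ ω, SpatialSubsampling.estimatorNOL H Z t R0
            (SpatialSubsampling.scaleSet (lam n) R0) (fun _ => slam n) ω ∂P)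
          - SpatialSubsampling.targetVariance P H Z t (SpatialSubsampling.scaleSet (lam n) R0))
        slam (volume.real R0) (∑' k, C k * SpatialSubsampling.sigma P Z H k)) := by
  classical
  have hr : 3 ≤ 3 + a := by omega
  obtain ⟨hLp, K, hdec⟩ := exists_momentDecay hd hZ hstat hmix hr hmom
  obtain ⟨hθ, K', hK', hvar, hbias⟩ := exists_bias_bounds hZ hstat hH hLp hdec
  obtain ⟨Kσ, hKσ, hσ⟩ := hdec.exists_sigma_bound (H := H) (by omega) hZ hstat
    (memLp_two_of_memLp hLp (by omega))
  have hσs : Summable fun k => (1 + ‖k‖) * |sigma P Z H k| :=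
    Summable.of_nonneg_of_le (fun k => by positivity) hσ ((summable_latticeWeight d).mul_left Kσ)
  set A : ℕ → Finset (Fin d → ℤ) := fun n => siteFinset hR0 t (fun _ => hscale.slam_pos n)
  set G : ℕ → Finset (Fin d → ℤ) := fun n => siteFinset hR0 t (hscale.lam_pos n)
  have hAc : ∀ n, (A n : Set (Fin d → ℤ)) = sites t (scaleSet (fun _ => slam n) R0) := fun n =>
    coe_siteFinset hR0 _
  have hGc : ∀ n, (G n : Set (Fin d → ℤ)) = sites t (scaleSet (lam n) R0) := fun n =>
    coe_siteFinset hR0 _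
  simp_rw [fun n k => siteCount_sub_siteCount_inter (hAc n) k] at hC
  have hst := hscale.tendsto_slam hd
  have hAv := tendsto_card_siteFinset (t := t) hR0 hd hscale.slam_pos hst
  obtain ⟨hG, hGne⟩ := tendsto_slam_mul_inv_card hR0 hd ht hscale
  have hGe := tendsto_slam_mul_excess hR0 hd ht hscale
  have htarget : ∀ n, targetVariance P H Z t (scaleSet (lam n) R0) =
      (G n).card * Var[finStat H Z (G n); P] := fun n => by
    rw [targetVariance, siteCount_eq_card (hGc n), statistic_eq_finStat (hGc n)]
  have hAne : ∀ᶠ n in atTop, (A n).Nonempty := by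
    filter_upwards [hAv.eventually (lt_mem_nhds hR0.volume_pos)] with n hn
    rw [← Finset.card_pos]
    by_contra h0
    have h1 : (A n).card = 0 := by omega
    simp [A] at h1
    simp [h1] at hn
  have hprod : ∀ n, 0 < ∏ i, lam n i := fun n => Finset.prod_pos fun i _ => hscale.lam_pos n i
  -- the expansion for an estimator built from translates of the prototype subregion
  have main : ∀ (est : ℕ → Ω → ℝ) (J : ℕ → Finset (Fin d → ℤ))
      (u : ℕ → (Fin d → ℤ) → (Fin d → ℤ)) (κ : ℕ → ℕ),
      (∀ n ω, est n ω = ((J n).card : ℝ)⁻¹ * ∑ i ∈ J n, (A n).card *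
        (finStat H Z (shift (A n) (u n i)) ω -
          ((J n).card : ℝ)⁻¹ * ∑ j ∈ J n, finStat H Z (shift (A n) (u n j)) ω) ^ 2) →
      (∀ᶠ n in atTop, (J n).Nonempty) →
      (∀ n z, ((J n ×ˢ A n).filter fun q => q.2 + u n q.1 = z).card ≤ κ n) →
      Tendsto (fun n => slam n * ((κ n : ℝ) * ((J n).card : ℝ)⁻¹)) atTop (𝓝 0) →
      (∀ n, Integrable (est n) P) ∧ BiasExpansion
        (fun n => (∫ ω, est n ω ∂P) - targetVariance P H Z t (scaleSet (lam n) R0))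
        slam (volume.real R0) (∑' k, C k * sigma P Z H k) := by
    intro est J u κ hest hJ hκ hlim
    refine ⟨fun n => ?_, biasExpansion_of_tendsto hscale.slam_pos hR0.volume_pos ?_⟩
    · rw [funext (hest n)]
      exact integrable_subsample_average (J n) (fun i => hθ (shift (A n) (u n i))) fun _ =>
        ((A n).card : ℝ)
    · simp_rw [htarget, hest]
      refine tendsto_scaled_bias hd hvar hσs hscale.slam_pos hst hR0.volume_pos hAv hC hG hGne hGe
        hlim ?_
      filter_upwards [hAne, hJ] with n hAn hJn
      exact hbias (A n) (J n) (u n) (κ n) hAn hJn (hκ n)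
  refine ⟨(tendsto_tsum_excess hσs (fun n => pow_pos (hscale.slam_pos n) (d - 1)) hC).1,
    fun n => ?_, ?_, fun hint => ?_⟩
  · rw [statistic_eq_finStat (hGc n)]
    exact hθ _
  · obtain ⟨c, hc, hJc⟩ := exists_card_indexOL hR0 hscale
    refine main _ (fun n => (finite_indexOL hR0 hscale n).toFinset) (fun _ i => i)
      (fun n => (A n).card) (fun n ω => ?_) ?_ (fun n z => card_fiber_le_card _ _ z) ?_
    · rw [← subsampleEstimator_eq (fun i => coe_shift i (hAc n)), Set.Finite.coe_toFinset]
      rfl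
    · filter_upwards [hJc] with n hn
      rw [← Finset.card_pos]
      exact_mod_cast (mul_pos hc (hprod n)).trans_le hn
    · exact tendsto_mul_inv_of_prod_le hscale hc (fun n => Nat.cast_nonneg _) hAv hJc
  · choose m hm using hint
    obtain ⟨c, hc, hJc⟩ := exists_card_indexNOL hR0 hscale
    refine main _ (fun n => (finite_indexNOL hR0 hscale n).toFinset) (fun n i => (m n : ℤ) • i)
      (fun _ => 1) (fun n ω => ?_) ?_
      (fun n z => card_fiber_nonoverlapping_le_one hR0 (hscale.slam_pos n) (hm n) _ z) ?_
    · have hR : ∀ i, (shift (A n) ((m n : ℤ) • i) : Set (Fin d → ℤ)) =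
          sites t (scaleSet (fun _ => slam n) (translate i R0)) := fun i => by
        rw [scaleSet_translate (hscale.slam_pos n) (hm n)]
        exact coe_shift _ (hAc n)
      rw [← subsampleEstimator_eq (u := fun i => (m n : ℤ) • i) hR, Set.Finite.coe_toFinset]
      rfl
    · filter_upwards [hJc] with n hn
      rw [← Finset.card_pos]
      exact_mod_cast (mul_pos hc (div_pos (hprod n) (pow_pos (hscale.slam_pos n) d))).trans_le hn
    -- The number of nonoverlapping regions is bounded below by a multiple of det Δ / s^d. Numerator
    -- and denominator of 1/|J| are both multiplied by s^d to reach the form required by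
    -- `tendsto_mul_inv_of_prod_le`.
    · have h1 : Tendsto (fun n => slam n ^ d / slam n ^ d) atTop (𝓝 1) := by
        refine tendsto_const_nhds.congr fun n => ?_
        rw [div_self (pow_pos (hscale.slam_pos n) d).ne']
      have h2 := tendsto_mul_inv_of_prod_le hscale hc
        (M := fun n => slam n ^ d * ((finite_indexNOL hR0 hscale n).toFinset.card : ℝ))
        (fun n => (pow_pos (hscale.slam_pos n) d).le) h1 ?_
      · refine h2.congr fun n => ?_
        have := (hscale.slam_pos n).ne'
        rw [mul_inv, Nat.cast_one, one_mul]
        field_simp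
      · filter_upwards [hJc] with n hn
        have hs := pow_pos (hscale.slam_pos n) d
        rw [← mul_div_assoc, div_le_iff₀ hs] at hn
        linarith
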